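/- Let $\mathbf X,\mathbf Y_1,\mathbf Y_2$ be jointly Gaussian, zero-mean random vectors of sizes $k,k_1,k_2$ such that the conditional covariance matrices $K_{\mathbf X|\mathbf Y_1}$ and $K_{\mathbf X|\mathbf Y_2}$ are invertible. For matrices, $A\preceq B$ means that $B-A$ is positive semidefinite (PSD). Let $\Gamma_1,\Gamma_2$ be linear maps sending $k\times k$ PSD matrices to $k_0\times k_0$ PSD matrices with $A\preceq B\Rightarrow\Gamma_i(A)\preceq\Gamma_i(B)$, and let $D_1,D_2$ be positive definite $k_0\times k_0$ matrices, $\mathbf D=(D_1,D_2)$. For random vectors, $K_{\mathbf X|\mathbf Z}=E\big[(\mathbf X-E[\mathbf X|\mathbf Z])(\mathbf X-E[\mathbf X|\mathbf Z])^T\big]$, $\mathbf A\leftrightarrow\mathbf B\leftrightarrow\mathbf C$ means that $\mathbf A$ and $\mathbf C$ are conditionally independent given $\mathbf B$, and $I(\cdot\,;\cdot\,|\,\cdot)\in[0,\infty]$ is conditional mutual information (with the natural logarithm). Let $(\mathbf X_t,\mathbf Y_{1,t},\mathbf Y_{2,t})_{t=1}^n$ be i.i.d. copies of $(\mathbf X,\mathbf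 Y_1,\mathbf Y_2)$. An $(n,M,D_1,D_2)$ code ($n\ge 1$) consists of (measurable) maps $f:\mathbb R^{kn}\to\{1,\dots,M\}$ and $g_i:\{1,\dots,M\}\times\mathbb R^{k_in}\to\mathbb R^{kn}$, $i=1,2$, such that, with $\widehat{\mathbf X}_i^n=g_i(f(\mathbf X^n),\mathbf Y_i^n)$, $$E\Big[\frac1n\sum_{t=1}^n\Gamma_i\big((\mathbf X_t-\widehat{\mathbf X}_{i,t})(\mathbf X_t-\widehat{\mathbf X}_{i,t})^T\big)\Big]\preceq D_i,\qquad i=1,2,$$ where the expectation is required to exist. A rate $R$ is $\mathbf D$-achievable if for every $\epsilon>0$ there is an $(n,M,D_1+\epsilon I,D_2+\epsilon I)$ code with $n^{-1}\log M\le R+\epsilon$, and $R(\mathbf D)$ is the infimum of the $\mathbf D$-achievable rates. Let $S_G$ be the set of random vectors $\mathbf Y$ (of any size) that are jointly Gaussian with $(\mathbf X,\mathbf Y_1,\mathbf Y_2)$ (zero-mean) and satisfy $\mathbf X\leftrightarrow\mathbf Y\leftrightarrow(\mathbf Y_1,\mathbf Y_2)$. For $\mathbf Y\in S_G$ let $\widetilde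 C_{l1}(\mathbf D)$ be the set of triples $(\mathbf W,\mathbf U,\mathbf V)$ of random vectors (of any sizes, jointly distributed with $(\mathbf X,\mathbf Y_1,\mathbf Y_2,\mathbf Y)$) such that $$(\mathbf W,\mathbf U,\mathbf V)\leftrightarrow\mathbf X\leftrightarrow(\mathbf Y,\mathbf Y_1,\mathbf Y_2),\quad \Gamma_1(K_{\mathbf X|\mathbf W,\mathbf U,\mathbf Y_1})\preceq D_1,\quad \Gamma_2(K_{\mathbf X|\mathbf W,\mathbf U,\mathbf V,\mathbf Y})\preceq D_2,$$ and $\widetilde C_{l2}(\mathbf D)$ the set of those such that $$(\mathbf W,\mathbf U,\mathbf V)\leftrightarrow\mathbf X\leftrightarrow(\mathbf Y,\mathbf Y_1,\mathbf Y_2),\quad \Gamma_1(K_{\mathbf X|\mathbf W,\mathbf U,\mathbf V,\mathbf Y})\preceq D_1,\quad \Gamma_2(K_{\mathbf X|\mathbf W,\mathbf V,\mathbf Y_2})\preceq D_2.$$ Put $$R_{lo1}=I(\mathbf X;\mathbf W,\mathbf U|\mathbf Y_1)+I(\mathbf X;\mathbf V|\mathbf W,\mathbf U,\mathbf Y),\qquad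 R_{lo2}=I(\mathbf X;\mathbf W,\mathbf V|\mathbf Y_2)+I(\mathbf X;\mathbf U|\mathbf W,\mathbf V,\mathbf Y).$$ **Proposition (enhancement lower bound).** $$R(\mathbf D)\ \ge\ \max\Big\{\sup_{\mathbf Y\in S_G}\ \inf_{\widetilde C_{l1}(\mathbf D)}R_{lo1},\ \ \sup_{\mathbf Y\in S_G}\ \inf_{\widetilde C_{l2}(\mathbf D)}R_{lo2}\Big\}.$$ -/

import Mathlib

open MeasureTheory ProbabilityTheory
open scoped ENNReal

namespace GaussSI

/-- Column vectors of size `k`. -/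
abbrev Vec (k : ℕ) : Type := Fin k → ℝ

/-- Real square matrices of size `k`. -/
abbrev Mat (k : ℕ) : Type := Matrix (Fin k) (Fin k) ℝ

/-- The positive semidefinite order: `A ⪯ B` when `B - A` is positive semidefinite. -/
def PsdLE {k : ℕ} (A B : Mat k) : Prop := (B - A).PosSemidef

/-- The admissible distortion maps: linear, sending positive semidefinite matrices to positive
semidefinite matrices, and monotone. Only the values at positive semidefinite matrices are ever
used; a map that is additive and positively homogeneous on the positive semidefinite cone
is the restriction of such a linear map. -/
structure IsDistortionMap {k k₀ : ℕ} (Γ : Mat k →ₗ[ℝ] Mat k₀) : Prop where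
  posSemidef : ∀ A : Mat k, A.PosSemidef → (Γ A).PosSemidef
  mono : ∀ A B : Mat k, A.PosSemidef → B.PosSemidef → PsdLE A B → PsdLE (Γ A) (Γ B)

section RandomVectors

variable {Ω α β γ : Type*} [MeasurableSpace Ω] [MeasurableSpace α] [MeasurableSpace β]
  [MeasurableSpace γ]

/-- `K_{X|Z} = E[(X - E[X|Z]) (X - E[X|Z])ᵀ]`, the (averaged) conditional covariance matrix of the
random vector `X` given `Z`. -/
noncomputable def condCov {k : ℕ} (μ : Measure Ω) (X : Ω → Vec k) (Z : Ω → α) : Mat k :=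
  Matrix.of fun i j =>
    ∫ ω, (X ω i - (μ[fun ω' => X ω' i | MeasurableSpace.comap Z inferInstance]) ω) *
         (X ω j - (μ[fun ω' => X ω' j | MeasurableSpace.comap Z inferInstance]) ω) ∂μ

/-- The conditional mutual information `I(A;B|C)`, in nats: the Kullback-Leibler divergence of the
law of `(C, A, B)` from the law under which `A` and `B` have the same conditional laws given `C`
but are conditionally independent given `C`. -/
noncomputable def condMutualInfo [StandardBorelSpace α] [Nonempty α] [StandardBorelSpace β]
    [Nonempty β] (μ : Measure Ω) [IsFiniteMeasure μ] (A : Ω → α) (B : Ω → β) (C : Ω → γ) :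
    ℝ≥0∞ :=
  InformationTheory.klDiv (μ.map fun ω => (C ω, A ω, B ω))
    (Measure.compProd (μ.map C) (Kernel.prod (condDistrib A C μ) (condDistrib B C μ)))

/-- The Markov chain `A ↔ B ↔ C`: `A` and `C` are conditionally independent given `B`. -/
def IsMarkovChain [StandardBorelSpace Ω] (μ : Measure Ω) [IsFiniteMeasure μ]
    (A : Ω → α) (B : Ω → β) (C : Ω → γ) : Prop :=
  ∃ hB : Measurable B, CondIndepFun (MeasurableSpace.comap B inferInstance) hB.comap_le A C μ

/-- A centered Gaussian law (the covariance may be singular). -/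
def IsCenteredGaussian {E : Type*} [NormedAddCommGroup E] [NormedSpace ℝ E] [MeasurableSpace E]
    (μ : Measure E) : Prop :=
  IsGaussian μ ∧ ∫ x, x ∂μ = 0

/-- The expectation of `(1/n) ∑ₜ Γ((Xₜ - X̂ₜ)(Xₜ - X̂ₜ)ᵀ)` exists and is `⪯ D`. -/
def MeetsDistortion {k k₀ n : ℕ} (μ : Measure Ω) (Γ : Mat k →ₗ[ℝ] Mat k₀) (D : Mat k₀)
    (X Xhat : Ω → Fin n → Vec k) : Prop :=
  let d : Ω → Mat k₀ := fun ω =>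
    (n : ℝ)⁻¹ • ∑ t, Γ (Matrix.vecMulVec (X ω t - Xhat ω t) (X ω t - Xhat ω t))
  (∀ i j, Integrable (fun ω => d ω i j) μ) ∧ PsdLE (Matrix.of fun i j => ∫ ω, d ω i j ∂μ) D

end RandomVectors

section Coding

variable {k k₁ k₂ k₀ m a b c : ℕ}

/-- `(f, g₁, g₂)` is an `(n, M, D₁, D₂)` code for `n` independent copies of `(X, Y₁, Y₂) ∼ P`. -/
structure IsCode (P : Measure (Vec k × Vec k₁ × Vec k₂)) (Γ₁ Γ₂ : Mat k →ₗ[ℝ] Mat k₀)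
    (n M : ℕ) (D₁ D₂ : Mat k₀) (f : (Fin n → Vec k) → Fin M)
    (g₁ : Fin M × (Fin n → Vec k₁) → (Fin n → Vec k))
    (g₂ : Fin M × (Fin n → Vec k₂) → (Fin n → Vec k)) : Prop where
  blockLength_pos : 0 < n
  measurable_f : Measurable f
  measurable_g₁ : Measurable g₁
  measurable_g₂ : Measurable g₂
  distortion₁ : MeetsDistortion (Measure.pi fun _ : Fin n => P) Γ₁ D₁
    (fun ω t => (ω t).1) (fun ω => g₁ (f (fun t => (ω t).1), fun t => (ω t).2.1))
  distortion₂ : MeetsDistortion (Measure.pi fun _ : Fin n => P) Γ₂ D₂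
    (fun ω t => (ω t).1) (fun ω => g₂ (f (fun t => (ω t).1), fun t => (ω t).2.2))

/-- The rate `R` (in nats per source symbol) is `(D₁, D₂)`-achievable. -/
def IsAchievable (P : Measure (Vec k × Vec k₁ × Vec k₂)) (Γ₁ Γ₂ : Mat k →ₗ[ℝ] Mat k₀)
    (D₁ D₂ : Mat k₀) (R : ℝ) : Prop :=
  ∀ ε : ℝ, 0 < ε → ∃ (n M : ℕ) (f : (Fin n → Vec k) → Fin M)
    (g₁ : Fin M × (Fin n → Vec k₁) → (Fin n → Vec k))
    (g₂ : Fin M × (Fin n → Vec k₂) → (Fin n → Vec k)),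
    IsCode P Γ₁ Γ₂ n M (D₁ + ε • (1 : Mat k₀)) (D₂ + ε • (1 : Mat k₀)) f g₁ g₂ ∧
      (n : ℝ)⁻¹ * Real.log M ≤ R + ε

/-- The rate-distortion function `R(D)`, the infimum of the achievable rates. -/
noncomputable def rateDistortion (P : Measure (Vec k × Vec k₁ × Vec k₂))
    (Γ₁ Γ₂ : Mat k →ₗ[ℝ] Mat k₀) (D₁ D₂ : Mat k₀) : EReal :=
  sInf {r : EReal | ∃ R : ℝ, IsAchievable P Γ₁ Γ₂ D₁ D₂ R ∧ r = (R : EReal)}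

/-- Values of `(X, Y₁, Y₂, Y)`, where `Y` has size `m`. -/
abbrev EnhSpace (k k₁ k₂ m : ℕ) : Type := Vec k × Vec k₁ × Vec k₂ × Vec m

instance : StandardBorelSpace (EnhSpace k k₁ k₂ m) :=
  inferInstanceAs (StandardBorelSpace (Vec k × Vec k₁ × Vec k₂ × Vec m))

/-- `S_G`, in terms of the joint law `Q` of `(X, Y₁, Y₂, Y)`: the triple `(X, Y₁, Y₂)` has the
given law `P`, all four vectors are jointly (centered) Gaussian, and `X ↔ Y ↔ (Y₁, Y₂)`. -/
structure IsGaussianEnhancement (P : Measure (Vec k × Vec k₁ × Vec k₂))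
    (Q : ProbabilityMeasure (EnhSpace k k₁ k₂ m)) : Prop where
  marginal : (Q : Measure (EnhSpace k k₁ k₂ m)).map (fun q => (q.1, q.2.1, q.2.2.1)) = P
  gaussian : IsCenteredGaussian (Q : Measure (EnhSpace k k₁ k₂ m))
  markov : IsMarkovChain (Q : Measure (EnhSpace k k₁ k₂ m))
    (fun q => q.1) (fun q => q.2.2.2) (fun q => (q.2.1, q.2.2.1))

/-- Values of `((X, Y₁, Y₂, Y), (W, U, V))`, where `W`, `U`, `V` have sizes `a`, `b`, `c`. -/
abbrev AuxSpace (k k₁ k₂ m a b c : ℕ) : Type := EnhSpace k k₁ k₂ m × Vec a × Vec b × Vec c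

instance : StandardBorelSpace (AuxSpace k k₁ k₂ m a b c) :=
  haveI : StandardBorelSpace (Vec a × Vec b × Vec c) := inferInstance
  inferInstanceAs (StandardBorelSpace (EnhSpace k k₁ k₂ m × (Vec a × Vec b × Vec c)))

namespace AuxSpace

/-- The source. -/
def X (ω : AuxSpace k k₁ k₂ m a b c) : Vec k := ω.1.1
/-- The side information at decoder 1. -/
def Y₁ (ω : AuxSpace k k₁ k₂ m a b c) : Vec k₁ := ω.1.2.1
/-- The side information at decoder 2. -/
def Y₂ (ω : AuxSpace k k₁ k₂ m a b c) : Vec k₂ := ω.1.2.2.1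
/-- The enhanced side information. -/
def Y (ω : AuxSpace k k₁ k₂ m a b c) : Vec m := ω.1.2.2.2
/-- First auxiliary vector. -/
def W (ω : AuxSpace k k₁ k₂ m a b c) : Vec a := ω.2.1
/-- Second auxiliary vector. -/
def U (ω : AuxSpace k k₁ k₂ m a b c) : Vec b := ω.2.2.1
/-- Third auxiliary vector. -/
def V (ω : AuxSpace k k₁ k₂ m a b c) : Vec c := ω.2.2.2

end AuxSpace

open AuxSpace

/-- `μ` is a joint law of `((X, Y₁, Y₂, Y), (W, U, V))` whose first component has law `Q` and
for which `(W, U, V) ↔ X ↔ (Y, Y₁, Y₂)`. -/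
structure IsAuxLaw (Q : ProbabilityMeasure (EnhSpace k k₁ k₂ m))
    (μ : ProbabilityMeasure (AuxSpace k k₁ k₂ m a b c)) : Prop where
  marginal : (μ : Measure (AuxSpace k k₁ k₂ m a b c)).map Prod.fst = Q
  markov : IsMarkovChain (μ : Measure (AuxSpace k k₁ k₂ m a b c))
    (fun ω => (W ω, U ω, V ω)) X (fun ω => (Y ω, Y₁ ω, Y₂ ω))

/-- The set `C̃_{l1}(D)`: the Markov condition, `Γ₁(K_{X|W,U,Y₁}) ⪯ D₁`
and `Γ₂(K_{X|W,U,V,Y}) ⪯ D₂`. -/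
def Cl1 (Γ₁ Γ₂ : Mat k →ₗ[ℝ] Mat k₀) (D₁ D₂ : Mat k₀)
    (Q : ProbabilityMeasure (EnhSpace k k₁ k₂ m)) (a b c : ℕ) :
    Set (ProbabilityMeasure (AuxSpace k k₁ k₂ m a b c)) :=
  {μ | IsAuxLaw Q μ ∧
    PsdLE (Γ₁ (condCov (μ : Measure (AuxSpace k k₁ k₂ m a b c)) X
      (fun ω => (W ω, U ω, Y₁ ω)))) D₁ ∧
    PsdLE (Γ₂ (condCov (μ : Measure (AuxSpace k k₁ k₂ m a b c)) X
      (fun ω => (W ω, U ω, V ω, Y ω)))) D₂}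

/-- The set `C̃_{l2}(D)`: the Markov condition, `Γ₁(K_{X|W,U,V,Y}) ⪯ D₁`
and `Γ₂(K_{X|W,V,Y₂}) ⪯ D₂`. -/
def Cl2 (Γ₁ Γ₂ : Mat k →ₗ[ℝ] Mat k₀) (D₁ D₂ : Mat k₀)
    (Q : ProbabilityMeasure (EnhSpace k k₁ k₂ m)) (a b c : ℕ) :
    Set (ProbabilityMeasure (AuxSpace k k₁ k₂ m a b c)) :=
  {μ | IsAuxLaw Q μ ∧
    PsdLE (Γ₁ (condCov (μ : Measure (AuxSpace k k₁ k₂ m a b c)) X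
      (fun ω => (W ω, U ω, V ω, Y ω)))) D₁ ∧
    PsdLE (Γ₂ (condCov (μ : Measure (AuxSpace k k₁ k₂ m a b c)) X
      (fun ω => (W ω, V ω, Y₂ ω)))) D₂}

/-- `R_{lo1} = I(X; W,U | Y₁) + I(X; V | W,U,Y)`. -/
noncomputable def Rlo1 (μ : ProbabilityMeasure (AuxSpace k k₁ k₂ m a b c)) : ℝ≥0∞ :=
  condMutualInfo (μ : Measure (AuxSpace k k₁ k₂ m a b c)) X (fun ω => (W ω, U ω)) Y₁ +
  condMutualInfo (μ : Measure (AuxSpace k k₁ k₂ m a b c)) X V (fun ω => (W ω, U ω, Y ω))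

/-- `R_{lo2} = I(X; W,V | Y₂) + I(X; U | W,V,Y)`. -/
noncomputable def Rlo2 (μ : ProbabilityMeasure (AuxSpace k k₁ k₂ m a b c)) : ℝ≥0∞ :=
  condMutualInfo (μ : Measure (AuxSpace k k₁ k₂ m a b c)) X (fun ω => (W ω, V ω)) Y₂ +
  condMutualInfo (μ : Measure (AuxSpace k k₁ k₂ m a b c)) X U (fun ω => (W ω, V ω, Y ω))

/-- The enhancement lower bound: the suprema run over all `Y ∈ S_G` (of any size `m`), the infima
over all random vectors `(W, U, V)` (of any sizes `a`, `b`, `c`) in `C̃_{l1}(D)`, `C̃_{l2}(D)`. -/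
noncomputable def enhancementBound (P : Measure (Vec k × Vec k₁ × Vec k₂))
    (Γ₁ Γ₂ : Mat k →ₗ[ℝ] Mat k₀) (D₁ D₂ : Mat k₀) : ℝ≥0∞ :=
  max
    (⨆ (m : ℕ) (Q : ProbabilityMeasure (EnhSpace k k₁ k₂ m)) (_ : IsGaussianEnhancement P Q),
      ⨅ (a : ℕ) (b : ℕ) (c : ℕ) (μ ∈ Cl1 Γ₁ Γ₂ D₁ D₂ Q a b c), Rlo1 μ)
    (⨆ (m : ℕ) (Q : ProbabilityMeasure (EnhSpace k k₁ k₂ m)) (_ : IsGaussianEnhancement P Q),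
      ⨅ (a : ℕ) (b : ℕ) (c : ℕ) (μ ∈ Cl2 Γ₁ Γ₂ D₁ D₂ Q a b c), Rlo2 μ)

end Coding

end GaussSI

/-! Fix an achievable rate R, an enhancement Y and η > 0. It is enough to turn one good code into
auxiliary vectors that meet the constraints exactly and carry total information at most R + η
(`exists_auxiliary_law`). For the first bound U is empty; the second is the same argument with the
decoders exchanged and V empty. Write E = (Y₁, Y₂, Y) for the full side information of a letter and
J for the codeword.

Single-letterization. At position t take W = (J, t, E before t, Y₁ off t) and V = (X before t, E off
t). Since J has finitely many values, both informations become differences of conditional entropies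
of J, although the source is continuous (`condMutualInfo_adjoin_le`, `condMutualInfo_given_le`). Two
conditional independences simplify the sum. Given X_t, the codeword does not depend on E_t, which
cancels the entropies H(J | X_t, ...) of the two informations against each other. Given Y_t, the
remaining side information says nothing about X_t, so Y_t may be replaced by E_t in H(J | Y_t, W's
and V's masks). What is left at position t is at most h(t) - h(t+1), where h(t) = H(J | E before t,
all Y₁) + H(J | X before t, all E). The sum over t telescopes. The term H(J | all E) occurs in h(0)
and in h(n), hence h(0) - h(n) ≤ H(J | all Y₁) ≤ log M (`sum_indexGap_inl_le`).

Distortion. Decoder 1 reconstructs X_t from W and Y₁. Decoder 2 needs W, V and E_t, but by the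
Markov chain conditioning on Y_t instead of E_t gives the same conditional mean of X_t. For every u
the map A ↦ uᵀ Γ(A) u is nonnegative on matrices v vᵀ, so the conditional mean minimizes the
corresponding quadratic loss (`sum_mul_integral_residual_le`), which yields the matrix inequalities
one u at a time.

Slack. Codes only meet D + εI, while the bound asks for D. With probability δ the code is therefore
replaced by a fixed finite quantizer of the single letter, accurate enough that its distortion is at
most half of a lower bound l for D. This costs δ log L in rate and creates a margin that absorbs ε,
so no continuity of the bound in D is needed. Positive definiteness of D provides l > 0.

Probability space. The current letter is drawn independently of the time-sharing index and of an
i.i.d. block, and is then substituted into the block (`map_update_prod_pi`). Its law is thus the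
prescribed one, and the Markov conditions hold because everything off position t is independent of
it. The auxiliary values are finally encoded as real numbers. -/

namespace GaussSI

/-! ### Conditional entropy of a finitely valued variable. -/

section Posterior

variable {Ω Ω' γ δ ι : Type*} [MeasurableSpace Ω] [MeasurableSpace Ω'] [MeasurableSpace γ]
  [MeasurableSpace δ]
  [MeasurableSpace ι] [Fintype ι] [DiscreteMeasurableSpace ι] [Nonempty ι]

/-- The posterior probability `P(J = j | G = g)`. -/
noncomputable def postProb (μ : Measure Ω) [IsFiniteMeasure μ] (J : Ω → ι) (G : Ω → γ) (j : ι)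
    (g : γ) : ℝ≥0∞ :=
  condDistrib J G μ g {j}

/-- The conditional entropy `H(J | G)` of a random variable `J` with finitely many values. -/
noncomputable def condEnt (μ : Measure Ω) [IsFiniteMeasure μ] (J : Ω → ι) (G : Ω → γ) : ℝ :=
  ∫ ω, -Real.log (postProb μ J G (J ω) (G ω)).toReal ∂μ

variable {μ : Measure Ω} [IsProbabilityMeasure μ] {J : Ω → ι} {G : Ω → γ}

@[fun_prop]
lemma measurable_postProb (j : ι) : Measurable (postProb μ J G j) :=
  Kernel.measurable_coe _ (MeasurableSet.singleton j)

lemma measurable_postProb_self (hJ : Measurable J) (hG : Measurable G) :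
    Measurable fun ω => postProb μ J G (J ω) (G ω) := by
  have : Measurable fun p : ι × γ => postProb μ J G p.1 p.2 :=
    measurable_from_prod_countable_right fun j => measurable_postProb j
  exact this.comp (hJ.prodMk hG)

lemma postProb_le_one (j : ι) (g : γ) : postProb μ J G j g ≤ 1 := prob_le_one

lemma postProb_ne_top (j : ι) (g : γ) : postProb μ J G j g ≠ ∞ := measure_ne_top _ _

lemma sum_postProb (g : γ) : ∑ j, postProb μ J G j g = 1 := by
  simp only [postProb]
  rw [sum_measure_singleton]
  simp

/-- The tower property, averaging over `J` first with `G` fixed. All later facts about posteriors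
are obtained by choosing `h`. -/
lemma lintegral_eq_lintegral_postProb (hJ : Measurable J) (hG : Measurable G)
    {h : ι → γ → ℝ≥0∞} (hh : ∀ j, Measurable (h j)) :
    ∫⁻ ω, h (J ω) (G ω) ∂μ = ∫⁻ ω, ∑ j, postProb μ J G j (G ω) * h j (G ω) ∂μ := by
  have hm : Measurable fun p : γ × ι => h p.2 p.1 :=
    measurable_from_prod_countable_left fun j => hh j
  calc ∫⁻ ω, h (J ω) (G ω) ∂μ
      = ∫⁻ p, h p.2 p.1 ∂(μ.map fun ω => (G ω, J ω)) := by
        rw [lintegral_map hm (hG.prodMk hJ)]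
    _ = ∫⁻ g, ∫⁻ j, h j g ∂(condDistrib J G μ g) ∂(μ.map G) := by
        rw [← compProd_map_condDistrib hJ.aemeasurable, Measure.lintegral_compProd hm]
    _ = ∫⁻ g, ∑ j, postProb μ J G j g * h j g ∂(μ.map G) := by
        refine lintegral_congr fun g => ?_
        rw [lintegral_fintype]
        simp [postProb, mul_comm]
    _ = _ := by
        rw [lintegral_map _ hG]
        exact Finset.measurable_sum _ fun j _ => (measurable_postProb j).mul (hh j)

/-- Values of posterior probability zero contribute nothing to the tower formula, so the observed
value almost surely is not one of them. This legitimizes the logarithms below. -/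
lemma ae_postProb_ne_zero (hJ : Measurable J) (hG : Measurable G) :
    ∀ᵐ ω ∂μ, postProb μ J G (J ω) (G ω) ≠ 0 := by
  classical
  have h := lintegral_eq_lintegral_postProb (μ := μ) hJ hG
    (h := fun j g => if postProb μ J G j g = 0 then 1 else 0)
    (fun j => Measurable.ite (measurable_postProb j (MeasurableSet.singleton 0))
      measurable_const measurable_const)
  have h0 : ∀ ω, (∑ j, postProb μ J G j (G ω) *
      (if postProb μ J G j (G ω) = 0 then (1 : ℝ≥0∞) else 0)) = 0 := by
    intro ω
    refine Finset.sum_eq_zero fun j _ => ?_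
    split_ifs with hj <;> simp [hj]
  simp only [h0, lintegral_zero] at h
  rw [lintegral_eq_zero_iff'] at h
  · filter_upwards [h] with ω hω h1
    simp [h1] at hω
  · exact (Measurable.ite (measurable_postProb_self hJ hG (MeasurableSet.singleton 0))
      measurable_const measurable_const).aemeasurable

lemma postProb_toReal_le_one (j : ι) (g : γ) : (postProb μ J G j g).toReal ≤ 1 :=
  ENNReal.toReal_le_of_le_ofReal zero_le_one (by simpa using postProb_le_one j g)

lemma log_postProb_nonpos (j : ι) (g : γ) : Real.log (postProb μ J G j g).toReal ≤ 0 :=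
  Real.log_nonpos ENNReal.toReal_nonneg (postProb_toReal_le_one j g)

lemma measurable_log_postProb (hJ : Measurable J) (hG : Measurable G) :
    Measurable fun ω => Real.log (postProb μ J G (J ω) (G ω)).toReal :=
  Real.measurable_log.comp (measurable_postProb_self hJ hG).ennreal_toReal

/-- By log p ≥ 1 - 1/p one has p |log p| ≤ 1 on (0, 1], so the integral is at most the number of
values of `J`. -/
lemma integrable_log_postProb (hJ : Measurable J) (hG : Measurable G) :
    Integrable (fun ω => Real.log (postProb μ J G (J ω) (G ω)).toReal) μ := by
  refine ⟨(measurable_log_postProb hJ hG).aestronglyMeasurable, ?_⟩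
  rw [hasFiniteIntegral_iff_norm]
  have h := lintegral_eq_lintegral_postProb (μ := μ) hJ hG
    (h := fun j g => ENNReal.ofReal ‖Real.log (postProb μ J G j g).toReal‖)
    (fun j => by
      have := (measurable_postProb (μ := μ) (J := J) (G := G) j)
      fun_prop)
  rw [h]
  refine lt_of_le_of_lt (lintegral_mono (g := fun _ => (Fintype.card ι : ℝ≥0∞)) ?_) (by simp)
  intro ω
  calc ∑ j, postProb μ J G j (G ω) * ENNReal.ofReal ‖Real.log (postProb μ J G j (G ω)).toReal‖
      ≤ ∑ j : ι, (1 : ℝ≥0∞) := by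
        refine Finset.sum_le_sum fun j _ => ?_
        set p := postProb μ J G j (G ω) with hp
        have hpt : p ≠ ∞ := postProb_ne_top j _
        have hp1 : p.toReal ≤ 1 := postProb_toReal_le_one j _
        have hp0 : 0 ≤ p.toReal := ENNReal.toReal_nonneg
        rw [← ENNReal.ofReal_toReal hpt, ← ENNReal.ofReal_mul ENNReal.toReal_nonneg,
          ENNReal.toReal_ofReal hp0, ← ENNReal.ofReal_one]
        refine ENNReal.ofReal_le_ofReal ?_
        rcases hp0.eq_or_lt with h0 | h0
        · simp [← h0]
        · rw [Real.norm_of_nonpos (Real.log_nonpos hp0 hp1)]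
          have := Real.one_sub_inv_le_log_of_pos h0
          have h2 := mul_le_mul_of_nonneg_left this hp0
          rw [mul_sub, mul_inv_cancel₀ h0.ne'] at h2
          linarith
    _ = _ := by simp

lemma condEnt_nonneg : 0 ≤ condEnt μ J G :=
  integral_nonneg fun ω => neg_nonneg.2 (log_postProb_nonpos _ _)

/-- Gibbs' inequality: no other predictor has smaller logarithmic loss than the posterior. -/
lemma condEnt_le_integral_neg_log (hJ : Measurable J) (hG : Measurable G) {q : ι → γ → ℝ≥0∞}
    (hq : ∀ j, Measurable (q j)) (hsum : ∀ g, ∑ j, q j g ≤ 1)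
    (hpos : ∀ᵐ ω ∂μ, q (J ω) (G ω) ≠ 0)
    (hint : Integrable (fun ω => Real.log (q (J ω) (G ω)).toReal) μ) :
    condEnt μ J G ≤ ∫ ω, -Real.log (q (J ω) (G ω)).toReal ∂μ := by
  have hqt : ∀ j g, q j g ≠ ∞ := fun j g =>
    ((Finset.single_le_sum (f := fun j => q j g) (fun _ _ => zero_le) (Finset.mem_univ j)).trans
      (hsum g)).trans_lt ENNReal.one_lt_top |>.ne
  -- The likelihood ratio has mean at most 1, and log r ≤ r - 1 then gives the inequality after
  -- integration.
  set r : Ω → ℝ≥0∞ := fun ω => q (J ω) (G ω) / postProb μ J G (J ω) (G ω) with hr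
  have hrm : Measurable r := by
    refine Measurable.div ?_ (measurable_postProb_self hJ hG)
    have : Measurable fun p : ι × γ => q p.1 p.2 :=
      measurable_from_prod_countable_right fun j => hq j
    exact this.comp (hJ.prodMk hG)
  have hr1 : ∫⁻ ω, r ω ∂μ ≤ 1 := by
    rw [hr, lintegral_eq_lintegral_postProb hJ hG (h := fun j g => q j g / postProb μ J G j g)
      (fun j => (hq j).div (measurable_postProb j))]
    refine (lintegral_mono (g := fun _ => 1) fun ω => ?_).trans (by simp)
    refine le_trans (Finset.sum_le_sum fun j _ => ?_) (hsum (G ω))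
    exact ENNReal.mul_div_le
  have hrint : Integrable (fun ω => (r ω).toReal) μ :=
    integrable_toReal_of_lintegral_ne_top hrm.aemeasurable
      (hr1.trans_lt ENNReal.one_lt_top).ne
  have hr2 : ∫ ω, (r ω).toReal ∂μ ≤ 1 := by
    rw [integral_toReal hrm.aemeasurable (ae_lt_top hrm (hr1.trans_lt ENNReal.one_lt_top).ne)]
    exact ENNReal.toReal_le_of_le_ofReal zero_le_one (by simpa using hr1)
  have hp := integrable_log_postProb (μ := μ) hJ hG
  have key : ∫ ω, (Real.log (q (J ω) (G ω)).toReal -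
      Real.log (postProb μ J G (J ω) (G ω)).toReal) ∂μ ≤ ∫ ω, ((r ω).toReal - 1) ∂μ := by
    refine integral_mono_ae (hint.sub hp) (hrint.sub (integrable_const _)) ?_
    filter_upwards [hpos, ae_postProb_ne_zero (μ := μ) hJ hG] with ω h1 h2
    have h1' := ENNReal.toReal_pos h1 (hqt _ _)
    have h2' := ENNReal.toReal_pos h2 (postProb_ne_top _ _)
    simp only [hr, ENNReal.toReal_div]
    rw [← Real.log_div h1'.ne' h2'.ne']
    exact Real.log_le_sub_one_of_pos (div_pos h1' h2')
  rw [integral_sub hint hp, integral_sub hrint (integrable_const _)] at key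
  simp only [integral_const, probReal_univ, smul_eq_mul, mul_one] at key
  unfold condEnt
  rw [integral_neg, integral_neg]
  linarith

/-- Conditioning on more reduces entropy. -/
lemma condEnt_le_condEnt_comp (hJ : Measurable J) (hG : Measurable G) {h : γ → δ}
    (hh : Measurable h) : condEnt μ J G ≤ condEnt μ J (fun ω => h (G ω)) :=
  condEnt_le_integral_neg_log hJ hG (q := fun j g => postProb μ J (fun ω => h (G ω)) j (h g))
    (fun j => (measurable_postProb j).comp hh) (fun g => (sum_postProb _).le)
    (ae_postProb_ne_zero hJ (hh.comp hG)) (integrable_log_postProb hJ (hh.comp hG))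

lemma condEnt_le_of_eq_comp (hJ : Measurable J) (hG : Measurable G) {G' : Ω → δ} {h : γ → δ}
    (hh : Measurable h) (hG' : ∀ ω, G' ω = h (G ω)) : condEnt μ J G ≤ condEnt μ J G' := by
  have : G' = fun ω => h (G ω) := funext hG'
  rw [this]
  exact condEnt_le_condEnt_comp hJ hG hh

/-- Gibbs' inequality with the uniform predictor on `s`. The set `s` is kept general because a
codeword uses only one summand of `Fin M ⊕ Fin L`. -/
lemma condEnt_le_log_card (hJ : Measurable J) (hG : Measurable G) (s : Finset ι)
    (hs : ∀ ω, J ω ∈ s) : condEnt μ J G ≤ Real.log s.card := by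
  classical
  obtain ⟨ω₀⟩ : Nonempty Ω := nonempty_of_isProbabilityMeasure μ
  have hc : 0 < s.card := Finset.card_pos.2 ⟨_, hs ω₀⟩
  have h := condEnt_le_integral_neg_log (μ := μ) hJ hG
    (q := fun j _ => if j ∈ s then (s.card : ℝ≥0∞)⁻¹ else 0) (fun j => measurable_const)
    (fun g => by
      simp only [Finset.sum_ite_mem, Finset.univ_inter, Finset.sum_const, nsmul_eq_mul]
      exact ENNReal.mul_inv_le_one _)
    (by simp [hs]) (by simp [hs])
  simpa [hs] using h

/-- Entropy depends only on the joint law, which permits changing the underlying space. -/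
lemma condEnt_map {F : Ω → Ω'} (hF : Measurable F) {J : Ω' → ι} {G : Ω' → γ}
    (hJ : Measurable J) (hG : Measurable G) :
    haveI := Measure.isProbabilityMeasure_map (μ := μ) hF.aemeasurable
    condEnt (μ.map F) J G = condEnt μ (fun ω => J (F ω)) (fun ω => G (F ω)) := by
  haveI := Measure.isProbabilityMeasure_map (μ := μ) hF.aemeasurable
  have h := condDistrib_map (ν := μ) (f := F) (X := G) (Y := J) hG.aemeasurable hJ.aemeasurable
    hF.aemeasurable
  have h' := ae_of_ae_map (hG.comp hF).aemeasurable h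
  unfold condEnt
  rw [integral_map hF.aemeasurable]
  · refine integral_congr_ae ?_
    filter_upwards [h'] with ω hω
    simp only [postProb]
    rw [Function.comp_apply] at hω
    rw [hω]
    rfl
  · exact (measurable_log_postProb hJ hG).neg.aestronglyMeasurable

/-- The posterior vanishes where a coarser one does. -/
lemma ae_postProb_eq_zero (hJ : Measurable J) (hG : Measurable G) {h : γ → δ}
    (hh : Measurable h) (j : ι) :
    ∀ᵐ ω ∂μ, postProb μ J (fun ω => h (G ω)) j (h (G ω)) = 0 → postProb μ J G j (G ω) = 0 := by
  classical
  set s : Set δ := {d | postProb μ J (fun ω => h (G ω)) j d = 0}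
  have hs : MeasurableSet s := measurable_postProb j (MeasurableSet.singleton 0)
  -- The probability of `J = j` together with `h (G ω) ∈ s` is computed with both posteriors. The
  -- coarse one gives 0, which forces the fine one to vanish there almost everywhere.
  have h1 := lintegral_eq_lintegral_postProb (μ := μ) hJ hG
    (h := fun i g => if i = j then s.indicator 1 (h g) else 0)
    (fun i => by
      by_cases hi : i = j
      · simp only [hi, if_true]
        exact (measurable_one.indicator hs).comp hh
      · simp only [hi, if_false]; exact measurable_const)
  have h2 := lintegral_eq_lintegral_postProb (μ := μ) hJ (hh.comp hG)
    (h := fun i d => if i = j then s.indicator 1 d else 0)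
    (fun i => by
      by_cases hi : i = j
      · simp only [hi, if_true]
        exact (measurable_one.indicator hs)
      · simp only [hi, if_false]; exact measurable_const)
  simp only [mul_ite, mul_zero, Finset.sum_ite_eq', Finset.mem_univ, if_true,
    Function.comp_apply] at h1 h2
  rw [h1] at h2
  have h3 : ∀ ω, postProb μ J (h ∘ G) j (h (G ω)) * s.indicator 1 (h (G ω)) = 0 := by
    intro ω
    by_cases hω : h (G ω) ∈ s
    · have : postProb μ J (h ∘ G) j (h (G ω)) = 0 := hω
      simp [this]
    · simp [hω]
  simp only [h3, lintegral_zero] at h2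
  rw [lintegral_eq_zero_iff'] at h2
  · filter_upwards [h2] with ω hω h0
    have : h (G ω) ∈ s := h0
    simpa [this] using hω
  · exact (((measurable_postProb j).comp hG).mul
      (((measurable_one.indicator hs).comp hh).comp hG)).aemeasurable

end Posterior
end GaussSI
namespace GaussSI

/-! ### Conditional independence through kernels. -/

section CondIndep

variable {Ω Ω' α α' β γ δ Θ : Type*} [MeasurableSpace Ω] [StandardBorelSpace Ω]
  [MeasurableSpace Ω'] [StandardBorelSpace Ω']
  [MeasurableSpace α] [StandardBorelSpace α] [Nonempty α] [MeasurableSpace α']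
  [StandardBorelSpace α'] [Nonempty α']
  [MeasurableSpace β] [StandardBorelSpace β] [Nonempty β]
  [MeasurableSpace γ] [MeasurableSpace δ] [MeasurableSpace Θ] [StandardBorelSpace Θ] [Nonempty Θ]
  {μ : Measure Ω} [IsProbabilityMeasure μ] {A : Ω → α} {N : Ω → β} {C : Ω → γ}

/-- A kernel that sees only `C` and reproduces `N` given `(C, A)` also reproduces `N` given `C`,
after integrating out `A`; the two conditional laws of `N` therefore agree. -/
lemma condIndepFun_of_map_eq_compProd (hA : Measurable A) (hN : Measurable N) (hC : Measurable C)
    (κ : Kernel γ β) [IsMarkovKernel κ]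
    (h : μ.map (fun ω => ((C ω, A ω), N ω)) = μ.map (fun ω => (C ω, A ω)) ⊗ₘ κ.prodMkRight α) :
    CondIndepFun (MeasurableSpace.comap C inferInstance) hC.comap_le A N μ := by
  rw [condIndepFun_iff_condDistrib_prod_ae_eq_prodMkRight hN hA hC]
  have h1 : condDistrib N (fun ω => (C ω, A ω)) μ =ᵐ[μ.map fun ω => (C ω, A ω)]
      κ.prodMkRight α := condDistrib_ae_eq_of_measure_eq_compProd _ hN.aemeasurable h
  have h2 : condDistrib N C μ =ᵐ[μ.map C] κ := by
    refine condDistrib_ae_eq_of_measure_eq_compProd _ hN.aemeasurable ?_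
    refine Measure.ext_of_lintegral _ fun F hF => ?_
    have h3 := congrArg (fun m : Measure ((γ × α) × β) => ∫⁻ p, F (p.1.1, p.2) ∂m) h
    rw [lintegral_map (by fun_prop) (by fun_prop), Measure.lintegral_compProd (by fun_prop),
      lintegral_map (by exact Measurable.lintegral_kernel_prod_right (by fun_prop))
        (by fun_prop)] at h3
    rw [lintegral_map hF (by fun_prop), Measure.lintegral_compProd hF,
      lintegral_map (by exact Measurable.lintegral_kernel_prod_right (by fun_prop)) hC]
    simpa using h3
  have h4 : ∀ᵐ p ∂(μ.map fun ω => (C ω, A ω)), condDistrib N C μ p.1 = κ p.1 := by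
    have : μ.map C = (μ.map fun ω => (C ω, A ω)).map Prod.fst := by
      rw [Measure.map_map measurable_fst (by fun_prop)]; rfl
    rw [this] at h2
    exact ae_of_ae_map measurable_fst.aemeasurable h2
  filter_upwards [h1, h4] with p hp1 hp2
  rw [hp1, Kernel.prodMkRight_apply, Kernel.prodMkRight_apply, hp2]

/-- The working criterion: together with its converse `lintegral_eq_of_condIndepFun` it reduces
manipulations of conditional independence to substitutions in the test function `F`. -/
lemma condIndepFun_of_lintegral_eq (hA : Measurable A) (hN : Measurable N) (hC : Measurable C)
    (κ : Kernel γ β) [IsMarkovKernel κ]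
    (h : ∀ F : (γ × α) × β → ℝ≥0∞, Measurable F →
      ∫⁻ ω, F ((C ω, A ω), N ω) ∂μ = ∫⁻ ω, ∫⁻ n, F ((C ω, A ω), n) ∂(κ (C ω)) ∂μ) :
    CondIndepFun (MeasurableSpace.comap C inferInstance) hC.comap_le A N μ := by
  refine condIndepFun_of_map_eq_compProd hA hN hC κ (Measure.ext_of_lintegral _ fun F hF => ?_)
  rw [lintegral_map hF (by fun_prop), Measure.lintegral_compProd hF, h F hF,
    lintegral_map (by exact Measurable.lintegral_kernel_prod_right (by fun_prop)) (by fun_prop)]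
  simp

lemma lintegral_eq_of_condIndepFun (hA : Measurable A) (hN : Measurable N) (hC : Measurable C)
    (h : CondIndepFun (MeasurableSpace.comap C inferInstance) hC.comap_le A N μ)
    {F : (γ × α) × β → ℝ≥0∞} (hF : Measurable F) :
    ∫⁻ ω, F ((C ω, A ω), N ω) ∂μ =
      ∫⁻ ω, ∫⁻ n, F ((C ω, A ω), n) ∂(condDistrib N C μ (C ω)) ∂μ := by
  rw [condIndepFun_iff_condDistrib_prod_ae_eq_prodMkRight hN hA hC,
    condDistrib_ae_eq_iff_measure_eq_compProd _ hN.aemeasurable] at h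
  have h3 := congrArg (fun m : Measure ((γ × α) × β) => ∫⁻ p, F p ∂m) h
  rw [lintegral_map hF (by fun_prop), Measure.lintegral_compProd hF,
    lintegral_map (by exact Measurable.lintegral_kernel_prod_right (by fun_prop))
      (by fun_prop)] at h3
  simpa using h3

/-- Weak union and decomposition for conditional independence. -/
lemma condIndepFun_weak_union (hA : Measurable A) (hN : Measurable N) (hC : Measurable C)
    (h : CondIndepFun (MeasurableSpace.comap C inferInstance) hC.comap_le A N μ)
    {f : α → α'} (hf : Measurable f) {g : α → δ} (hg : Measurable g) :
    CondIndepFun (MeasurableSpace.comap (fun ω => (C ω, g (A ω))) inferInstance)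
      (hC.prodMk (hg.comp hA)).comap_le (fun ω => f (A ω)) N μ := by
  -- The conditional law of `N` given `C` still serves, ignoring the added coordinate `g (A ω)`.
  refine condIndepFun_of_lintegral_eq (hf.comp hA) hN (hC.prodMk (hg.comp hA))
    ((condDistrib N C μ).prodMkRight δ) fun F hF => ?_
  have := lintegral_eq_of_condIndepFun hA hN hC h
    (F := fun p => F (((p.1.1, g p.1.2), f p.1.2), p.2)) (by fun_prop)
  simpa using this

/-- An independent variable can be adjoined to one side of a conditional independence. -/
lemma condIndepFun_prod (hA : Measurable A) (hN : Measurable N) (hC : Measurable C)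
    (h : CondIndepFun (MeasurableSpace.comap C inferInstance) hC.comap_le A N μ)
    (ρ : Measure Θ) [IsProbabilityMeasure ρ] :
    CondIndepFun (MeasurableSpace.comap (fun ω : Ω × Θ => C ω.1) inferInstance)
      (hC.comp measurable_fst).comap_le (fun ω => (A ω.1, ω.2)) (fun ω => N ω.1) (μ.prod ρ) := by
  refine condIndepFun_of_lintegral_eq (by fun_prop) (by fun_prop) (hC.comp measurable_fst)
    (condDistrib N C μ) fun F hF => ?_
  rw [lintegral_prod_symm _ (by fun_prop), lintegral_prod_symm]
  · refine lintegral_congr fun θ => ?_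
    exact lintegral_eq_of_condIndepFun hA hN hC h (F := fun p => F ((p.1.1, (p.1.2, θ)), p.2))
      (by fun_prop)
  · have : Measurable fun q : γ × (α × Θ) =>
        ∫⁻ n, F ((q.1, q.2), n) ∂((condDistrib N C μ).prodMkRight (α × Θ) q) :=
      Measurable.lintegral_kernel_prod_right (by fun_prop)
    simp only [Kernel.prodMkRight_apply] at this
    exact (this.comp (by fun_prop : Measurable fun ω : Ω × Θ =>
      (C ω.1, (A ω.1, ω.2)))).aemeasurable

lemma condIndepFun_map {F : Ω' → Ω} (ν : Measure Ω') [IsProbabilityMeasure ν] (hF : Measurable F)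
    (hA : Measurable A) (hN : Measurable N) (hC : Measurable C)
    (h : CondIndepFun (MeasurableSpace.comap (fun ω => C (F ω)) inferInstance)
      (hC.comp hF).comap_le (fun ω => A (F ω)) (fun ω => N (F ω)) ν) :
    have := Measure.isProbabilityMeasure_map (μ := ν) hF.aemeasurable
    CondIndepFun (MeasurableSpace.comap C inferInstance) hC.comap_le A N (ν.map F) := by
  have := Measure.isProbabilityMeasure_map (μ := ν) hF.aemeasurable
  refine condIndepFun_of_lintegral_eq hA hN hC
    (condDistrib (fun ω => N (F ω)) (fun ω => C (F ω)) ν) fun G hG => ?_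
  rw [lintegral_map (by fun_prop) hF, lintegral_map _ hF]
  · exact lintegral_eq_of_condIndepFun (hA.comp hF) (hN.comp hF) (hC.comp hF) h hG
  · have : Measurable fun q : γ × α => ∫⁻ n, G ((q.1, q.2), n)
        ∂((condDistrib (fun ω => N (F ω)) (fun ω => C (F ω)) ν).prodMkRight α q) :=
      Measurable.lintegral_kernel_prod_right (by fun_prop)
    simp only [Kernel.prodMkRight_apply] at this
    exact this.comp (hC.prodMk hA)

/-- Used to add the side information outside `Y` to the conditioning without changing the
conditional mean of the source. -/
lemma condExp_comap_prodMk_of_condIndepFun (hA : Measurable A) (hN : Measurable N)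
    (hC : Measurable C)
    (h : CondIndepFun (MeasurableSpace.comap C inferInstance) hC.comap_le A N μ)
    {f : α → ℝ} (hf : Measurable f) (hint : Integrable (fun ω => f (A ω)) μ) :
    μ[fun ω => f (A ω) | MeasurableSpace.comap (fun ω => (C ω, N ω)) inferInstance] =ᵐ[μ]
      μ[fun ω => f (A ω) | MeasurableSpace.comap C inferInstance] := by
  have h' := h.symm
  rw [condIndepFun_iff_condDistrib_prod_ae_eq_prodMkRight hA hN hC] at h'
  have h1 := condExp_ae_eq_integral_condDistrib (μ := μ) (hC.prodMk hN) hA.aemeasurable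
    hf.stronglyMeasurable hint
  have h2 := condExp_ae_eq_integral_condDistrib (μ := μ) hC hA.aemeasurable
    hf.stronglyMeasurable hint
  have h3 := ae_of_ae_map (hC.prodMk hN).aemeasurable h'
  filter_upwards [h1, h2, h3] with ω e1 e2 e3
  rw [e1, e2, e3, Kernel.prodMkRight_apply]

/-- The equality case of "conditioning reduces entropy": the two posteriors coincide almost
everywhere. -/
lemma condEnt_eq_of_condIndepFun {ι : Type*} [MeasurableSpace ι] [Fintype ι]
    [DiscreteMeasurableSpace ι] [Nonempty ι] {J : Ω → ι} (hJ : Measurable J)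
    (hN : Measurable N) (hC : Measurable C)
    (h : CondIndepFun (MeasurableSpace.comap C inferInstance) hC.comap_le J N μ) :
    condEnt μ J (fun ω => (C ω, N ω)) = condEnt μ J C := by
  have h' := h.symm
  rw [condIndepFun_iff_condDistrib_prod_ae_eq_prodMkRight hJ hN hC] at h'
  have h3 := ae_of_ae_map (hC.prodMk hN).aemeasurable h'
  refine integral_congr_ae ?_
  filter_upwards [h3] with ω e3
  simp only [postProb, e3, Kernel.prodMkRight_apply]

end CondIndep

/-! ### Entropy of a finite mixture. -/

section Mixture

instance {α β : Type*} [MeasurableSpace α] [MeasurableSpace β] [DiscreteMeasurableSpace α]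
    [DiscreteMeasurableSpace β] : DiscreteMeasurableSpace (α ⊕ β) :=
  ⟨fun _ => measurableSet_sum_iff.2 ⟨.of_discrete, .of_discrete⟩⟩

variable {Ω τ γ ι : Type*} [MeasurableSpace Ω] [MeasurableSpace τ] [Fintype τ]
  [DiscreteMeasurableSpace τ] [MeasurableSpace γ]
  [MeasurableSpace ι] [Fintype ι] [DiscreteMeasurableSpace ι] [Nonempty ι]

/-- Entropy given a finite mixing variable is the average of the entropies of the components. -/
lemma condEnt_mixture (w : Measure τ) [IsProbabilityMeasure w] (ν : Measure Ω)
    [IsProbabilityMeasure ν] {J : τ × Ω → ι} {G : τ × Ω → γ} (hJ : Measurable J)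
    (hG : Measurable G) :
    condEnt (w.prod ν) J (fun p => (p.1, G p)) =
      ∑ t, w.real {t} * condEnt ν (fun ω => J (t, ω)) (fun ω => G (t, ω)) := by
  have hJt : ∀ t, Measurable fun ω => J (t, ω) := fun t => by fun_prop
  have hGt : ∀ t, Measurable fun ω => G (t, ω) := fun t => by fun_prop
  -- The conditional laws of the slices are glued together; measurability is automatic because the
  -- mixing variable is discrete.
  let κ : Kernel (τ × γ) ι :=
    { toFun := fun p => condDistrib (fun ω => J (p.1, ω)) (fun ω => G (p.1, ω)) ν p.2
      measurable' := measurable_from_prod_countable_right fun t =>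
        (condDistrib (fun ω => J (t, ω)) (fun ω => G (t, ω)) ν).measurable }
  have hκ : ∀ p, κ p = condDistrib (fun ω => J (p.1, ω)) (fun ω => G (p.1, ω)) ν p.2 :=
    fun p => rfl
  have : IsMarkovKernel κ := ⟨fun p => by rw [hκ]; infer_instance⟩
  have h1 : condDistrib J (fun p => (p.1, G p)) (w.prod ν) =ᵐ[(w.prod ν).map fun p => (p.1, G p)]
      κ := by
    refine condDistrib_ae_eq_of_measure_eq_compProd _ hJ.aemeasurable ?_
    refine Measure.ext_of_lintegral _ fun F hF => ?_
    have hm : Measurable fun a => ∫⁻ b, F (a, b) ∂κ a :=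
      Measurable.lintegral_kernel_prod_right (by fun_prop)
    have hm' : Measurable fun p : τ × Ω => ∫⁻ b, F ((p.1, G p), b) ∂κ (p.1, G p) :=
      hm.comp (by fun_prop : Measurable fun p : τ × Ω => (p.1, G p))
    rw [lintegral_map hF (by fun_prop), Measure.lintegral_compProd hF,
      lintegral_map hm (by fun_prop),
      lintegral_prod _ (by fun_prop),
      lintegral_prod _ hm'.aemeasurable]
    refine lintegral_congr fun t => ?_
    have h2 := congrArg (fun m : Measure (γ × ι) => ∫⁻ p, F ((t, p.1), p.2) ∂m)
      (compProd_map_condDistrib (μ := ν) (X := fun ω => G (t, ω)) (hJt t).aemeasurable)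
    rw [Measure.lintegral_compProd (by fun_prop), lintegral_map _ (hGt t),
      lintegral_map (by fun_prop) (by fun_prop)] at h2
    · exact h2.symm
    · exact Measurable.lintegral_kernel_prod_right (by fun_prop)
  have h2 := ae_of_ae_map (by fun_prop) h1
  have hmeas : Measurable fun p => -Real.log (κ (p.1, G p) {J p}).toReal := by
    have : Measurable fun q : (τ × γ) × ι => κ q.1 {q.2} :=
      measurable_from_prod_countable_left fun j => κ.measurable_coe (MeasurableSet.singleton j)
    have h3 : Measurable fun p => κ (p.1, G p) {J p} :=
      this.comp (by fun_prop : Measurable fun p : τ × Ω => ((p.1, G p), J p))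
    exact (Real.measurable_log.comp h3.ennreal_toReal).neg
  have heq : ∀ᵐ p ∂(w.prod ν), -Real.log (postProb (w.prod ν) J (fun p => (p.1, G p)) (J p)
      (p.1, G p)).toReal = -Real.log (κ (p.1, G p) {J p}).toReal := by
    filter_upwards [h2] with p hp
    simp only [postProb, hp]
  have hint : Integrable (fun p => -Real.log (κ (p.1, G p) {J p}).toReal) (w.prod ν) :=
    (integrable_log_postProb (μ := w.prod ν) hJ (by fun_prop : Measurable fun p : τ × Ω =>
      (p.1, G p))).neg.congr heq
  unfold condEnt
  rw [integral_congr_ae heq, integral_prod _ hint, integral_fintype]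
  · simp only [smul_eq_mul, hκ, postProb]
  · exact Integrable.of_finite

end Mixture
end GaussSI
namespace GaussSI

/-! ### Conditional mutual information as a difference of entropies. -/

section KL

lemma measurable_postProb_comp {Ω δ ξ ι : Type*} [MeasurableSpace Ω] [MeasurableSpace δ]
    [MeasurableSpace ξ] [MeasurableSpace ι] [Fintype ι] [DiscreteMeasurableSpace ι] [Nonempty ι]
    {μ : Measure Ω} [IsProbabilityMeasure μ] {J : Ω → ι} {G : Ω → δ} {j : ξ → ι} {f : ξ → δ}
    (hj : Measurable j) (hf : Measurable f) :
    Measurable fun x => postProb μ J G (j x) (f x) := by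
  have : Measurable fun p : ι × δ => postProb μ J G p.1 p.2 :=
    measurable_from_prod_countable_right fun j => measurable_postProb j
  exact this.comp (hj.prodMk hf)

open InformationTheory

/-- The mass correction in the general divergence vanishes for probability measures, leaving the
mean log-density. Its nonnegativity is returned as well, since `ENNReal.ofReal` would hide it. -/
lemma klDiv_withDensity_eq {E : Type*} [MeasurableSpace E] {P R : Measure E}
    [IsProbabilityMeasure P] [IsProbabilityMeasure R] {h : E → ℝ≥0∞} (hh : Measurable h)
    (hP : P = R.withDensity h) (hint : Integrable (fun x => Real.log (h x).toReal) P) :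
    0 ≤ ∫ x, Real.log (h x).toReal ∂P ∧
      klDiv P R = ENNReal.ofReal (∫ x, Real.log (h x).toReal ∂P) := by
  have hac : P ≪ R := hP ▸ withDensity_absolutelyContinuous R h
  have h1 : P.rnDeriv R =ᵐ[P] h := by
    have : (R.withDensity h).rnDeriv R =ᵐ[R] h := Measure.rnDeriv_withDensity R hh
    rw [← hP] at this
    exact hac.ae_le this
  have h2 : llr P R =ᵐ[P] fun x => Real.log (h x).toReal := by
    filter_upwards [h1] with x hx
    rw [llr, hx]
  have hint' : Integrable (llr P R) P := hint.congr h2.symm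
  have h3 := integral_llr_add_sub_measure_univ_nonneg hac hint'
  rw [klDiv_of_ac_of_integrable hac hint']
  simp only [add_sub_cancel_right, probReal_univ] at h3 ⊢
  rw [integral_congr_ae h2] at h3 ⊢
  exact ⟨h3, rfl⟩

variable {Ω α β γ ι E : Type*} [MeasurableSpace Ω] 
  [MeasurableSpace α] [StandardBorelSpace α] [Nonempty α]
  [MeasurableSpace β] [StandardBorelSpace β] [Nonempty β]
  [MeasurableSpace γ] [MeasurableSpace E]
  [MeasurableSpace ι] [Fintype ι] [DiscreteMeasurableSpace ι] [Nonempty ι]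
  {μ : Measure Ω} [IsProbabilityMeasure μ] {A : Ω → α} {B : Ω → β} {C : Ω → γ} {J : Ω → ι}

lemma lintegral_condDistrib_eq {A : Ω → α} {C : Ω → γ} (hA : Measurable A) (hC : Measurable C)
    {F : γ → α → ℝ≥0∞} (hF : Measurable (Function.uncurry F)) :
    ∫⁻ ω, ∫⁻ x, F (C ω) x ∂(condDistrib A C μ (C ω)) ∂μ = ∫⁻ ω, F (C ω) (A ω) ∂μ := by
  have h2 := congrArg (fun m : Measure (γ × α) => ∫⁻ p, Function.uncurry F p ∂m)
    (compProd_map_condDistrib (μ := μ) (X := C) hA.aemeasurable)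
  rw [Measure.lintegral_compProd hF, lintegral_map _ hC, lintegral_map hF (by fun_prop)] at h2
  · exact h2
  · exact Measurable.lintegral_kernel_prod_right hF

lemma lintegral_condDistrib_condDistrib_eq [StandardBorelSpace Ω] (hA : Measurable A) (hB :
    Measurable B)
    (hC : Measurable C)
    (h : CondIndepFun (MeasurableSpace.comap C inferInstance) hC.comap_le A B μ)
    {F : γ → α → β → ℝ≥0∞} (hF : Measurable fun p : (γ × α) × β => F p.1.1 p.1.2 p.2) :
    ∫⁻ ω, ∫⁻ x, ∫⁻ y, F (C ω) x y ∂(condDistrib B C μ (C ω)) ∂(condDistrib A C μ (C ω)) ∂μ =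
      ∫⁻ ω, F (C ω) (A ω) (B ω) ∂μ := by
  have h1 := lintegral_eq_of_condIndepFun hA hB hC h hF
  simp only at h1
  rw [h1]
  refine lintegral_condDistrib_eq hA hC (F := fun c x => ∫⁻ y, F c x y ∂(condDistrib B C μ c)) ?_
  have : Measurable fun q : γ × α =>
      ∫⁻ n, F q.1 q.2 n ∂((condDistrib B C μ).prodMkRight α q) :=
    Measurable.lintegral_kernel_prod_right (by exact hF)
  simp only [Kernel.prodMkRight_apply] at this
  exact this

/-- Bayes' rule: the conditional law of `A` given `J` and `C` is the conditional law given `C`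
tilted by the posterior probabilities of `J`. -/
lemma ae_smul_condDistrib_eq_withDensity (hA : Measurable A) (hC : Measurable C)
    (hJ : Measurable J) (j : ι) :
    ∀ᵐ ω ∂μ, postProb μ J C j (C ω) • condDistrib A (fun ω => (J ω, C ω)) μ (j, C ω) =
      (condDistrib A C μ (C ω)).withDensity
        (fun x => postProb μ J (fun ω => (C ω, A ω)) j (C ω, x)) := by
  classical
  let κ₀ : Kernel γ α := (condDistrib A (fun ω => (J ω, C ω)) μ).comap (fun c => (j, c))
    (by fun_prop)
  have hm₁ : Measurable (Function.uncurry fun (c : γ) (_ : α) => postProb μ J C j c) :=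
    (measurable_postProb j).comp measurable_fst
  have hm₂ : Measurable (Function.uncurry fun (c : γ) (x : α) =>
      postProb μ J (fun ω => (C ω, A ω)) j (c, x)) := measurable_postProb j
  let κ₁ : Kernel γ α := κ₀.withDensity fun c _ => postProb μ J C j c
  let κ₂ : Kernel γ α := (condDistrib A C μ).withDensity
    fun c x => postProb μ J (fun ω => (C ω, A ω)) j (c, x)
  have : IsFiniteKernel κ₁ := Kernel.isFiniteKernel_withDensity_of_bounded _ ENNReal.one_ne_top
    fun c x => postProb_le_one _ _
  have : IsFiniteKernel κ₂ := Kernel.isFiniteKernel_withDensity_of_bounded _ ENNReal.one_ne_top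
    fun c x => postProb_le_one _ _
  -- Both sides integrate `F` to the expectation of `F (C, A)` on the event `J = j`. Uniqueness of
  -- the kernel then gives Bayes' rule, in product form so that a zero posterior needs no division.
  have key : μ.map C ⊗ₘ κ₁ = μ.map C ⊗ₘ κ₂ := by
    refine Measure.ext_of_lintegral _ fun F hF => ?_
    have hm₃ : Measurable fun q : ι × γ => ∫⁻ x, F (q.2, x)
        ∂(condDistrib A (fun ω => (J ω, C ω)) μ q) :=
      Measurable.lintegral_kernel_prod_right (by fun_prop)
    rw [Measure.lintegral_compProd hF, Measure.lintegral_compProd hF,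
      lintegral_map (Measurable.lintegral_kernel_prod_right (by exact hF)) hC,
      lintegral_map (Measurable.lintegral_kernel_prod_right (by exact hF)) hC]
    have e1 : ∫⁻ ω, ∫⁻ b, F (C ω, b) ∂κ₁ (C ω) ∂μ =
        ∫⁻ ω, (if J ω = j then F (C ω, A ω) else 0) ∂μ := by
      have t := lintegral_eq_lintegral_postProb (μ := μ) hJ hC
        (h := fun i c => if i = j then
          ∫⁻ x, F (c, x) ∂(condDistrib A (fun ω => (J ω, C ω)) μ (i, c)) else 0)
        (fun i => by
          by_cases hi : i = j
          · simp only [hi, if_true]; exact hm₃.comp (by fun_prop : Measurable fun c : γ => (j, c))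
          · simp only [hi, if_false]; exact measurable_const)
      simp only [mul_ite, mul_zero, Finset.sum_ite_eq', Finset.mem_univ, if_true] at t
      have t2 := lintegral_condDistrib_eq (μ := μ) hA (hJ.prodMk hC)
        (F := fun q x => if q.1 = j then F (q.2, x) else 0)
        (by
          refine Measurable.ite ?_ (by fun_prop) measurable_const
          exact (MeasurableSet.singleton j).preimage (by fun_prop))
      rw [← t2]
      refine Eq.trans ?_ (t.symm.trans (lintegral_congr fun ω => ?_))
      · refine lintegral_congr fun ω => ?_
        rw [Kernel.lintegral_withDensity _ hm₁ _ (by fun_prop)]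
        rw [lintegral_const_mul _ (by fun_prop)]
        rfl
      · split_ifs <;> simp
    have e2 : ∫⁻ ω, ∫⁻ b, F (C ω, b) ∂κ₂ (C ω) ∂μ =
        ∫⁻ ω, (if J ω = j then F (C ω, A ω) else 0) ∂μ := by
      have t := lintegral_eq_lintegral_postProb (μ := μ) hJ (hC.prodMk hA)
        (h := fun i q => if i = j then F q else 0)
        (fun i => by
          by_cases hi : i = j
          · simp only [hi, if_true]; exact hF
          · simp only [hi, if_false]; exact measurable_const)
      simp only [mul_ite, mul_zero, Finset.sum_ite_eq', Finset.mem_univ, if_true] at t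
      rw [t, ← lintegral_condDistrib_eq (μ := μ) hA hC
        (F := fun c x => postProb μ J (fun ω => (C ω, A ω)) j (c, x) * F (c, x))
        (by exact hm₂.mul hF)]
      refine lintegral_congr fun ω => ?_
      rw [Kernel.lintegral_withDensity _ hm₂ _ (by fun_prop)]
    rw [e1, e2]
  rw [Kernel.compProd_eq_iff] at key
  filter_upwards [ae_of_ae_map hC.aemeasurable key] with ω hω
  have h1 : κ₁ (C ω) = postProb μ J C j (C ω) • κ₀ (C ω) := by
    rw [Kernel.withDensity_apply _ hm₁]
    exact withDensity_const _
  have h2 : κ₂ (C ω) = (condDistrib A C μ (C ω)).withDensity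
      (fun x => postProb μ J (fun ω => (C ω, A ω)) j (C ω, x)) := by
    rw [Kernel.withDensity_apply _ hm₂]
  rw [← h2, ← hω, h1]
  rfl

/-- The law that `condMutualInfo` compares with. -/
noncomputable def condIndepLaw (μ : Measure Ω) [IsFiniteMeasure μ] (A : Ω → α) (B : Ω → β)
    (C : Ω → γ) : Measure (γ × α × β) :=
  (μ.map C) ⊗ₘ (condDistrib A C μ ×ₖ condDistrib B C μ)

lemma isProbabilityMeasure_condIndepLaw (hC : Measurable C) :
    IsProbabilityMeasure (condIndepLaw μ A B C) := by
  have := Measure.isProbabilityMeasure_map (μ := μ) hC.aemeasurable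
  unfold condIndepLaw
  infer_instance

lemma lintegral_condIndepLaw (hC : Measurable C) {F : γ × α × β → ℝ≥0∞} (hF : Measurable F) :
    ∫⁻ p, F p ∂(condIndepLaw μ A B C) = ∫⁻ ω, ∫⁻ x, ∫⁻ y, F (C ω, x, y)
      ∂(condDistrib B C μ (C ω)) ∂(condDistrib A C μ (C ω)) ∂μ := by
  rw [condIndepLaw, Measure.lintegral_compProd hF, lintegral_map _ hC]
  · refine lintegral_congr fun ω => ?_
    rw [Kernel.lintegral_prod _ _ _ (by fun_prop)]
  · exact Measurable.lintegral_kernel_prod_right (by exact hF)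

/-- The true law and `ν` are both sums over `j` along the maps `ψ j`, with weights the posterior and
`r j`. A function `h` with `r j * h` equal to the posterior is hence the density. Only this product
must be checked, so zeros of `r j` are harmless as long as the posterior vanishes there too. -/
lemma klDiv_eq_of_lintegral_postProb {G : Ω → γ} (hG : Measurable G) (hJ : Measurable J)
    {ψ : ι → γ → E} (hψ : ∀ j, Measurable (ψ j)) {ν : Measure E} [IsProbabilityMeasure ν]
    {r : ι → γ → ℝ≥0∞} {h : E → ℝ≥0∞} (hh : Measurable h)
    (hν : ∀ F : E → ℝ≥0∞, Measurable F →
      ∫⁻ x, F x ∂ν = ∫⁻ ω, ∑ j, r j (G ω) * F (ψ j (G ω)) ∂μ)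
    (hrh : ∀ j, ∀ᵐ ω ∂μ, r j (G ω) * h (ψ j (G ω)) = postProb μ J G j (G ω))
    (hint : Integrable (fun ω => Real.log (h (ψ (J ω) (G ω))).toReal) μ) :
    0 ≤ ∫ ω, Real.log (h (ψ (J ω) (G ω))).toReal ∂μ ∧
      klDiv (μ.map fun ω => ψ (J ω) (G ω)) ν =
        ENNReal.ofReal (∫ ω, Real.log (h (ψ (J ω) (G ω))).toReal ∂μ) := by
  have hΨ : Measurable fun ω => ψ (J ω) (G ω) := by
    have : Measurable fun p : ι × γ => ψ p.1 p.2 :=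
      measurable_from_prod_countable_right fun j => hψ j
    exact this.comp (hJ.prodMk hG)
  have hlog : Measurable fun x => Real.log (h x).toReal :=
    Real.measurable_log.comp hh.ennreal_toReal
  have := Measure.isProbabilityMeasure_map (μ := μ) hΨ.aemeasurable
  have hP : (μ.map fun ω => ψ (J ω) (G ω)) = ν.withDensity h := by
    refine Measure.ext_of_lintegral _ fun F hF => ?_
    rw [lintegral_map hF hΨ, lintegral_withDensity_eq_lintegral_mul _ hh hF, hν _ (hh.mul hF),
      lintegral_eq_lintegral_postProb hJ hG (h := fun j g => F (ψ j g)) (fun j => hF.comp (hψ j))]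
    refine lintegral_congr_ae ?_
    filter_upwards [ae_all_iff.2 hrh] with ω hω
    refine Finset.sum_congr rfl fun j _ => ?_
    rw [← hω j, Pi.mul_apply, mul_assoc]
  have hint' : Integrable (fun x => Real.log (h x).toReal) (μ.map fun ω => ψ (J ω) (G ω)) :=
    (integrable_map_measure hlog.aestronglyMeasurable hΨ.aemeasurable).2 hint
  have h1 := klDiv_withDensity_eq hh hP hint'
  rwa [integral_map hΨ.aemeasurable hlog.aestronglyMeasurable] at h1

/-- If `A` and `B` are conditionally independent given `C`, then
`I(A; J, B | C) = H(J | C, B) - H(J | C, A, B)` for every finitely valued `J`. -/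
lemma condMutualInfo_adjoin_le [StandardBorelSpace Ω] (hA : Measurable A) (hB : Measurable B) (hC :
    Measurable C)
    (hJ : Measurable J)
    (h : CondIndepFun (MeasurableSpace.comap C inferInstance) hC.comap_le A B μ) :
    condMutualInfo μ A (fun ω => (J ω, B ω)) C ≤
      ENNReal.ofReal (condEnt μ J (fun ω => (C ω, B ω)) -
        condEnt μ J (fun ω => (C ω, A ω, B ω))) := by
  have := isProbabilityMeasure_condIndepLaw (μ := μ) (A := A) (B := fun ω => (J ω, B ω)) hC
  have hG : Measurable fun ω => (C ω, A ω, B ω) := by fun_prop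
  have hpm : Measurable fun q : γ × α × ι × β =>
      postProb μ J (fun ω => (C ω, A ω, B ω)) q.2.2.1 (q.1, q.2.1, q.2.2.2) :=
    measurable_postProb_comp (by fun_prop) (by fun_prop)
  have hbm : Measurable fun q : γ × α × ι × β =>
      postProb μ J (fun ω => (C ω, B ω)) q.2.2.1 (q.1, q.2.2.2) :=
    measurable_postProb_comp (by fun_prop) (by fun_prop)
  have i1 := integrable_log_postProb (μ := μ) hJ hG
  have i2 := integrable_log_postProb (μ := μ) hJ (hC.prodMk hB)
  have hlog : ∀ᵐ ω ∂μ, Real.log (postProb μ J (fun ω => (C ω, A ω, B ω)) (J ω) (C ω, A ω, B ω) /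
      postProb μ J (fun ω => (C ω, B ω)) (J ω) (C ω, B ω)).toReal =
      Real.log (postProb μ J (fun ω => (C ω, A ω, B ω)) (J ω) (C ω, A ω, B ω)).toReal -
      Real.log (postProb μ J (fun ω => (C ω, B ω)) (J ω) (C ω, B ω)).toReal := by
    filter_upwards [ae_postProb_ne_zero (μ := μ) hJ hG,
      ae_postProb_ne_zero (μ := μ) hJ (hC.prodMk hB)] with ω h1 h2
    rw [ENNReal.toReal_div, Real.log_div]
    · exact (ENNReal.toReal_pos h1 (postProb_ne_top _ _)).ne'
    · exact (ENNReal.toReal_pos h2 (postProb_ne_top _ _)).ne'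
  -- By conditional independence the comparison law keeps the law of `(C, A, B)`, but it draws `J`
  -- from the posterior given `(C, B)` only. The density is the ratio of the two posteriors.
  have main := klDiv_eq_of_lintegral_postProb (μ := μ) (J := J) hG hJ
    (ψ := fun j q => ((q.1, q.2.1, (j, q.2.2)) : γ × α × ι × β)) (fun j => by fun_prop)
    (ν := condIndepLaw μ A (fun ω => (J ω, B ω)) C)
    (r := fun j q => postProb μ J (fun ω => (C ω, B ω)) j (q.1, q.2.2))
    (h := fun q => postProb μ J (fun ω => (C ω, A ω, B ω)) q.2.2.1 (q.1, q.2.1, q.2.2.2) /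
      postProb μ J (fun ω => (C ω, B ω)) q.2.2.1 (q.1, q.2.2.2))
    (hpm.div hbm)
    (fun F hF => by
      rw [lintegral_condIndepLaw hC hF]
      have s1 : ∀ ω, ∫⁻ x, ∫⁻ y, F (C ω, x, y)
          ∂(condDistrib (fun ω => (J ω, B ω)) C μ (C ω)) ∂(condDistrib A C μ (C ω)) =
          ∫⁻ y, ∫⁻ x, F (C ω, x, y) ∂(condDistrib A C μ (C ω))
            ∂(condDistrib (fun ω => (J ω, B ω)) C μ (C ω)) :=
        fun ω => lintegral_lintegral_swap (by fun_prop)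
      simp only [s1]
      have hm : Measurable fun q : γ × (ι × β) =>
          ∫⁻ x, F (q.1, x, q.2) ∂((condDistrib A C μ).prodMkRight (ι × β) q) :=
        Measurable.lintegral_kernel_prod_right (by fun_prop)
      simp only [Kernel.prodMkRight_apply] at hm
      rw [lintegral_condDistrib_eq (μ := μ) (hJ.prodMk hB) hC
        (F := fun c y => ∫⁻ x, F (c, x, y) ∂(condDistrib A C μ c)) hm]
      rw [lintegral_eq_lintegral_postProb hJ (hC.prodMk hB)
        (h := fun j q => ∫⁻ x, F (q.1, x, (j, q.2)) ∂(condDistrib A C μ q.1))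
        (fun j => hm.comp (by fun_prop : Measurable fun q : γ × β => (q.1, (j, q.2))))]
      rw [lintegral_finsetSum _ fun j _ => ?_, lintegral_finsetSum _ fun j _ => ?_]
      · refine Finset.sum_congr rfl fun j _ => ?_
        have s2 := lintegral_eq_of_condIndepFun hB hA hC h.symm
          (F := fun p => postProb μ J (fun ω => (C ω, B ω)) j p.1 * F (p.1.1, p.2, (j, p.1.2)))
          (by fun_prop)
        rw [s2]
        refine lintegral_congr fun ω => (lintegral_const_mul
          (postProb μ J (fun ω => (C ω, B ω)) j (C ω, B ω)) ?_).symm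
        fun_prop
      · fun_prop
      · have : Measurable fun ω => ∫⁻ x, F (C ω, x, (j, B ω)) ∂(condDistrib A C μ (C ω)) :=
          hm.comp (by fun_prop : Measurable fun ω => (C ω, (j, B ω)))
        exact ((measurable_postProb j).comp (hC.prodMk hB)).mul this)
    (fun j => by
      filter_upwards [ae_postProb_eq_zero (μ := μ) hJ hG (h := fun q => (q.1, q.2.2))
        (by fun_prop) j] with ω hω
      by_cases h0 : postProb μ J (fun ω => (C ω, B ω)) j (C ω, B ω) = 0
      · rw [h0, hω h0, zero_mul]
      · exact ENNReal.mul_div_cancel h0 (postProb_ne_top _ _))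
    ((i1.sub i2).congr (by filter_upwards [hlog] with ω hω using hω.symm))
  have e : ∫ ω, Real.log (postProb μ J (fun ω => (C ω, A ω, B ω)) (J ω) (C ω, A ω, B ω) /
      postProb μ J (fun ω => (C ω, B ω)) (J ω) (C ω, B ω)).toReal ∂μ =
      condEnt μ J (fun ω => (C ω, B ω)) - condEnt μ J (fun ω => (C ω, A ω, B ω)) := by
    rw [integral_congr_ae hlog, integral_sub i1 i2, condEnt, condEnt, integral_neg, integral_neg]
    ring
  rw [← e]
  exact main.2.le

/-- If `A` and `B` are conditionally independent given `C`, then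
`I(A; B | J, C) = H(J | C, A) + H(J | C, B) - H(J | C) - H(J | C, A, B)` for every
finitely valued `J`. -/
lemma condMutualInfo_given_le [StandardBorelSpace Ω] (hA : Measurable A) (hB : Measurable B) (hC :
    Measurable C)
    (hJ : Measurable J)
    (h : CondIndepFun (MeasurableSpace.comap C inferInstance) hC.comap_le A B μ) :
    0 ≤ condEnt μ J (fun ω => (C ω, A ω)) + condEnt μ J (fun ω => (C ω, B ω)) -
        condEnt μ J C - condEnt μ J (fun ω => (C ω, A ω, B ω)) ∧
    condMutualInfo μ A B (fun ω => (J ω, C ω)) ≤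
      ENNReal.ofReal (condEnt μ J (fun ω => (C ω, A ω)) + condEnt μ J (fun ω => (C ω, B ω)) -
        condEnt μ J C - condEnt μ J (fun ω => (C ω, A ω, B ω))) := by
  have := isProbabilityMeasure_condIndepLaw (μ := μ) (A := A) (B := B) (hJ.prodMk hC)
  have hG : Measurable fun ω => (C ω, A ω, B ω) := by fun_prop
  let p : ι → γ → ℝ≥0∞ := postProb μ J C
  let a : ι → γ × α → ℝ≥0∞ := postProb μ J (fun ω => (C ω, A ω))
  let b : ι → γ × β → ℝ≥0∞ := postProb μ J (fun ω => (C ω, B ω))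
  let d : ι → γ × α × β → ℝ≥0∞ := postProb μ J (fun ω => (C ω, A ω, B ω))
  have hp1 : ∀ j, Measurable (p j) := fun j => measurable_postProb j
  have ha1 : ∀ j, Measurable (a j) := fun j => measurable_postProb j
  have hb1 : ∀ j, Measurable (b j) := fun j => measurable_postProb j
  have hpm : Measurable fun q : (ι × γ) × α × β => p q.1.1 q.1.2 :=
    measurable_postProb_comp (by fun_prop) (by fun_prop)
  have ham : Measurable fun q : (ι × γ) × α × β => a q.1.1 (q.1.2, q.2.1) :=
    measurable_postProb_comp (by fun_prop) (by fun_prop)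
  have hbm : Measurable fun q : (ι × γ) × α × β => b q.1.1 (q.1.2, q.2.2) :=
    measurable_postProb_comp (by fun_prop) (by fun_prop)
  have hdm : Measurable fun q : (ι × γ) × α × β => d q.1.1 (q.1.2, q.2.1, q.2.2) :=
    measurable_postProb_comp (by fun_prop) (by fun_prop)
  have i1 := integrable_log_postProb (μ := μ) hJ hG
  have i2 := integrable_log_postProb (μ := μ) hJ hC
  have i3 := integrable_log_postProb (μ := μ) hJ (hC.prodMk hA)
  have i4 := integrable_log_postProb (μ := μ) hJ (hC.prodMk hB)
  let L : Ω → ℝ := fun ω => Real.log (d (J ω) (C ω, A ω, B ω)).toReal +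
    Real.log (p (J ω) (C ω)).toReal - Real.log (a (J ω) (C ω, A ω)).toReal -
    Real.log (b (J ω) (C ω, B ω)).toReal
  have iL : Integrable L μ := ((i1.add i2).sub i3).sub i4
  have hlog : ∀ᵐ ω ∂μ, Real.log (d (J ω) (C ω, A ω, B ω) * p (J ω) (C ω) /
      a (J ω) (C ω, A ω) / b (J ω) (C ω, B ω)).toReal = L ω := by
    filter_upwards [ae_postProb_ne_zero (μ := μ) hJ hG, ae_postProb_ne_zero (μ := μ) hJ hC,
      ae_postProb_ne_zero (μ := μ) hJ (hC.prodMk hA),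
      ae_postProb_ne_zero (μ := μ) hJ (hC.prodMk hB)] with ω h1 h2 h3 h4
    have h1' := (ENNReal.toReal_pos h1 (postProb_ne_top _ _)).ne'
    have h2' := (ENNReal.toReal_pos h2 (postProb_ne_top _ _)).ne'
    have h3' := (ENNReal.toReal_pos h3 (postProb_ne_top _ _)).ne'
    have h4' := (ENNReal.toReal_pos h4 (postProb_ne_top _ _)).ne'
    rw [ENNReal.toReal_div, ENNReal.toReal_div, ENNReal.toReal_mul,
      Real.log_div (div_ne_zero (mul_ne_zero h1' h2') h3') h4',
      Real.log_div (mul_ne_zero h1' h2') h3', Real.log_mul h1' h2']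
  -- By Bayes' rule the laws of `A` and of `B` given `(J, C)` are tilted by `a / p` and `b / p`.
  -- Weighted with `p`, the comparison law thus gives `J` the weight `a * b / p`, against the true
  -- posterior `d`.
  have main := klDiv_eq_of_lintegral_postProb (μ := μ) (J := J) hG hJ
    (ψ := fun j q => (((j, q.1), q.2.1, q.2.2) : (ι × γ) × α × β)) (fun j => by fun_prop)
    (ν := condIndepLaw μ A B (fun ω => (J ω, C ω)))
    (r := fun j q => (p j q.1)⁻¹ * (a j (q.1, q.2.1) * b j (q.1, q.2.2)))
    (h := fun q => d q.1.1 (q.1.2, q.2.1, q.2.2) * p q.1.1 q.1.2 / a q.1.1 (q.1.2, q.2.1) /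
      b q.1.1 (q.1.2, q.2.2))
    (((hdm.mul hpm).div ham).div hbm)
    (fun F hF => by
      rw [lintegral_condIndepLaw (hJ.prodMk hC) hF]
      have hm : Measurable fun q : ι × γ => ∫⁻ x, ∫⁻ y, F (q, x, y)
          ∂(condDistrib B (fun ω => (J ω, C ω)) μ q)
          ∂(condDistrib A (fun ω => (J ω, C ω)) μ q) := by
        have h1 : Measurable fun q : ι × γ => ∫⁻ z, F (q, z)
            ∂((condDistrib A (fun ω => (J ω, C ω)) μ ×ₖ
              condDistrib B (fun ω => (J ω, C ω)) μ) q) :=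
          Measurable.lintegral_kernel_prod_right (by exact hF)
        have h2 : ∀ q : ι × γ, ∫⁻ z, F (q, z) ∂((condDistrib A (fun ω => (J ω, C ω)) μ ×ₖ
              condDistrib B (fun ω => (J ω, C ω)) μ) q) = ∫⁻ x, ∫⁻ y, F (q, x, y)
            ∂(condDistrib B (fun ω => (J ω, C ω)) μ q)
            ∂(condDistrib A (fun ω => (J ω, C ω)) μ q) :=
          fun q => Kernel.lintegral_prod _ _ _ (by fun_prop)
        simpa only [h2] using h1
      rw [lintegral_eq_lintegral_postProb hJ hC
        (h := fun j c => ∫⁻ x, ∫⁻ y, F ((j, c), x, y)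
          ∂(condDistrib B (fun ω => (J ω, C ω)) μ (j, c))
          ∂(condDistrib A (fun ω => (J ω, C ω)) μ (j, c)))
        (fun j => hm.comp (by fun_prop : Measurable fun c : γ => (j, c)))]
      rw [lintegral_finsetSum _ fun j _ => ?_, lintegral_finsetSum _ fun j _ => ?_]
      · refine Finset.sum_congr rfl fun j _ => ?_
        have s2 := lintegral_condDistrib_condDistrib_eq (μ := μ) hA hB hC h
          (F := fun c x y => (p j c)⁻¹ * (a j (c, x) * b j (c, y)) * F ((j, c), x, y))
          (by fun_prop)
        rw [← s2]
        refine lintegral_congr_ae ?_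
        filter_upwards [ae_smul_condDistrib_eq_withDensity hA hC hJ j,
          ae_smul_condDistrib_eq_withDensity hB hC hJ j] with ω hω1 hω2
        have t1 : ∀ x, ∫⁻ y, (p j (C ω))⁻¹ * (a j (C ω, x) * b j (C ω, y)) *
            F ((j, C ω), x, y) ∂(condDistrib B C μ (C ω)) = (p j (C ω))⁻¹ * (a j (C ω, x) *
              ∫⁻ y, F ((j, C ω), x, y) ∂((condDistrib B C μ (C ω)).withDensity
                fun y => b j (C ω, y))) := by
          intro x
          rw [lintegral_withDensity_eq_lintegral_mul _ (by fun_prop) (by fun_prop),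
            ← lintegral_const_mul _ (by fun_prop), ← lintegral_const_mul _ (by fun_prop)]
          refine lintegral_congr fun y => ?_
          simp only [Pi.mul_apply]
          ring
        simp only [t1]
        have hm2 : Measurable fun x => ∫⁻ y, F ((j, C ω), x, y)
            ∂((condDistrib B C μ (C ω)).withDensity fun y => b j (C ω, y)) := by
          rw [← hω2]
          simp only [lintegral_smul_measure, smul_eq_mul]
          refine Measurable.const_mul ?_ _
          exact Measurable.lintegral_prod_right' (f := fun z : α × β => F ((j, C ω), z.1, z.2))
            (by fun_prop)
        rw [lintegral_const_mul _ (by fun_prop)]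
        have t2 := lintegral_withDensity_eq_lintegral_mul (condDistrib A C μ (C ω))
          (f := fun x => a j (C ω, x)) (by fun_prop) hm2
        simp only [Pi.mul_apply] at t2
        rw [← t2, ← hω1, ← hω2]
        simp only [lintegral_smul_measure, smul_eq_mul]
        have hm3 : Measurable fun x => ∫⁻ y, F ((j, C ω), x, y)
            ∂(condDistrib B (fun ω => (J ω, C ω)) μ (j, C ω)) :=
          Measurable.lintegral_prod_right' (f := fun z : α × β => F ((j, C ω), z.1, z.2))
            (by fun_prop)
        rw [lintegral_const_mul _ hm3]
        by_cases h0 : postProb μ J C j (C ω) = 0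
        · simp [h0, p]
        · rw [← mul_assoc, ENNReal.inv_mul_cancel h0 (postProb_ne_top _ _), one_mul]
      · exact (((hpm.comp (by fun_prop : Measurable fun ω => ((j, C ω), A ω, B ω))).inv.mul
          ((ham.comp (by fun_prop : Measurable fun ω => ((j, C ω), A ω, B ω))).mul
          (hbm.comp (by fun_prop : Measurable fun ω => ((j, C ω), A ω, B ω))))).mul
          (hF.comp (by fun_prop)))
      · exact ((measurable_postProb j).comp hC).mul
          (hm.comp (by fun_prop : Measurable fun ω => (j, C ω))))
    (fun j => by
      filter_upwards [ae_postProb_eq_zero (μ := μ) hJ hG (h := fun q => (q.1, q.2.2))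
        (by fun_prop) j, ae_postProb_eq_zero (μ := μ) hJ hG (h := fun q => (q.1, q.2.1))
        (by fun_prop) j, ae_postProb_eq_zero (μ := μ) hJ hG (h := fun q => q.1)
        (by fun_prop) j] with ω hb ha hp
      change b j (C ω, B ω) = 0 → d j (C ω, A ω, B ω) = 0 at hb
      change a j (C ω, A ω) = 0 → d j (C ω, A ω, B ω) = 0 at ha
      change p j (C ω) = 0 → d j (C ω, A ω, B ω) = 0 at hp
      change (p j (C ω))⁻¹ * (a j (C ω, A ω) * b j (C ω, B ω)) * (d j (C ω, A ω, B ω) *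
        p j (C ω) / a j (C ω, A ω) / b j (C ω, B ω)) = d j (C ω, A ω, B ω)
      by_cases h0 : d j (C ω, A ω, B ω) = 0
      · simp [h0]
      have hp0 := mt hp h0
      have ha0 := mt ha h0
      have hb0 := mt hb h0
      have hpt : p j (C ω) ≠ ∞ := postProb_ne_top _ _
      have hat : a j (C ω, A ω) ≠ ∞ := postProb_ne_top _ _
      have hbt : b j (C ω, B ω) ≠ ∞ := postProb_ne_top _ _
      generalize d j (C ω, A ω, B ω) = d' at *
      generalize p j (C ω) = p' at *
      generalize a j (C ω, A ω) = a' at *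
      generalize b j (C ω, B ω) = b' at *
      calc p'⁻¹ * (a' * b') * (d' * p' / a' / b')
          = (p'⁻¹ * p') * (a' * a'⁻¹) * (b' * b'⁻¹) * d' := by
            simp only [div_eq_mul_inv]; ring
        _ = d' := by
            rw [ENNReal.inv_mul_cancel hp0 hpt, ENNReal.mul_inv_cancel ha0 hat,
              ENNReal.mul_inv_cancel hb0 hbt]; simp)
    (iL.congr (by filter_upwards [hlog] with ω hω using hω.symm))
  have e : ∫ ω, Real.log (d (J ω) (C ω, A ω, B ω) * p (J ω) (C ω) /
      a (J ω) (C ω, A ω) / b (J ω) (C ω, B ω)).toReal ∂μ =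
      condEnt μ J (fun ω => (C ω, A ω)) + condEnt μ J (fun ω => (C ω, B ω)) -
        condEnt μ J C - condEnt μ J (fun ω => (C ω, A ω, B ω)) := by
    rw [integral_congr_ae hlog]
    simp only [L]
    rw [integral_sub (by exact (i1.add i2).sub i3) i4, integral_sub (by exact i1.add i2) i3,
      integral_add i1 i2]
    simp only [condEnt, integral_neg]
    ring
  rw [← e]
  exact ⟨main.1, main.2.le⟩

end KL
end GaussSI
namespace GaussSI

/-! ### Re-encoding of variables and conditional mutual information. -/

section Encoding

variable {Ω Ω' α β γ β₀ γ₀ : Type*} [MeasurableSpace Ω] [MeasurableSpace Ω']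
  [MeasurableSpace α] [StandardBorelSpace α] [Nonempty α]
  [MeasurableSpace β] [StandardBorelSpace β] [Nonempty β]
  [MeasurableSpace β₀] [StandardBorelSpace β₀] [Nonempty β₀]
  [MeasurableSpace γ] [MeasurableSpace γ₀]
  {ν : Measure Ω'} [IsProbabilityMeasure ν] {F : Ω' → Ω}

/-- Since `dC` undoes `eC`, conditioning on the encoded variable is conditioning on the original
one. The conditional law is the original one, evaluated at `dC` and pushed forward by `eD`. -/
lemma condDistrib_map_ae_eq_comap (hF : Measurable F) {D : Ω → β} {C : Ω → γ} {D₀ : Ω' → β₀}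
    {C₀ : Ω' → γ₀} (hD : Measurable D) (hC : Measurable C) (hD₀ : Measurable D₀)
    (hC₀ : Measurable C₀) {eD : β₀ → β} {eC : γ₀ → γ} {dC : γ → γ₀} (heD : Measurable eD)
    (heC : Measurable eC) (hdC : Measurable dC) (hde : ∀ c, dC (eC c) = c)
    (hDF : ∀ ω, D (F ω) = eD (D₀ ω)) (hCF : ∀ ω, C (F ω) = eC (C₀ ω)) :
    haveI := Measure.isProbabilityMeasure_map (μ := ν) hF.aemeasurable
    ∀ᵐ ω ∂ν, condDistrib D C (ν.map F) (C (F ω)) = (condDistrib D₀ C₀ ν (C₀ ω)).map eD := by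
  have := Measure.isProbabilityMeasure_map (μ := ν) hF.aemeasurable
  let κ : Kernel γ β := ((condDistrib D₀ C₀ ν).map eD).comap dC hdC
  have : IsMarkovKernel ((condDistrib D₀ C₀ ν).map eD) := Kernel.IsMarkovKernel.map _ heD
  have h : condDistrib D C (ν.map F) =ᵐ[(ν.map F).map C] κ := by
    refine condDistrib_ae_eq_of_measure_eq_compProd _ hD.aemeasurable ?_
    refine Measure.ext_of_lintegral _ fun G hG => ?_
    rw [Measure.lintegral_compProd hG, Measure.map_map hC hF, lintegral_map hG (by fun_prop),
      lintegral_map (by fun_prop) hF,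
      lintegral_map (Measurable.lintegral_kernel_prod_right (by exact hG)) (hC.comp hF)]
    have e : ∀ ω, ∫⁻ b, G ((C ∘ F) ω, b) ∂κ ((C ∘ F) ω) =
        ∫⁻ b, G ((C ∘ F) ω, eD b) ∂(condDistrib D₀ C₀ ν (C₀ ω)) := by
      intro ω
      have : κ ((C ∘ F) ω) = (condDistrib D₀ C₀ ν (C₀ ω)).map eD := by
        simp only [κ, Function.comp_apply]
        rw [Kernel.comap_apply, hCF, hde, Kernel.map_apply _ heD]
      rw [this, lintegral_map (by fun_prop) heD]
    simp only [e]
    simp only [hDF, Function.comp_apply, hCF]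
    exact (lintegral_condDistrib_eq (μ := ν) hD₀ hC₀ (F := fun c b => G (eC c, eD b))
      (by fun_prop)).symm
  have := ae_of_ae_map hF.aemeasurable (ae_of_ae_map hC.aemeasurable h)
  filter_upwards [this] with ω hω
  rw [hω, Kernel.comap_apply, hCF, hde, Kernel.map_apply _ heD]

/-- Conditional mutual information does not increase under an injective re-encoding of the
conditioning variable and any processing of the second variable. -/
lemma condMutualInfo_map_le (hF : Measurable F) {A : Ω → α} {B : Ω → β} {C : Ω → γ}
    {A₀ : Ω' → α} {B₀ : Ω' → β₀} {C₀ : Ω' → γ₀} (hA : Measurable A) (hB : Measurable B)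
    (hC : Measurable C) (hB₀ : Measurable B₀) (hC₀ : Measurable C₀) {eB : β₀ → β} {eC : γ₀ → γ}
    {dC : γ → γ₀} (heB : Measurable eB) (heC : Measurable eC) (hdC : Measurable dC)
    (hde : ∀ c, dC (eC c) = c) (hAF : ∀ ω, A (F ω) = A₀ ω) (hBF : ∀ ω, B (F ω) = eB (B₀ ω))
    (hCF : ∀ ω, C (F ω) = eC (C₀ ω)) :
    haveI := Measure.isProbabilityMeasure_map (μ := ν) hF.aemeasurable
    condMutualInfo (ν.map F) A B C ≤ condMutualInfo ν A₀ B₀ C₀ := by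
  have := Measure.isProbabilityMeasure_map (μ := ν) hF.aemeasurable
  have hA₀ : Measurable A₀ := by
    have : A₀ = fun ω => A (F ω) := funext fun ω => (hAF ω).symm
    rw [this]; exact hA.comp hF
  have hE : Measurable fun p : γ₀ × α × β₀ => ((eC p.1, p.2.1, eB p.2.2) : γ × α × β) := by
    fun_prop
  have h1 : (ν.map F).map (fun ω => (C ω, A ω, B ω)) =
      (ν.map fun ω => (C₀ ω, A₀ ω, B₀ ω)).map (fun p => (eC p.1, p.2.1, eB p.2.2)) := by
    rw [Measure.map_map (by fun_prop) hF, Measure.map_map hE (by fun_prop)]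
    congr 1
    funext ω
    simp [hAF, hBF, hCF]
  -- The comparison law is the image of the original one under the same map as the true law; this is
  -- where the left inverse on the conditioning variable is needed. The data processing inequality
  -- for the divergence concludes.
  have h2 : condIndepLaw (ν.map F) A B C =
      (condIndepLaw ν A₀ B₀ C₀).map (fun p => (eC p.1, p.2.1, eB p.2.2)) := by
    refine Measure.ext_of_lintegral _ fun G hG => ?_
    rw [lintegral_map hG hE, lintegral_condIndepLaw hC hG,
      lintegral_condIndepLaw hC₀ (F := fun p => G (eC p.1, p.2.1, eB p.2.2)) (hG.comp hE),
      lintegral_map _ hF]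
    · refine lintegral_congr_ae ?_
      filter_upwards [condDistrib_map_ae_eq_comap (ν := ν) hF hA hC hA₀ hC₀ measurable_id heC hdC
        hde hAF hCF, condDistrib_map_ae_eq_comap (ν := ν) hF hB hC hB₀ hC₀ heB heC hdC hde hBF
        hCF] with ω e1 e2
      rw [e1, e2, Measure.map_id, hCF]
      refine lintegral_congr fun x => ?_
      rw [lintegral_map (by fun_prop) heB]
    · have h3 : Measurable fun q : γ => ∫⁻ z, G (q, z)
          ∂((condDistrib A C (ν.map F) ×ₖ condDistrib B C (ν.map F)) q) :=
        Measurable.lintegral_kernel_prod_right (by exact hG)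
      have h4 : ∀ q : γ, ∫⁻ z, G (q, z)
          ∂((condDistrib A C (ν.map F) ×ₖ condDistrib B C (ν.map F)) q) =
          ∫⁻ x, ∫⁻ y, G (q, x, y) ∂(condDistrib B C (ν.map F) q) ∂(condDistrib A C (ν.map F) q) :=
        fun q => Kernel.lintegral_prod _ _ _ (by fun_prop)
      simp only [h4] at h3
      exact h3.comp hC
  have := isProbabilityMeasure_condIndepLaw (μ := ν) (A := A₀) (B := B₀) hC₀
  have := Measure.isProbabilityMeasure_map (μ := ν)
    (f := fun ω => (C₀ ω, A₀ ω, B₀ ω)) (by fun_prop)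
  change InformationTheory.klDiv ((ν.map F).map fun ω => (C ω, A ω, B ω))
    (condIndepLaw (ν.map F) A B C) ≤ InformationTheory.klDiv (ν.map fun ω => (C₀ ω, A₀ ω, B₀ ω))
    (condIndepLaw ν A₀ B₀ C₀)
  rw [h1, h2]
  exact InformationTheory.klDiv_map_le _ _ hE

end Encoding

/-! ### Conditional covariance under a change of probability space. -/

section CondCov

variable {Ω Ω' α : Type*} [MeasurableSpace Ω] [mΩ' : MeasurableSpace Ω'] [mα : MeasurableSpace α]
  {ν : Measure Ω'} [IsProbabilityMeasure ν] {F : Ω' → Ω}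

/-- Every set of the pulled back σ-algebra is the preimage of a set generated by `Z`, so the set
integrals defining the conditional expectation transfer along `F`. -/
lemma condExp_map_comap (hF : Measurable F) {Z : Ω → α} (hZ : Measurable Z) {g : Ω → ℝ}
    (hg : Integrable g (ν.map F)) :
    (fun ω => ((ν.map F)[g | MeasurableSpace.comap Z inferInstance]) (F ω)) =ᵐ[ν]
      ν[fun ω => g (F ω) | MeasurableSpace.comap (fun ω => Z (F ω)) inferInstance] := by
  have := Measure.isProbabilityMeasure_map (μ := ν) hF.aemeasurable
  have hg' : Integrable (fun ω => g (F ω)) ν := hg.comp_measurable hF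
  have hm := stronglyMeasurable_condExp (μ := ν.map F) (f := g)
    (m := MeasurableSpace.comap Z inferInstance)
  refine ae_eq_condExp_of_forall_setIntegral_eq (hZ.comp hF).comap_le hg' ?_ ?_ ?_
  · intro s _ _
    exact (integrable_condExp.comp_measurable hF).integrableOn
  · rintro s ⟨t, ht, rfl⟩ _
    have hs : MeasurableSet[MeasurableSpace.comap Z inferInstance] (Z ⁻¹' t) := ⟨t, ht, rfl⟩
    have h1 := setIntegral_condExp (μ := ν.map F) hZ.comap_le hg hs
    rw [setIntegral_map (hZ ht) integrable_condExp.aestronglyMeasurable hF.aemeasurable,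
      setIntegral_map (hZ ht) hg.aestronglyMeasurable hF.aemeasurable] at h1
    exact h1
  · refine StronglyMeasurable.aestronglyMeasurable ?_
    refine hm.comp_measurable ?_
    rintro s ⟨t, ht, rfl⟩
    exact ⟨t, ht, rfl⟩

lemma condCov_map {k : ℕ} (hF : Measurable F) {Z : Ω → α} (hZ : Measurable Z) {X : Ω → Vec k}
    (hX : Measurable X) (hint : ∀ i, Integrable (fun ω => X (F ω) i) ν) :
    condCov (ν.map F) X Z = condCov ν (fun ω => X (F ω)) (fun ω => Z (F ω)) := by
  have hint' : ∀ i, Integrable (fun ω => X ω i) (ν.map F) := fun i =>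
    (integrable_map_measure (by fun_prop) hF.aemeasurable).2 (hint i)
  ext i j
  simp only [condCov, Matrix.of_apply]
  have hm : ∀ i, Measurable ((ν.map F)[fun ω' => X ω' i | MeasurableSpace.comap Z inferInstance]) :=
    fun i => (stronglyMeasurable_condExp.mono hZ.comap_le).measurable
  rw [integral_map hF.aemeasurable (by
    have := hm i; have := hm j
    exact Measurable.aestronglyMeasurable (by fun_prop))]
  refine integral_congr_ae ?_
  filter_upwards [condExp_map_comap hF hZ (hint' i), condExp_map_comap hF hZ (hint' j)]
    with ω h1 h2
  rw [h1, h2]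

end CondCov
end GaussSI
namespace GaussSI

/-! ### Optimality of the conditional mean. -/

section Estimation

open Filter Topology

variable {Ω α α' : Type*} [mΩ : MeasurableSpace Ω] [mα : MeasurableSpace α]
  [mα' : MeasurableSpace α'] {ν : Measure Ω} {k : ℕ} {X : Ω → Vec k}

lemma condCov_congr {Z : Ω → α} {Z' : Ω → α'}
    (h : ∀ i, ν[fun ω => X ω i | MeasurableSpace.comap Z inferInstance] =ᵐ[ν]
      ν[fun ω => X ω i | MeasurableSpace.comap Z' inferInstance]) :
    condCov ν X Z = condCov ν X Z' := by
  ext i j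
  simp only [condCov, Matrix.of_apply]
  refine integral_congr_ae ?_
  filter_upwards [h i, h j] with ω h1 h2
  rw [h1, h2]

lemma integrable_residual_mul (hX : ∀ i, MemLp (fun ω => X ω i) 2 ν) (m : MeasurableSpace Ω)
    (i j : Fin k) :
    Integrable (fun ω => (X ω i - (ν[fun ω' => X ω' i | m]) ω) *
      (X ω j - (ν[fun ω' => X ω' j | m]) ω)) ν := by
  have h : ∀ i, MemLp (fun ω => X ω i - (ν[fun ω' => X ω' i | m]) ω) 2 ν := fun i =>
    (hX i).sub ((hX i).condExp (by norm_num))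
  exact (h i).integrable_mul (h j)

lemma condCov_posSemidef [IsProbabilityMeasure ν] (hX : ∀ i, MemLp (fun ω => X ω i) 2 ν) (Z : Ω →
    α) :
    (condCov ν X Z).PosSemidef := by
  refine .of_dotProduct_mulVec_nonneg ?_ fun x => ?_
  · ext i j
    simp only [condCov, Matrix.conjTranspose_apply, Matrix.of_apply, star_trivial]
    congr 1
    funext ω
    ring
  · have hI := integrable_residual_mul hX (MeasurableSpace.comap Z inferInstance)
    set e : Fin k → Ω → ℝ := fun i ω => X ω i -
      (ν[fun ω' => X ω' i | MeasurableSpace.comap Z inferInstance]) ω with he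
    have h1 : star x ⬝ᵥ (condCov ν X Z).mulVec x = ∫ ω, (∑ i, x i * e i ω) ^ 2 ∂ν := by
      have h2 : ∀ ω, (∑ i, x i * e i ω) ^ 2 = ∑ i, ∑ j, x i * x j * (e i ω * e j ω) := by
        intro ω
        rw [sq, Finset.sum_mul_sum]
        refine Finset.sum_congr rfl fun i _ => Finset.sum_congr rfl fun j _ => by ring
      simp only [h2]
      rw [integral_finsetSum _ fun i _ => integrable_finsetSum _ fun j _ =>
        (hI i j).const_mul _]
      simp only [dotProduct, Matrix.mulVec, star_trivial]
      refine Finset.sum_congr rfl fun i _ => ?_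
      rw [integral_finsetSum _ fun j _ => (hI i j).const_mul _, Finset.mul_sum]
      refine Finset.sum_congr rfl fun j _ => ?_
      rw [integral_const_mul]
      simp only [condCov, Matrix.of_apply]
      ring
    rw [h1]
    exact integral_nonneg fun ω => sq_nonneg _

/-- Orthogonality of the residual, for bounded test functions only, which is all that the truncation
argument needs. -/
lemma integral_residual_mul_eq_zero [IsProbabilityMeasure ν] (hX : ∀ i, MemLp (fun ω => X ω i) 2 ν)
    {m : MeasurableSpace Ω} (hm : m ≤ mΩ) (i : Fin k) {g : Ω → ℝ} (hg : StronglyMeasurable[m] g)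
    (N : ℝ) (hN : ∀ ω, ‖g ω‖ ≤ N) :
    Integrable (fun ω => g ω * (X ω i - (ν[fun ω' => X ω' i | m]) ω)) ν ∧
      ∫ ω, g ω * (X ω i - (ν[fun ω' => X ω' i | m]) ω) ∂ν = 0 := by
  have hi : Integrable (fun ω => X ω i) ν := (hX i).integrable (by norm_num)
  have hgm := (hg.mono hm).aestronglyMeasurable (μ := ν)
  have h1 : Integrable (fun ω => g ω * X ω i) ν :=
    hi.bdd_mul hgm (ae_of_all _ hN)
  have h2 : Integrable (fun ω => g ω * (ν[fun ω' => X ω' i | m]) ω) ν :=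
    integrable_condExp.bdd_mul hgm (ae_of_all _ hN)
  have h3 := condExp_stronglyMeasurable_mul_of_bound hm hg hi N (ae_of_all _ hN)
  have h4 := integral_condExp (μ := ν) (f := g * fun ω => X ω i) hm
  rw [integral_congr_ae h3] at h4
  simp only [mul_sub]
  refine ⟨h1.sub h2, ?_⟩
  rw [integral_sub h1 h2, sub_eq_zero]
  exact h4.symm

/-- The conditional mean minimizes every positive semidefinite quadratic loss, also among
estimators that need not be square integrable. -/
lemma sum_mul_integral_residual_le {Ω : Type*} {m mΩ : MeasurableSpace Ω} {ν : Measure Ω}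
    [IsProbabilityMeasure ν] {X : Ω → Vec k} (hX : ∀ i, MemLp (fun ω => X ω i) 2 ν) (hm : m ≤ mΩ)
    {Y : Ω → Vec k} (hY : ∀ i, StronglyMeasurable[m] fun ω => Y ω i) {c : Fin k → Fin k → ℝ}
    (hc : ∀ v : Vec k, 0 ≤ ∑ i, ∑ j, c i j * (v i * v j))
    (hint : Integrable (fun ω => ∑ i, ∑ j, c i j * ((X ω i - Y ω i) * (X ω j - Y ω j))) ν) :
    ∑ i, ∑ j, c i j * ∫ ω, (X ω i - (ν[fun ω' => X ω' i | m]) ω) *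
      (X ω j - (ν[fun ω' => X ω' j | m]) ω) ∂ν ≤
      ∫ ω, ∑ i, ∑ j, c i j * ((X ω i - Y ω i) * (X ω j - Y ω j)) ∂ν := by
  set e : Fin k → Ω → ℝ := fun i ω => X ω i - (ν[fun ω' => X ω' i | m]) ω with he
  set d : Fin k → Ω → ℝ := fun i ω => (ν[fun ω' => X ω' i | m]) ω - Y ω i with hd
  have hdm : ∀ i, StronglyMeasurable[m] (d i) := fun i =>
    stronglyMeasurable_condExp.sub (hY i)
  have hed : ∀ i ω, X ω i - Y ω i = e i ω + d i ω := fun i ω => by simp only [he, hd]; ring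
  have hee : ∀ i j, Integrable (fun ω => e i ω * e j ω) ν := integrable_residual_mul hX m
  -- Only the quadratic loss of the estimator is known to be integrable, since the form `c` may be
  -- degenerate. On `S N` the difference `d` from the conditional mean is bounded, so the cross
  -- terms integrate to zero and the form in `d` is nonnegative; then `N` tends to infinity.
  let S : ℕ → Set Ω := fun N => ⋂ i, {ω | |d i ω| ≤ N}
  have hSm : ∀ N, MeasurableSet[m] (S N) := fun N => by
    refine MeasurableSet.iInter fun i => ?_
    exact (hdm i).measurable (measurableSet_le measurable_id.abs measurable_const :
      MeasurableSet {x : ℝ | |x| ≤ N})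
  have hSmono : Monotone S := fun N N' h =>
    Set.iInter_mono fun i => fun ω (hω : |d i ω| ≤ N) => hω.trans (by exact_mod_cast h)
  have hSU : ⋃ N, S N = Set.univ := by
    refine Set.eq_univ_of_forall fun ω => Set.mem_iUnion.2 ?_
    obtain ⟨N, hN⟩ := exists_nat_ge (∑ i, |d i ω|)
    refine ⟨N, Set.mem_iInter.2 fun i => ?_⟩
    exact (Finset.single_le_sum (f := fun i => |d i ω|) (fun _ _ => abs_nonneg _)
      (Finset.mem_univ i)).trans hN
  let q : Ω → ℝ := fun ω => ∑ i, ∑ j, c i j * (e i ω * e j ω)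
  have hq : Integrable q ν := integrable_finsetSum _ fun i _ => integrable_finsetSum _ fun j _ =>
    (hee i j).const_mul _
  have hstep : ∀ N, ∫ ω in S N, q ω ∂ν ≤ ∫ ω in S N, ∑ i, ∑ j, c i j *
      ((X ω i - Y ω i) * (X ω j - Y ω j)) ∂ν := by
    intro N
    let dN : Fin k → Ω → ℝ := fun i => (S N).indicator (d i)
    have hdN : ∀ i, StronglyMeasurable[m] (dN i) := fun i => (hdm i).indicator (hSm N)
    have hbd : ∀ i ω, ‖dN i ω‖ ≤ N := by
      intro i ω
      by_cases hω : ω ∈ S N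
      · simp only [dN, Set.indicator_of_mem hω]
        exact Set.mem_iInter.1 hω i
      · simp only [dN, Set.indicator_of_notMem hω, norm_zero]
        exact Nat.cast_nonneg N
    have hx := fun i j => integral_residual_mul_eq_zero hX hm i (hdN j) N (hbd j)
    have hxij : ∀ i j, Integrable (fun ω => dN j ω * e i ω + dN i ω * e j ω) ν := fun i j =>
      (hx i j).1.add (hx j i).1
    have hxint : Integrable (fun ω => ∑ i, ∑ j, c i j *
        (dN j ω * e i ω + dN i ω * e j ω)) ν :=
      integrable_finsetSum _ fun i _ => integrable_finsetSum _ fun j _ =>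
        (hxij i j).const_mul _
    have hx0 : ∫ ω, ∑ i, ∑ j, c i j * (dN j ω * e i ω + dN i ω * e j ω) ∂ν = 0 := by
      rw [integral_finsetSum _ fun i _ => integrable_finsetSum _ fun j _ =>
        (hxij i j).const_mul _]
      refine Finset.sum_eq_zero fun i _ => ?_
      rw [integral_finsetSum _ fun j _ => (hxij i j).const_mul _]
      refine Finset.sum_eq_zero fun j _ => ?_
      rw [integral_const_mul]
      rw [integral_add (hx i j).1 (hx j i).1, (hx i j).2, (hx j i).2, add_zero, mul_zero]
    rw [← integral_indicator (hm _ (hSm N)), ← integral_indicator (hm _ (hSm N))]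
    have h1 := integral_add (hq.indicator (hm _ (hSm N))) hxint
    rw [hx0, add_zero] at h1
    rw [← h1]
    refine integral_mono ((hq.indicator (hm _ (hSm N))).add hxint)
      (hint.indicator (hm _ (hSm N))) fun ω => ?_
    by_cases hω : ω ∈ S N
    · simp only [Set.indicator_of_mem hω, dN, q, hed]
      have h2 := hc fun i => d i ω
      have h3 : ∑ i, ∑ j, c i j * ((e i ω + d i ω) * (e j ω + d j ω)) =
          ∑ i, ∑ j, c i j * (e i ω * e j ω) + ∑ i, ∑ j, c i j * (d j ω * e i ω + d i ω * e j ω) +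
          ∑ i, ∑ j, c i j * (d i ω * d j ω) := by
        simp only [← Finset.sum_add_distrib]
        refine Finset.sum_congr rfl fun i _ => Finset.sum_congr rfl fun j _ => by ring
      rw [h3]
      linarith
    · simp [Set.indicator_of_notMem hω, dN]
  have hl1 := tendsto_setIntegral_of_monotone (μ := ν) (f := q) (fun N => hm _ (hSm N)) hSmono
    hq.integrableOn
  have hl2 := tendsto_setIntegral_of_monotone (μ := ν) (fun N => hm _ (hSm N)) hSmono
    hint.integrableOn
  rw [hSU, setIntegral_univ] at hl1 hl2
  have := le_of_tendsto_of_tendsto' hl1 hl2 hstep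
  refine le_trans (le_of_eq ?_) this
  simp only [q]
  rw [integral_finsetSum _ fun i _ => integrable_finsetSum _ fun j _ => (hee i j).const_mul _]
  refine Finset.sum_congr rfl fun i _ => ?_
  rw [integral_finsetSum _ fun j _ => (hee i j).const_mul _]
  refine Finset.sum_congr rfl fun j _ => ?_
  rw [integral_const_mul]

lemma sum_mul_condCov_le [IsProbabilityMeasure ν] (hX : ∀ i, MemLp (fun ω => X ω i) 2 ν)
    {Z : Ω → α} (hZ : Measurable Z) {g : α → Vec k} (hg : Measurable g) {c : Fin k → Fin k → ℝ}
    (hc : ∀ v : Vec k, 0 ≤ ∑ i, ∑ j, c i j * (v i * v j))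
    (hint : Integrable (fun ω => ∑ i, ∑ j, c i j *
      ((X ω i - g (Z ω) i) * (X ω j - g (Z ω) j))) ν) :
    ∑ i, ∑ j, c i j * condCov ν X Z i j ≤
      ∫ ω, ∑ i, ∑ j, c i j * ((X ω i - g (Z ω) i) * (X ω j - g (Z ω) j)) ∂ν :=
  sum_mul_integral_residual_le hX hZ.comap_le (Y := fun ω => g (Z ω))
    (fun i => (((measurable_pi_apply i).comp hg).comp (comap_measurable Z)).stronglyMeasurable)
    hc hint

end Estimation

/-! ### Matrix inequalities tested on vectors. -/

section QuadraticForms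

variable {k k₀ : ℕ}

/-- The coefficients of the linear functional `A ↦ uᵀ Γ(A) u`. -/
noncomputable def quadCoeff (Γ : Mat k →ₗ[ℝ] Mat k₀) (u : Vec k₀) (i j : Fin k) : ℝ :=
  u ⬝ᵥ (Γ (Matrix.single i j 1)).mulVec u

lemma dotProduct_map_mulVec (Γ : Mat k →ₗ[ℝ] Mat k₀) (u : Vec k₀) (A : Mat k) :
    u ⬝ᵥ (Γ A).mulVec u = ∑ i, ∑ j, quadCoeff Γ u i j * A i j := by
  have h1 : Γ A = ∑ i, ∑ j, A i j • Γ (Matrix.single i j 1) := by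
    conv_lhs => rw [Matrix.matrix_eq_sum_single A]
    simp only [map_sum]
    refine Finset.sum_congr rfl fun i _ => Finset.sum_congr rfl fun j _ => ?_
    rw [← map_smul, Matrix.smul_single, smul_eq_mul, mul_one]
  rw [h1]
  simp only [Matrix.sum_mulVec, Matrix.smul_mulVec, dotProduct_sum, dotProduct_smul, quadCoeff,
    smul_eq_mul]
  refine Finset.sum_congr rfl fun i _ => Finset.sum_congr rfl fun j _ => by ring

lemma dotProduct_map_vecMulVec (Γ : Mat k →ₗ[ℝ] Mat k₀) (u : Vec k₀) (v : Vec k) :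
    u ⬝ᵥ (Γ (Matrix.vecMulVec v v)).mulVec u =
      ∑ i, ∑ j, quadCoeff Γ u i j * (v i * v j) := by
  rw [dotProduct_map_mulVec]
  rfl

lemma posSemidef_vecMulVec_self (v : Vec k) : (Matrix.vecMulVec v v).PosSemidef := by
  simpa using Matrix.posSemidef_vecMulVec_self_star v

/-- Rank one matrices `v vᵀ` are mapped to positive semidefinite ones. This is the form of
positivity that makes the conditional mean optimal. -/
lemma quadCoeff_nonneg {Γ : Mat k →ₗ[ℝ] Mat k₀} (hΓ : IsDistortionMap Γ) (u : Vec k₀)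
    (v : Vec k) : 0 ≤ ∑ i, ∑ j, quadCoeff Γ u i j * (v i * v j) := by
  rw [← dotProduct_map_vecMulVec]
  simpa using (hΓ.posSemidef _ (posSemidef_vecMulVec_self v)).dotProduct_mulVec_nonneg u

lemma psdLE_iff_dotProduct {A B : Mat k} (hA : A.IsHermitian) (hB : B.IsHermitian) :
    PsdLE A B ↔ ∀ u : Vec k, u ⬝ᵥ A.mulVec u ≤ u ⬝ᵥ B.mulVec u := by
  have h : ∀ u : Vec k, star u ⬝ᵥ (B - A).mulVec u = u ⬝ᵥ B.mulVec u - u ⬝ᵥ A.mulVec u := by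
    intro u
    rw [Matrix.sub_mulVec, dotProduct_sub, star_trivial]
  constructor
  · intro hAB u
    have := hAB.dotProduct_mulVec_nonneg u
    rw [h] at this
    linarith
  · intro hu
    refine .of_dotProduct_mulVec_nonneg (hB.sub hA) fun u => ?_
    rw [h]
    linarith [hu u]

lemma dotProduct_le_of_psdLE {A B : Mat k} (h : PsdLE A B) (u : Vec k) :
    u ⬝ᵥ A.mulVec u ≤ u ⬝ᵥ B.mulVec u := by
  have := h.dotProduct_mulVec_nonneg u
  rw [Matrix.sub_mulVec, dotProduct_sub, star_trivial] at this
  linarith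

lemma psdLE_vecMulVec_smul_one (v : Vec k) :
    PsdLE (Matrix.vecMulVec v v) ((v ⬝ᵥ v) • (1 : Mat k)) := by
  rw [psdLE_iff_dotProduct (posSemidef_vecMulVec_self v).1 (by
    rw [Matrix.IsHermitian, Matrix.conjTranspose_smul]; simp)]
  intro u
  simp only [Matrix.smul_mulVec, Matrix.one_mulVec, dotProduct_smul, smul_eq_mul]
  have h1 : u ⬝ᵥ (Matrix.vecMulVec v v).mulVec u = (∑ i, v i * u i) ^ 2 := by
    simp only [dotProduct, Matrix.mulVec, Matrix.vecMulVec_apply]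
    rw [sq, Finset.sum_mul_sum]
    refine Finset.sum_congr rfl fun i _ => ?_
    rw [Finset.mul_sum]
    refine Finset.sum_congr rfl fun j _ => by ring
  rw [h1]
  have := Finset.sum_mul_sq_le_sq_mul_sq Finset.univ v u
  simpa [dotProduct, sq] using this

/-- Any matrix is bounded by a multiple of the identity as a quadratic form. -/
lemma exists_dotProduct_mulVec_le (A : Mat k) :
    ∃ K : ℝ, 0 ≤ K ∧ ∀ u : Vec k, u ⬝ᵥ A.mulVec u ≤ K * (u ⬝ᵥ u) := by
  refine ⟨∑ i, ∑ j, |A i j|, by positivity, fun u => ?_⟩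
  simp only [dotProduct, Matrix.mulVec]
  rw [Finset.sum_mul]
  refine Finset.sum_le_sum fun i _ => ?_
  rw [Finset.mul_sum, Finset.sum_mul]
  refine Finset.sum_le_sum fun j _ => ?_
  have h1 : u i * u j ≤ ∑ i, u i * u i ∧ -(u i * u j) ≤ ∑ i, u i * u i := by
    have hi := Finset.single_le_sum (f := fun i => u i * u i) (fun i _ => mul_self_nonneg _)
      (Finset.mem_univ i)
    have hj := Finset.single_le_sum (f := fun i => u i * u i) (fun i _ => mul_self_nonneg _)
      (Finset.mem_univ j)
    constructor <;> nlinarith [mul_self_nonneg (u i - u j), mul_self_nonneg (u i + u j)]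
  have h2 : |u i * u j| ≤ ∑ i, u i * u i := abs_le.2 ⟨by linarith [h1.2], h1.1⟩
  calc u i * (A i j * u j) = A i j * (u i * u j) := by ring
    _ ≤ |A i j * (u i * u j)| := le_abs_self _
    _ = |A i j| * |u i * u j| := abs_mul _ _
    _ ≤ _ := mul_le_mul_of_nonneg_left h2 (abs_nonneg _)

/-- A positive definite matrix is bounded below by a positive multiple of the identity. -/
lemma exists_le_dotProduct_mulVec {D : Mat k} (hD : D.PosDef) :
    ∃ l : ℝ, 0 < l ∧ ∀ u : Vec k, l * (u ⬝ᵥ u) ≤ u ⬝ᵥ D.mulVec u := by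
  have hpos : ∀ u : Vec k, u ≠ 0 → 0 < u ⬝ᵥ D.mulVec u := fun u hu => by
    simpa using hD.dotProduct_mulVec_pos hu
  rcases isEmpty_or_nonempty (Fin k) with hk | hk
  · exact ⟨1, one_pos, fun u => by simp [dotProduct]⟩
  have hcont : Continuous fun u : Vec k => u ⬝ᵥ D.mulVec u := by
    unfold dotProduct Matrix.mulVec dotProduct
    fun_prop
  -- The sphere is that of the sup norm, for which `u ⬝ᵥ u ≤ k * ‖u‖ ^ 2`; hence the division of the
  -- minimum by `k`.
  obtain ⟨u₀, hu₀, hmin⟩ := (isCompact_sphere (0 : Vec k) 1).exists_isMinOn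
    (NormedSpace.sphere_nonempty.2 zero_le_one) hcont.continuousOn
  have hu₀' : u₀ ≠ 0 := by
    rintro rfl
    simp at hu₀
  have hk' : (0 : ℝ) < k := by
    have : Nonempty (Fin k) := hk
    exact_mod_cast Fin.pos_iff_nonempty.2 this
  refine ⟨(u₀ ⬝ᵥ D.mulVec u₀) / k, div_pos (hpos _ hu₀') hk', fun u => ?_⟩
  rcases eq_or_ne u 0 with rfl | hu
  · simp
  have hn : 0 < ‖u‖ := norm_pos_iff.2 hu
  have h1 : u₀ ⬝ᵥ D.mulVec u₀ ≤ (‖u‖⁻¹ • u) ⬝ᵥ D.mulVec (‖u‖⁻¹ • u) := by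
    refine hmin ?_
    rw [mem_sphere_zero_iff_norm, norm_smul, norm_inv, norm_norm, inv_mul_cancel₀ hn.ne']
  rw [Matrix.mulVec_smul, dotProduct_smul, smul_dotProduct, smul_eq_mul, smul_eq_mul] at h1
  have h2 : u ⬝ᵥ u ≤ k * ‖u‖ ^ 2 := by
    have : ∀ i ∈ Finset.univ, u i * u i ≤ ‖u‖ ^ 2 := fun i _ => by
      have := norm_le_pi_norm u i
      rw [← abs_mul_abs_self, sq]
      exact mul_self_le_mul_self (abs_nonneg _) this
    simpa [dotProduct] using Finset.sum_le_sum this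
  have h3 : (u₀ ⬝ᵥ D.mulVec u₀) * ‖u‖ ^ 2 ≤ u ⬝ᵥ D.mulVec u := by
    have := mul_le_mul_of_nonneg_right h1 (sq_nonneg ‖u‖)
    refine this.trans (le_of_eq ?_)
    field_simp
  calc (u₀ ⬝ᵥ D.mulVec u₀) / k * (u ⬝ᵥ u)
      ≤ (u₀ ⬝ᵥ D.mulVec u₀) / k * (k * ‖u‖ ^ 2) :=
        mul_le_mul_of_nonneg_left h2 (div_pos (hpos _ hu₀') hk').le
    _ = (u₀ ⬝ᵥ D.mulVec u₀) * ‖u‖ ^ 2 := by field_simp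
    _ ≤ _ := h3

end QuadraticForms
end GaussSI
namespace GaussSI

/-! ### The time-sharing space: current letter, index and independent block. -/

section SingleLetter

variable {𝒳 ℰ 𝒜 𝒴 𝒩 : Type*} [MeasurableSpace 𝒳] [StandardBorelSpace 𝒳] [Inhabited 𝒳]
  [MeasurableSpace ℰ] [StandardBorelSpace ℰ] [Inhabited ℰ]
  [MeasurableSpace 𝒜] [StandardBorelSpace 𝒜] [Inhabited 𝒜]
  [MeasurableSpace 𝒴] [StandardBorelSpace 𝒴] [Inhabited 𝒴]
  [MeasurableSpace 𝒩] [StandardBorelSpace 𝒩] [Inhabited 𝒩] {n M L : ℕ}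

/-- The time-sharing index: a position in the block, or the use of the scalar quantizer. -/
abbrev ShareIdx (n : ℕ) : Type := Fin n ⊕ Unit

/-- The transmitted index: at `Sum.inl t` the code is applied to the block `s` with the letter `q`
substituted at position `t`, at `Sum.inr ()` the letter is quantized. -/
def sharedIndex (f : (Fin n → 𝒳) → Fin M) (φ : 𝒳 → Fin L) :
    ShareIdx n → (𝒳 × ℰ) × (Fin n → 𝒳 × ℰ) → Fin M ⊕ Fin L
  | .inl t, p => .inl (f fun s => (Function.update p.2 t p.1 s).1)
  | .inr _, p => .inr (φ p.1.1)

/-- All the side information before position `t`, the side information `ya` off position `t`. -/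
def weakMask (ya : ℰ → 𝒜) : ShareIdx n → (Fin n → 𝒳 × ℰ) → (Fin n → ℰ) × (Fin n → 𝒜)
  | .inl t, S => (fun s => if s < t then (S s).2 else default,
      fun s => if s = t then default else ya (S s).2)
  | .inr _, _ => default

/-- The source before position `t`, all the side information off position `t`. -/
def strongMask : ShareIdx n → (Fin n → 𝒳 × ℰ) → (Fin n → 𝒳) × (Fin n → ℰ)
  | .inl t, S => (fun s => if s < t then (S s).1 else default,
      fun s => if s = t then default else (S s).2)
  | .inr _, _ => default

lemma measurable_sharedIndex {f : (Fin n → 𝒳) → Fin M} {φ : 𝒳 → Fin L} (hf : Measurable f)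
    (hφ : Measurable φ) (t : ShareIdx n) :
    Measurable (sharedIndex (ℰ := ℰ) f φ t) := by
  rcases t with t | t
  · refine measurable_inl.comp (hf.comp (measurable_pi_lambda _ fun s => ?_))
    by_cases h : s = t
    · subst h
      simp only [Function.update_self]
      fun_prop
    · simp only [Function.update_of_ne h]
      fun_prop
  · exact measurable_inr.comp (hφ.comp (by fun_prop))

lemma measurable_weakMask {ya : ℰ → 𝒜} (hya : Measurable ya) (t : ShareIdx n) :
    Measurable (weakMask (𝒳 := 𝒳) ya t) := by
  rcases t with t | t
  · refine Measurable.prodMk (measurable_pi_lambda _ fun s => ?_)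
      (measurable_pi_lambda _ fun s => ?_)
    · split_ifs <;> fun_prop
    · split_ifs <;> fun_prop
  · exact measurable_const

lemma measurable_strongMask (t : ShareIdx n) : Measurable (strongMask (𝒳 := 𝒳) (ℰ := ℰ) t) := by
  rcases t with t | t
  · refine Measurable.prodMk (measurable_pi_lambda _ fun s => ?_)
      (measurable_pi_lambda _ fun s => ?_)
    · split_ifs <;> fun_prop
    · split_ifs <;> fun_prop
  · exact measurable_const

lemma Measurable.of_discrete_index {τ β ξ δ : Type*} [MeasurableSpace τ] [Countable τ]
    [DiscreteMeasurableSpace τ] [MeasurableSpace β] [MeasurableSpace ξ] [MeasurableSpace δ]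
    {g : τ → β → δ} (hg : ∀ t, Measurable (g t)) {T : ξ → τ} {b : ξ → β} (hT : Measurable T)
    (hb : Measurable b) : Measurable fun x => g (T x) (b x) := by
  have : Measurable fun p : τ × β => g p.1 p.2 := measurable_from_prod_countable_right hg
  exact this.comp (hT.prodMk hb)

lemma measurable_update_prod {α : Type*} [MeasurableSpace α] (t : Fin n) :
    Measurable fun p : α × (Fin n → α) => Function.update p.2 t p.1 := by
  refine measurable_pi_lambda _ fun s => ?_
  by_cases h : s = t
  · subst h
    simp only [Function.update_self]
    fun_prop
  · simp only [Function.update_of_ne h]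
    fun_prop

/-- Substituting an independent letter into an i.i.d. block gives an i.i.d. block. -/
lemma map_update_prod_pi {α : Type*} [MeasurableSpace α] (Q : Measure α) [IsProbabilityMeasure Q]
    (t : Fin n) :
    (Q.prod (Measure.pi fun _ : Fin n => Q)).map (fun p => Function.update p.2 t p.1) =
      Measure.pi fun _ : Fin n => Q := by
  have hm := measurable_update_prod (α := α) t
  refine (Measure.pi_eq fun B hB => ?_).symm
  rw [Measure.map_apply hm (MeasurableSet.univ_pi hB)]
  -- The overwritten entry of the block is unconstrained and contributes the factor `Q Set.univ =
  -- 1`.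
  have h1 : (fun p : α × (Fin n → α) => Function.update p.2 t p.1) ⁻¹' (Set.univ.pi B) =
      B t ×ˢ (Set.univ.pi (Function.update B t Set.univ)) := by
    ext ⟨q, s⟩
    simp only [Set.mem_preimage, Set.mem_pi, Set.mem_univ, true_implies, Set.mem_prod]
    constructor
    · intro h
      refine ⟨by simpa using h t, fun i => ?_⟩
      by_cases hi : i = t
      · subst hi; simp
      · simpa [Function.update_of_ne hi] using h i
    · rintro ⟨h, h'⟩ i
      by_cases hi : i = t
      · subst hi; simpa using h
      · simpa [Function.update_of_ne hi] using h' i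
  rw [h1, Measure.prod_prod, Measure.pi_pi, ← Finset.mul_prod_erase Finset.univ (fun i => Q (B i))
    (Finset.mem_univ t), ← Finset.mul_prod_erase Finset.univ _ (Finset.mem_univ t)]
  simp only [Function.update_self, measure_univ, one_mul]
  congr 1
  refine Finset.prod_congr rfl fun i hi => ?_
  rw [Function.update_of_ne (Finset.ne_of_mem_erase hi)]

/-- The law of the current letter, the time-sharing index and the rest of the block. -/
noncomputable def shareLaw (Q : Measure (𝒳 × ℰ)) (w : Measure (ShareIdx n)) :
    Measure ((𝒳 × ℰ) × (ShareIdx n × (Fin n → 𝒳 × ℰ))) :=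
  Q.prod (w.prod (Measure.pi fun _ : Fin n => Q))

variable {Q : Measure (𝒳 × ℰ)} [IsProbabilityMeasure Q] {w : Measure (ShareIdx n)}
  [IsProbabilityMeasure w]

instance : IsProbabilityMeasure (shareLaw Q w) := by
  unfold shareLaw
  infer_instance

/-- Moving the time-sharing index to the front gives the shape in which expectations and entropies
split over the index. -/
lemma shareLaw_eq_map : (w.prod (Q.prod (Measure.pi fun _ : Fin n => Q))).map
    (fun p => (p.2.1, (p.1, p.2.2))) = shareLaw Q w := by
  refine Measure.ext_of_lintegral _ fun F hF => ?_
  rw [lintegral_map hF (by fun_prop), lintegral_prod _ (by fun_prop), shareLaw,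
    lintegral_prod _ (by fun_prop)]
  have h1 : ∀ t, ∫⁻ p, F (p.1, t, p.2) ∂(Q.prod (Measure.pi fun _ : Fin n => Q)) =
      ∫⁻ q, ∫⁻ s, F (q, t, s) ∂(Measure.pi fun _ : Fin n => Q) ∂Q := fun t =>
    lintegral_prod _ (by fun_prop)
  have h2 : ∀ q, ∫⁻ p, F (q, p) ∂(w.prod (Measure.pi fun _ : Fin n => Q)) =
      ∫⁻ t, ∫⁻ s, F (q, t, s) ∂(Measure.pi fun _ : Fin n => Q) ∂w := fun q =>
    lintegral_prod _ (by fun_prop)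
  simp only [h1, h2]
  refine lintegral_lintegral_swap ?_
  refine Measurable.aemeasurable ?_
  exact Measurable.lintegral_prod_right' (f := fun z : (ShareIdx n × (𝒳 × ℰ)) × (Fin n → 𝒳 × ℰ) =>
    F (z.1.2, z.1.1, z.2)) (by fun_prop)

lemma condEnt_shareLaw {γ ι : Type*} [MeasurableSpace γ] [MeasurableSpace ι] [Fintype ι]
    [DiscreteMeasurableSpace ι] [Nonempty ι]
    {J : ShareIdx n → (𝒳 × ℰ) × (Fin n → 𝒳 × ℰ) → ι}
    {G : ShareIdx n → (𝒳 × ℰ) × (Fin n → 𝒳 × ℰ) → γ} (hJ : ∀ t, Measurable (J t))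
    (hG : ∀ t, Measurable (G t)) :
    condEnt (shareLaw Q w) (fun ω => J ω.2.1 (ω.1, ω.2.2))
      (fun ω => (ω.2.1, G ω.2.1 (ω.1, ω.2.2))) =
      ∑ t, w.real {t} * condEnt (Q.prod (Measure.pi fun _ : Fin n => Q)) (J t) (G t) := by
  have hJm : Measurable fun ω : (𝒳 × ℰ) × (ShareIdx n × (Fin n → 𝒳 × ℰ)) =>
      J ω.2.1 (ω.1, ω.2.2) := Measurable.of_discrete_index hJ (by fun_prop) (by fun_prop)
  have hGm : Measurable fun ω : (𝒳 × ℰ) × (ShareIdx n × (Fin n → 𝒳 × ℰ)) =>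
      G ω.2.1 (ω.1, ω.2.2) := Measurable.of_discrete_index hG (by fun_prop) (by fun_prop)
  have h := condEnt_map (μ := w.prod (Q.prod (Measure.pi fun _ : Fin n => Q)))
    (F := fun p => (p.2.1, (p.1, p.2.2))) (by fun_prop) hJm
    ((by fun_prop : Measurable fun ω : (𝒳 × ℰ) × (ShareIdx n × (Fin n → 𝒳 × ℰ)) => ω.2.1).prodMk
      hGm)
  simp only [shareLaw_eq_map] at h
  rw [h]
  exact condEnt_mixture w (Q.prod (Measure.pi fun _ : Fin n => Q)) (J := fun p => J p.1 p.2)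
    (G := fun p => G p.1 p.2) (Measurable.of_discrete_index hJ measurable_fst measurable_snd)
    (Measurable.of_discrete_index hG measurable_fst measurable_snd)

end SingleLetter
end GaussSI
namespace GaussSI

/-! ### Telescoping of the entropies along the block. -/

section SingleLetterRate

variable {𝒳 ℰ 𝒜 𝒴 : Type*} [MeasurableSpace 𝒳] [StandardBorelSpace 𝒳] [Inhabited 𝒳]
  [MeasurableSpace ℰ] [StandardBorelSpace ℰ] [Inhabited ℰ]
  [MeasurableSpace 𝒜] [StandardBorelSpace 𝒜] [Inhabited 𝒜]
  [MeasurableSpace 𝒴] [StandardBorelSpace 𝒴] [Inhabited 𝒴] {n M L : ℕ}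

/-- All the side information before time `t`, the side information `ya` at all times. -/
def weakPast (ya : ℰ → 𝒜) (t : ℕ) (S : Fin n → 𝒳 × ℰ) : (Fin n → ℰ) × (Fin n → 𝒜) :=
  (fun s => if (s : ℕ) < t then (S s).2 else default, fun s => ya (S s).2)

/-- The source before time `t`, all the side information at all times. -/
def strongPast (t : ℕ) (S : Fin n → 𝒳 × ℰ) : (Fin n → 𝒳) × (Fin n → ℰ) :=
  (fun s => if (s : ℕ) < t then (S s).1 else default, fun s => (S s).2)

lemma measurable_weakPast {ya : ℰ → 𝒜} (hya : Measurable ya) (t : ℕ) :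
    Measurable (weakPast (𝒳 := 𝒳) (n := n) ya t) := by
  refine Measurable.prodMk (measurable_pi_lambda _ fun s => ?_)
    (measurable_pi_lambda _ fun s => ?_)
  · split_ifs <;> fun_prop
  · fun_prop

lemma measurable_strongPast (t : ℕ) :
    Measurable (strongPast (𝒳 := 𝒳) (ℰ := ℰ) (n := n) t) := by
  refine Measurable.prodMk (measurable_pi_lambda _ fun s => ?_)
    (measurable_pi_lambda _ fun s => ?_)
  · split_ifs <;> fun_prop
  · fun_prop

variable {Q : Measure (𝒳 × ℰ)} [IsProbabilityMeasure Q] {f : (Fin n → 𝒳) → Fin M}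
  {φ : 𝒳 → Fin L} {ya : ℰ → 𝒜} {y : ℰ → 𝒴}

/-- The codeword of a block. -/
def blockIndex (L : ℕ) (f : (Fin n → 𝒳) → Fin M) (S : Fin n → 𝒳 × ℰ) : Fin M ⊕ Fin L :=
  .inl (f fun s => (S s).1)

lemma measurable_blockIndex (hf : Measurable f) :
    Measurable (blockIndex (ℰ := ℰ) L f) :=
  measurable_inl.comp (hf.comp (by fun_prop))

variable [Nonempty (Fin M ⊕ Fin L)]

/-- After substitution of the current letter the block is i.i.d. and the transmitted index is its
codeword, so single-letter entropies compare with block entropies. Here `G` determines `H`; the next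
lemma treats the opposite case. -/
lemma condEnt_le_condEnt_block {γ δ : Type*} [MeasurableSpace γ] [MeasurableSpace δ]
    (hf : Measurable f) (hφ : Measurable φ)
    (t : Fin n) {G : (𝒳 × ℰ) × (Fin n → 𝒳 × ℰ) → γ} (hG : Measurable G)
    {H : (Fin n → 𝒳 × ℰ) → δ} (hH : Measurable H) {h : γ → δ} (hh : Measurable h)
    (hGH : ∀ p, H (Function.update p.2 t p.1) = h (G p)) :
    condEnt (Q.prod (Measure.pi fun _ : Fin n => Q)) (sharedIndex f φ (.inl t)) G ≤
      condEnt (Measure.pi fun _ : Fin n => Q) (blockIndex L f) H := by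
  have key := condEnt_map (μ := Q.prod (Measure.pi fun _ : Fin n => Q)) (measurable_update_prod t)
    (measurable_blockIndex (L := L) hf) hH
  simp only [map_update_prod_pi] at key
  rw [key]
  exact condEnt_le_of_eq_comp (measurable_sharedIndex hf hφ (.inl t)) hG hh hGH

lemma condEnt_block_le_condEnt {γ δ : Type*} [MeasurableSpace γ] [MeasurableSpace δ]
    (hf : Measurable f) (hφ : Measurable φ)
    (t : Fin n) {G : (𝒳 × ℰ) × (Fin n → 𝒳 × ℰ) → γ}
    {H : (Fin n → 𝒳 × ℰ) → δ} (hH : Measurable H) {h : δ → γ} (hh : Measurable h)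
    (hGH : ∀ p, G p = h (H (Function.update p.2 t p.1))) :
    condEnt (Measure.pi fun _ : Fin n => Q) (blockIndex L f) H ≤
      condEnt (Q.prod (Measure.pi fun _ : Fin n => Q)) (sharedIndex f φ (.inl t)) G := by
  have key := condEnt_map (μ := Q.prod (Measure.pi fun _ : Fin n => Q)) (measurable_update_prod t)
    (measurable_blockIndex (L := L) hf) hH
  simp only [map_update_prod_pi] at key
  rw [key]
  exact condEnt_le_of_eq_comp (measurable_sharedIndex hf hφ (.inl t))
    (hH.comp (measurable_update_prod t)) hh hGH

variable (Q f φ ya y) in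
/-- The entropies entering the bound, for a fixed time-sharing index. -/
noncomputable def indexGap (t : ShareIdx n) : ℝ :=
  condEnt (Q.prod (Measure.pi fun _ : Fin n => Q)) (sharedIndex f φ t)
      (fun p => (ya p.1.2, weakMask ya t p.2)) +
    condEnt (Q.prod (Measure.pi fun _ : Fin n => Q)) (sharedIndex f φ t)
      (fun p => (p.1.2, weakMask ya t p.2, strongMask t p.2)) -
    condEnt (Q.prod (Measure.pi fun _ : Fin n => Q)) (sharedIndex f φ t)
      (fun p => (y p.1.2, weakMask ya t p.2)) -
    condEnt (Q.prod (Measure.pi fun _ : Fin n => Q)) (sharedIndex f φ t)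
      (fun p => (y p.1.2, p.1.1, weakMask ya t p.2, strongMask t p.2))

/-- The masks omit exactly the current letter. Restoring `ya` (resp. all the side information) at
position `t` yields the past up to `t`; in the negative terms the conditioning is a function of the
past up to `t + 1`. -/
lemma indexGap_inl_le (hf : Measurable f) (hφ : Measurable φ) (hya : Measurable ya)
    (hy : Measurable y) (t : Fin n) :
    indexGap Q f φ ya y (.inl t) ≤
      condEnt (Measure.pi fun _ : Fin n => Q) (blockIndex L f) (weakPast ya t) +
      condEnt (Measure.pi fun _ : Fin n => Q) (blockIndex L f) (strongPast t) -
      condEnt (Measure.pi fun _ : Fin n => Q) (blockIndex L f) (weakPast ya (t + 1)) -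
      condEnt (Measure.pi fun _ : Fin n => Q) (blockIndex L f) (strongPast (t + 1)) := by
  have hw := measurable_weakMask (𝒳 := 𝒳) (n := n) hya (.inl t)
  have hs := measurable_strongMask (𝒳 := 𝒳) (ℰ := ℰ) (n := n) (.inl t)
  have ha := condEnt_le_condEnt_block (Q := Q) (L := L) hf hφ t
    (G := fun p => (ya p.1.2, weakMask ya (.inl t) p.2)) (by fun_prop)
    (measurable_weakPast hya t)
    (h := fun z => (z.2.1, fun s => if s = t then z.1 else z.2.2 s))
    (by
      refine Measurable.prodMk (by fun_prop) (measurable_pi_lambda _ fun s => ?_)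
      split_ifs <;> fun_prop)
    (by
      rintro ⟨q, S⟩
      refine Prod.ext (funext fun s => ?_) (funext fun s => ?_)
      · by_cases h : s < t
        · simp [weakPast, weakMask, h, Function.update_of_ne h.ne]
        · simp [weakPast, weakMask, h]
      · by_cases h : s = t
        · subst h; simp [weakPast]
        · simp [weakPast, weakMask, h])
  have hb := condEnt_block_le_condEnt (Q := Q) (L := L) hf hφ t
    (G := fun p => (y p.1.2, weakMask ya (.inl t) p.2))
    (measurable_weakPast hya (t + 1))
    (h := fun z => (y (z.1 t), fun s => if s < t then z.1 s else default,
      fun s => if s = t then default else z.2 s))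
    (by
      refine Measurable.prodMk (by fun_prop) (Measurable.prodMk
        (measurable_pi_lambda _ fun s => ?_) (measurable_pi_lambda _ fun s => ?_)) <;>
      split_ifs <;> fun_prop)
    (by
      rintro ⟨q, S⟩
      refine Prod.ext (by simp [weakPast]) (Prod.ext (funext fun s => ?_) (funext fun s => ?_))
      · by_cases h : s < t
        · simp [weakPast, weakMask, h, Function.update_of_ne h.ne, h.le]
        · simp [weakPast, weakMask, h]
      · by_cases h : s = t
        · subst h; simp [weakMask]
        · simp [weakPast, weakMask, h])
  have hc := condEnt_le_condEnt_block (Q := Q) (L := L) hf hφ t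
    (G := fun p => (p.1.2, weakMask ya (.inl t) p.2, strongMask (.inl t) p.2)) (by fun_prop)
    (measurable_strongPast t)
    (h := fun z => (z.2.2.1, fun s => if s = t then z.1 else z.2.2.2 s))
    (by
      refine Measurable.prodMk (by fun_prop) (measurable_pi_lambda _ fun s => ?_)
      split_ifs <;> fun_prop)
    (by
      rintro ⟨q, S⟩
      refine Prod.ext (funext fun s => ?_) (funext fun s => ?_)
      · by_cases h : s < t
        · simp [strongPast, strongMask, h, Function.update_of_ne h.ne]
        · simp [strongPast, strongMask, h]
      · by_cases h : s = t
        · subst h; simp [strongPast]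
        · simp [strongPast, strongMask, h])
  have hd := condEnt_block_le_condEnt (Q := Q) (L := L) hf hφ t
    (G := fun p => (y p.1.2, p.1.1, weakMask ya (.inl t) p.2, strongMask (.inl t) p.2))
    (measurable_strongPast (t + 1))
    (h := fun z => (y (z.2 t), z.1 t, (fun s => if s < t then z.2 s else default,
      fun s => if s = t then default else ya (z.2 s)),
      fun s => if s < t then z.1 s else default,
      fun s => if s = t then default else z.2 s))
    (by
      refine Measurable.prodMk (by fun_prop) (Measurable.prodMk (by fun_prop) (Measurable.prodMk
        (Measurable.prodMk
        (measurable_pi_lambda _ fun s => ?_) (measurable_pi_lambda _ fun s => ?_))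
        (Measurable.prodMk
        (measurable_pi_lambda _ fun s => ?_) (measurable_pi_lambda _ fun s => ?_)))) <;>
      split_ifs <;> fun_prop)
    (by
      rintro ⟨q, S⟩
      refine Prod.ext (by simp [strongPast]) (Prod.ext (by simp [strongPast]) (Prod.ext
        (Prod.ext (funext fun s => ?_) (funext fun s => ?_))
        (Prod.ext (funext fun s => ?_) (funext fun s => ?_))))
      · by_cases h : s < t
        · simp [strongPast, weakMask, h, Function.update_of_ne h.ne]
        · simp [weakMask, h]
      · by_cases h : s = t
        · subst h; simp [weakMask]
        · simp [strongPast, weakMask, h]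
      · by_cases h : s < t
        · simp [strongPast, strongMask, h, Function.update_of_ne h.ne, h.le]
        · simp [strongMask, h]
      · by_cases h : s = t
        · subst h; simp [strongMask]
        · simp [strongPast, strongMask, h])
  unfold indexGap
  linarith

/-- The sum telescopes. The strong past at time 0 and the weak past at time `n` both amount to all
the side information, so their entropies cancel, and the other terms are at most `Real.log M` and at
least 0. -/
lemma sum_indexGap_inl_le (hf : Measurable f) (hφ : Measurable φ) (hya : Measurable ya)
    (hy : Measurable y) :
    ∑ t : Fin n, indexGap Q f φ ya y (.inl t) ≤ Real.log M := by
  set h : ℕ → ℝ := fun t =>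
    condEnt (Measure.pi fun _ : Fin n => Q) (blockIndex L f) (weakPast ya t) +
      condEnt (Measure.pi fun _ : Fin n => Q) (blockIndex L f) (strongPast t) with hh
  have h1 : ∑ t : Fin n, indexGap Q f φ ya y (.inl t) ≤ ∑ t : Fin n, (h t - h (t + 1)) :=
    Finset.sum_le_sum fun t _ => by
      have := indexGap_inl_le (Q := Q) (L := L) hf hφ hya hy t
      simp only [hh]
      linarith
  have h2 : ∑ t : Fin n, (h t - h (t + 1)) = h 0 - h n := by
    rw [Fin.sum_univ_eq_sum_range fun t => h t - h (t + 1)]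
    exact Finset.sum_range_sub' h n
  have hJ := measurable_blockIndex (ℰ := ℰ) (L := L) hf
  have h3 : condEnt (Measure.pi fun _ : Fin n => Q) (blockIndex L f) (strongPast 0) ≤
      condEnt (Measure.pi fun _ : Fin n => Q) (blockIndex L f) (weakPast ya n) :=
    condEnt_le_of_eq_comp hJ (measurable_strongPast 0)
      (h := fun z => (z.2, fun s => ya (z.2 s))) (by fun_prop)
      (fun S => by simp [weakPast, strongPast])
  have h4 : 0 ≤ condEnt (Measure.pi fun _ : Fin n => Q) (blockIndex L f) (strongPast n) :=
    condEnt_nonneg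
  have h5 : condEnt (Measure.pi fun _ : Fin n => Q) (blockIndex L f) (weakPast ya 0) ≤
      Real.log M := by
    have := condEnt_le_log_card (μ := Measure.pi fun _ : Fin n => Q) hJ
      (measurable_weakPast hya 0) (Finset.univ.map ⟨Sum.inl, Sum.inl_injective⟩)
      (fun S => by simp [blockIndex])
    simpa using this
  simp only [hh] at h2
  linarith

/-- The masks are constant here and the full side information determines `y`, so the two middle
entropies contribute at most 0 and only the entropy of the quantizer output remains. -/
lemma indexGap_inr_le (hφ : Measurable φ) (hf : Measurable f) (hya : Measurable ya)
    (hy : Measurable y) : indexGap Q f φ ya y (.inr ()) ≤ Real.log L := by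
  have hw := measurable_weakMask (𝒳 := 𝒳) (n := n) hya (.inr ())
  have hs := measurable_strongMask (𝒳 := 𝒳) (ℰ := ℰ) (n := n) (.inr ())
  have hJ := measurable_sharedIndex (ℰ := ℰ) hf hφ (.inr ())
  have ha : condEnt (Q.prod (Measure.pi fun _ : Fin n => Q)) (sharedIndex f φ (.inr ()))
      (fun p => (ya p.1.2, weakMask ya (.inr ()) p.2)) ≤ Real.log L := by
    have := condEnt_le_log_card (μ := Q.prod (Measure.pi fun _ : Fin n => Q)) hJ
      (G := fun p => (ya p.1.2, weakMask ya (.inr ()) p.2)) (by fun_prop)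
      (Finset.univ.map ⟨Sum.inr, Sum.inr_injective⟩)
      (fun S => by simp [sharedIndex])
    simpa using this
  have hbc : condEnt (Q.prod (Measure.pi fun _ : Fin n => Q)) (sharedIndex f φ (.inr ()))
      (fun p => (p.1.2, weakMask ya (.inr ()) p.2, strongMask (.inr ()) p.2)) ≤
      condEnt (Q.prod (Measure.pi fun _ : Fin n => Q)) (sharedIndex f φ (.inr ()))
      (fun p => (y p.1.2, weakMask ya (.inr ()) p.2)) :=
    condEnt_le_of_eq_comp hJ (by fun_prop) (h := fun z => (y z.1, z.2.1)) (by fun_prop)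
      (fun _ => rfl)
  have hd : 0 ≤ condEnt (Q.prod (Measure.pi fun _ : Fin n => Q)) (sharedIndex f φ (.inr ()))
      (fun p => (y p.1.2, p.1.1, weakMask ya (.inr ()) p.2, strongMask (.inr ()) p.2)) :=
    condEnt_nonneg
  unfold indexGap
  linarith

end SingleLetterRate
end GaussSI
namespace GaussSI

/-! ### Information carried by the auxiliary variables. -/

section SharedAuxiliaries

variable {𝒳 ℰ 𝒜 𝒴 𝒩 : Type*} [MeasurableSpace 𝒳] [StandardBorelSpace 𝒳] [Inhabited 𝒳]
  [MeasurableSpace ℰ] [StandardBorelSpace ℰ] [Inhabited ℰ]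
  [MeasurableSpace 𝒜] [StandardBorelSpace 𝒜] [Inhabited 𝒜]
  [MeasurableSpace 𝒴] [StandardBorelSpace 𝒴] [Inhabited 𝒴]
  [MeasurableSpace 𝒩] [StandardBorelSpace 𝒩] [Inhabited 𝒩] {n M L : ℕ}

/-- The transmitted index, as a random variable. -/
def sharedCodeword (f : (Fin n → 𝒳) → Fin M) (φ : 𝒳 → Fin L)
    (ω : (𝒳 × ℰ) × (ShareIdx n × (Fin n → 𝒳 × ℰ))) : Fin M ⊕ Fin L :=
  sharedIndex f φ ω.2.1 (ω.1, ω.2.2)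

/-- The time-sharing index and the corresponding weak masking of the block. -/
def weakAux (ya : ℰ → 𝒜) (θ : ShareIdx n × (Fin n → 𝒳 × ℰ)) :
    ShareIdx n × ((Fin n → ℰ) × (Fin n → 𝒜)) :=
  (θ.1, weakMask ya θ.1 θ.2)

/-- The strong masking of the block given by the time-sharing index. -/
def strongAux (θ : ShareIdx n × (Fin n → 𝒳 × ℰ)) : (Fin n → 𝒳) × (Fin n → ℰ) :=
  strongMask θ.1 θ.2

variable {f : (Fin n → 𝒳) → Fin M} {φ : 𝒳 → Fin L} {ya : ℰ → 𝒜} {y : ℰ → 𝒴} {o : ℰ → 𝒩}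

lemma measurable_sharedCodeword (hf : Measurable f) (hφ : Measurable φ) :
    Measurable (sharedCodeword (ℰ := ℰ) f φ) :=
  Measurable.of_discrete_index (measurable_sharedIndex hf hφ) (by fun_prop) (by fun_prop)

lemma measurable_weakAux (hya : Measurable ya) : Measurable (weakAux (𝒳 := 𝒳) (n := n) ya) :=
  measurable_fst.prodMk
    (Measurable.of_discrete_index (measurable_weakMask hya) measurable_fst measurable_snd)

lemma measurable_strongAux : Measurable (strongAux (𝒳 := 𝒳) (ℰ := ℰ) (n := n)) :=
  Measurable.of_discrete_index measurable_strongMask measurable_fst measurable_snd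

/-- The transmitted index does not depend on the current side information. -/
lemma sharedIndex_congr (t : ShareIdx n) (x : 𝒳) (e e' : ℰ) (S : Fin n → 𝒳 × ℰ) :
    sharedIndex f φ t ((x, e), S) = sharedIndex f φ t ((x, e'), S) := by
  rcases t with t | t
  · simp only [sharedIndex]
    congr 2
    funext s
    by_cases h : s = t
    · subst h; simp
    · simp [Function.update_of_ne h]
  · rfl

/-- The transmitted index as a function of the source letter and the independent part. -/
def sharedCodewordOf (f : (Fin n → 𝒳) → Fin M) (φ : 𝒳 → Fin L)
    (a : 𝒳 × (ShareIdx n × (Fin n → 𝒳 × ℰ))) : Fin M ⊕ Fin L :=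
  sharedIndex f φ a.2.1 ((a.1, default), a.2.2)

lemma measurable_sharedCodewordOf (hf : Measurable f) (hφ : Measurable φ) :
    Measurable (sharedCodewordOf (ℰ := ℰ) f φ) :=
  Measurable.of_discrete_index (measurable_sharedIndex hf hφ) (by fun_prop) (by fun_prop)

lemma sharedCodeword_eq (ω : (𝒳 × ℰ) × (ShareIdx n × (Fin n → 𝒳 × ℰ))) :
    sharedCodeword f φ ω = sharedCodewordOf f φ (ω.1.1, ω.2) :=
  sharedIndex_congr _ _ _ _ _

variable {Q : Measure (𝒳 × ℰ)} [IsProbabilityMeasure Q] {w : Measure (ShareIdx n)}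
  [IsProbabilityMeasure w]

/-- A conditional independence of the letter persists when the independent part joins `A` and some
function `g` of both moves into the conditioning. -/
lemma condIndepFun_shareLaw {α : Type*} [MeasurableSpace α] [StandardBorelSpace α]
    [Nonempty α] {A : 𝒳 × ℰ → 𝒜} {N : 𝒳 × ℰ → 𝒩} {C : 𝒳 × ℰ → 𝒴} (hA : Measurable A)
    (hN : Measurable N) (hC : Measurable C)
    (h : CondIndepFun (MeasurableSpace.comap C inferInstance) hC.comap_le A N Q)
    {δ : Type*} [MeasurableSpace δ]
    {a : 𝒜 × (ShareIdx n × (Fin n → 𝒳 × ℰ)) → α} (ha : Measurable a)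
    {g : 𝒜 × (ShareIdx n × (Fin n → 𝒳 × ℰ)) → δ} (hg : Measurable g) :
    CondIndepFun (MeasurableSpace.comap (fun ω => (C ω.1, g (A ω.1, ω.2))) inferInstance)
      ((hC.comp measurable_fst).prodMk (hg.comp
        ((hA.comp measurable_fst).prodMk measurable_snd))).comap_le
      (fun ω => a (A ω.1, ω.2)) (fun ω => N ω.1) (shareLaw Q w) :=
  condIndepFun_weak_union ((hA.comp measurable_fst).prodMk measurable_snd)
    (hN.comp measurable_fst) (hC.comp measurable_fst)
    (condIndepFun_prod hA hN hC h (w.prod (Measure.pi fun _ : Fin n => Q))) ha hg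

variable [Nonempty (Fin M ⊕ Fin L)]

/-- The two informations entering the lower bound, for the auxiliary variables of the
time-sharing construction. -/
lemma condMutualInfo_shareLaw_le (hf : Measurable f) (hφ : Measurable φ) (hya : Measurable ya)
    (hy : Measurable y) (ho : Measurable o) {r : 𝒴 × 𝒩 → ℰ} (hr : Measurable r)
    (hro : ∀ e, r (y e, o e) = e)
    (h : CondIndepFun (MeasurableSpace.comap (fun q : 𝒳 × ℰ => y q.2) inferInstance)
      (hy.comp measurable_snd).comap_le Prod.fst (fun q => o q.2) Q) :
    condMutualInfo (shareLaw Q w) (fun ω => ω.1.1)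
        (fun ω => (sharedCodeword f φ ω, weakAux ya ω.2)) (fun ω => ya ω.1.2) +
      condMutualInfo (shareLaw Q w) (fun ω => ω.1.1) (fun ω => strongAux ω.2)
        (fun ω => (sharedCodeword f φ ω, (y ω.1.2, weakAux ya ω.2))) ≤
      ENNReal.ofReal (∑ t, w.real {t} * indexGap Q f φ ya y t) := by
  have hJ := measurable_sharedCodeword (ℰ := ℰ) hf hφ
  have hJ' := measurable_sharedCodewordOf (ℰ := ℰ) hf hφ
  have hw := measurable_weakAux (𝒳 := 𝒳) (n := n) hya
  have hs := measurable_strongAux (𝒳 := 𝒳) (ℰ := ℰ) (n := n)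
  have hw' := fun t => measurable_weakMask (𝒳 := 𝒳) (n := n) hya t
  have hs' := fun t => measurable_strongMask (𝒳 := 𝒳) (ℰ := ℰ) (n := n) t
  -- The masks are functions of the independent part alone, so given the side information (and, in
  -- `c2`, the weak mask) they are independent of the current source letter.
  have c1 : CondIndepFun (MeasurableSpace.comap (fun ω => ya ω.1.2) inferInstance)
      ((hya.comp measurable_snd).comp measurable_fst).comap_le (fun ω => ω.1.1)
      (fun ω => weakAux ya ω.2) (shareLaw Q w) := by
    have := condIndepFun_prod (C := fun q : 𝒳 × ℰ => ya q.2) (A := fun _ : 𝒳 × ℰ => ())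
      (N := Prod.fst) measurable_const measurable_fst (by fun_prop)
      (condIndepFun_const_left (μ := Q) () Prod.fst) (w.prod (Measure.pi fun _ : Fin n => Q))
    exact (this.comp (hw.comp measurable_snd) measurable_id).symm
  have c2 : CondIndepFun (MeasurableSpace.comap (fun ω => (y ω.1.2, weakAux ya ω.2)) inferInstance)
      ((hy.comp (measurable_snd.comp measurable_fst)).prodMk (hw.comp measurable_snd)).comap_le
      (fun ω => ω.1.1) (fun ω => strongAux ω.2) (shareLaw Q w) :=
    (condIndepFun_shareLaw (A := fun _ : 𝒳 × ℰ => ()) (N := Prod.fst)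
      (C := fun q : 𝒳 × ℰ => y q.2) measurable_const measurable_fst (by fun_prop)
      (condIndepFun_const_left (μ := Q) () Prod.fst) (hs.comp measurable_snd)
      (hw.comp measurable_snd)).symm
  have k1 := condMutualInfo_adjoin_le (A := fun ω => ω.1.1) (by fun_prop) (by fun_prop)
    (by fun_prop) hJ c1
  obtain ⟨k2, k3⟩ := condMutualInfo_given_le (A := fun ω => ω.1.1) (by fun_prop) (by fun_prop)
    (by fun_prop) hJ c2
  -- Given the source letter, the index is independent of the current side information. So `y` may
  -- be dropped, all the side information added for free, and then reduced to `ya`. This matches the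
  -- negative term of `k1` with a positive term of `k3`.
  have m2 : condEnt (shareLaw Q w) (sharedCodeword f φ)
      (fun ω => ((y ω.1.2, weakAux ya ω.2), ω.1.1)) ≤
      condEnt (shareLaw Q w) (sharedCodeword f φ) (fun ω => (ya ω.1.2, ω.1.1, weakAux ya ω.2)) := by
    have c := condIndepFun_shareLaw (w := w) (A := Prod.fst) (N := Prod.snd) (C := Prod.fst)
      measurable_fst measurable_snd measurable_fst
      (condIndepFun_self_left (μ := Q) measurable_snd measurable_fst) hJ' (hw.comp measurable_snd)
    simp only [← sharedCodeword_eq] at c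
    have e := condEnt_eq_of_condIndepFun hJ (by fun_prop) (by fun_prop) c
    refine (condEnt_le_of_eq_comp hJ (by fun_prop) (h := fun z => (z.2, z.1.2)) (by fun_prop)
      fun ω => rfl).trans (e.symm.le.trans ?_)
    exact condEnt_le_of_eq_comp hJ (by fun_prop)
      (h := fun z : (𝒳 × _) × ℰ => (ya z.2, z.1.1, z.1.2)) (by fun_prop) fun ω => rfl
  -- The Markov chain through `y` lets `o` join the conditioning at no cost, and `y` and `o`
  -- together determine the full side information by `hro`.
  have m1 : condEnt (shareLaw Q w) (sharedCodeword f φ)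
      (fun ω => ((y ω.1.2, weakAux ya ω.2), strongAux ω.2)) ≤
      condEnt (shareLaw Q w) (sharedCodeword f φ)
        (fun ω => (ω.2.1, (ω.1.2, weakMask ya ω.2.1 ω.2.2, strongMask ω.2.1 ω.2.2))) := by
    have c := condIndepFun_shareLaw (w := w) (A := Prod.fst) (N := fun q : 𝒳 × ℰ => o q.2)
      (C := fun q => y q.2) measurable_fst (by fun_prop) (by fun_prop) h hJ'
      (g := fun a => (weakAux ya a.2, strongAux a.2)) (by fun_prop)
    simp only [← sharedCodeword_eq] at c
    have e := condEnt_eq_of_condIndepFun hJ (by fun_prop) (by fun_prop) c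
    refine (condEnt_le_of_eq_comp hJ (by fun_prop) (h := fun z => (z.1.1, z.1.2, z.2))
      (by fun_prop) fun ω => rfl).trans (e.symm.le.trans ?_)
    exact condEnt_le_of_eq_comp hJ (by fun_prop)
      (h := fun z : (𝒴 × (ShareIdx n × ((Fin n → ℰ) × (Fin n → 𝒜))) × _) × 𝒩 =>
        (z.1.2.1.1, r (z.1.1, z.2), z.1.2.1.2, z.1.2.2)) (by fun_prop)
      fun ω => by simp [hro, weakAux, strongAux]
  have a : condEnt (shareLaw Q w) (sharedCodeword f φ) (fun ω => (ya ω.1.2, weakAux ya ω.2)) ≤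
      condEnt (shareLaw Q w) (sharedCodeword f φ)
        (fun ω => (ω.2.1, (ya ω.1.2, weakMask ya ω.2.1 ω.2.2))) :=
    condEnt_le_of_eq_comp hJ (by fun_prop) (h := fun z => (z.2.1, (z.1, z.2.2))) (by fun_prop)
      fun ω => rfl
  have mw : Measurable fun ω : (𝒳 × ℰ) × (ShareIdx n × (Fin n → 𝒳 × ℰ)) =>
      weakMask ya ω.2.1 ω.2.2 := (measurable_snd.comp hw).comp measurable_snd
  have b : condEnt (shareLaw Q w) (sharedCodeword f φ)
        (fun ω => (ω.2.1, (y ω.1.2, weakMask ya ω.2.1 ω.2.2))) ≤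
      condEnt (shareLaw Q w) (sharedCodeword f φ) (fun ω => (y ω.1.2, weakAux ya ω.2)) :=
    condEnt_le_of_eq_comp hJ (by fun_prop) (h := fun z => (z.2.1, (z.1, z.2.2))) (by fun_prop)
      fun ω => rfl
  have ms : Measurable fun ω : (𝒳 × ℰ) × (ShareIdx n × (Fin n → 𝒳 × ℰ)) =>
      strongMask ω.2.1 ω.2.2 := hs.comp measurable_snd
  have d : condEnt (shareLaw Q w) (sharedCodeword f φ)
        (fun ω => (ω.2.1, (y ω.1.2, ω.1.1, weakMask ya ω.2.1 ω.2.2, strongMask ω.2.1 ω.2.2))) ≤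
      condEnt (shareLaw Q w) (sharedCodeword f φ)
        (fun ω => ((y ω.1.2, weakAux ya ω.2), ω.1.1, strongAux ω.2)) :=
    condEnt_le_of_eq_comp hJ (by fun_prop)
      (h := fun z => ((z.2.1, (z.1, z.2.2.2.1)), z.2.2.1, z.2.2.2.2)) (by fun_prop) fun ω => rfl
  have sum : condEnt (shareLaw Q w) (sharedCodeword f φ)
        (fun ω => (ω.2.1, (ya ω.1.2, weakMask ya ω.2.1 ω.2.2))) +
      condEnt (shareLaw Q w) (sharedCodeword f φ)
        (fun ω => (ω.2.1, (ω.1.2, weakMask ya ω.2.1 ω.2.2, strongMask ω.2.1 ω.2.2))) -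
      condEnt (shareLaw Q w) (sharedCodeword f φ)
        (fun ω => (ω.2.1, (y ω.1.2, weakMask ya ω.2.1 ω.2.2))) -
      condEnt (shareLaw Q w) (sharedCodeword f φ)
        (fun ω => (ω.2.1, (y ω.1.2, ω.1.1, weakMask ya ω.2.1 ω.2.2, strongMask ω.2.1 ω.2.2))) =
      ∑ t, w.real {t} * indexGap Q f φ ya y t := by
    have hm := measurable_sharedIndex (ℰ := ℰ) hf hφ
    have e1 := condEnt_shareLaw (Q := Q) (w := w) hm
      (G := fun t p => (ya p.1.2, weakMask ya t p.2)) (fun t => by have := hw' t; fun_prop)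
    have e2 := condEnt_shareLaw (Q := Q) (w := w) hm
      (G := fun t p => (p.1.2, weakMask ya t p.2, strongMask t p.2))
      (fun t => by have := hw' t; have := hs' t; fun_prop)
    have e3 := condEnt_shareLaw (Q := Q) (w := w) hm
      (G := fun t p => (y p.1.2, weakMask ya t p.2)) (fun t => by have := hw' t; fun_prop)
    have e4 := condEnt_shareLaw (Q := Q) (w := w) hm
      (G := fun t p => (y p.1.2, p.1.1, weakMask ya t p.2, strongMask t p.2))
      (fun t => by have := hw' t; have := hs' t; fun_prop)
    unfold sharedCodeword
    rw [e1, e2, e3, e4, ← Finset.sum_add_distrib, ← Finset.sum_sub_distrib,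
      ← Finset.sum_sub_distrib]
    refine Finset.sum_congr rfl fun t _ => ?_
    unfold indexGap
    ring
  have pos : 0 ≤ condEnt (shareLaw Q w) (sharedCodeword f φ)
        (fun ω => (ya ω.1.2, weakAux ya ω.2)) -
      condEnt (shareLaw Q w) (sharedCodeword f φ)
        (fun ω => (ya ω.1.2, ω.1.1, weakAux ya ω.2)) :=
    sub_nonneg.2 (condEnt_le_of_eq_comp hJ (by fun_prop) (h := fun z => (z.1, z.2.2))
      (by fun_prop) fun ω => rfl)
  refine (add_le_add k1 k3).trans ?_
  rw [← ENNReal.ofReal_add pos k2]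
  exact ENNReal.ofReal_le_ofReal (by linarith)

end SharedAuxiliaries
end GaussSI
namespace GaussSI

/-! ### Expectations and weights of the time-sharing index. -/

section TimeSharing

variable {𝒳 ℰ 𝒜 𝒴 𝒩 : Type*} [MeasurableSpace 𝒳] [StandardBorelSpace 𝒳] [Inhabited 𝒳]
  [MeasurableSpace ℰ] [StandardBorelSpace ℰ] [Inhabited ℰ] {n : ℕ}
  {Q : Measure (𝒳 × ℰ)} [IsProbabilityMeasure Q] {w : Measure (ShareIdx n)}
  [IsProbabilityMeasure w]

lemma integral_shareLaw {F : (𝒳 × ℰ) × (ShareIdx n × (Fin n → 𝒳 × ℰ)) → ℝ} (hF : Measurable F)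
    (hint : ∀ t, Integrable (fun p => F (p.1, t, p.2))
      (Q.prod (Measure.pi fun _ : Fin n => Q))) :
    Integrable F (shareLaw Q w) ∧ ∫ ω, F ω ∂(shareLaw Q w) =
      ∑ t, w.real {t} * ∫ p, F (p.1, t, p.2) ∂(Q.prod (Measure.pi fun _ : Fin n => Q)) := by
  have hm : Measurable fun p : ShareIdx n × ((𝒳 × ℰ) × (Fin n → 𝒳 × ℰ)) =>
      (p.2.1, (p.1, p.2.2)) := by fun_prop
  have hi : Integrable (fun p : ShareIdx n × ((𝒳 × ℰ) × (Fin n → 𝒳 × ℰ)) =>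
      F (p.2.1, (p.1, p.2.2))) (w.prod (Q.prod (Measure.pi fun _ : Fin n => Q))) := by
    exact (integrable_prod_iff (hF.comp hm).aestronglyMeasurable).2 ⟨Filter.Eventually.of_forall
        hint, Integrable.of_finite⟩
  rw [← shareLaw_eq_map]
  refine ⟨(integrable_map_measure hF.aestronglyMeasurable hm.aemeasurable).2 hi, ?_⟩
  rw [integral_map hm.aemeasurable hF.aestronglyMeasurable, integral_prod _ hi,
    integral_fintype Integrable.of_finite]
  rfl

/-- The law of the time-sharing index: `Sum.inr ()` has probability `δ`, the positions in the
block are equally likely. -/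
noncomputable def shareWeight (n : ℕ) (hn : 0 < n) (δ : ℝ) (h0 : 0 ≤ δ) (h1 : δ ≤ 1) :
    PMF (ShareIdx n) :=
  PMF.ofFintype (fun t => ENNReal.ofReal (t.elim (fun _ => (1 - δ) / n) (fun _ => δ))) (by
    have hn' : (0 : ℝ) < n := Nat.cast_pos.2 hn
    have h3 : 0 ≤ (1 - δ) / n := div_nonneg (by linarith) hn'.le
    rw [← ENNReal.ofReal_sum_of_nonneg]
    · rw [Fintype.sum_sum_type]
      simp only [Sum.elim_inl, Sum.elim_inr, Finset.sum_const, Finset.card_univ, Fintype.card_fin,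
        nsmul_eq_mul, Fintype.card_unit, Nat.cast_one, one_mul]
      rw [mul_div_cancel₀ _ hn'.ne']
      simp
    · rintro (t | t) _
      · exact h3
      · exact h0)

lemma shareWeight_real (hn : 0 < n) {δ : ℝ} (h0 : 0 ≤ δ) (h1 : δ ≤ 1) (t : ShareIdx n) :
    (shareWeight n hn δ h0 h1).toMeasure.real {t} =
      t.elim (fun _ => (1 - δ) / n) (fun _ => δ) := by
  rw [measureReal_def, PMF.toMeasure_apply_singleton _ _ (measurableSet_singleton _)]
  simp only [shareWeight, PMF.ofFintype_apply]
  refine ENNReal.toReal_ofReal ?_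
  rcases t with t | t
  · exact div_nonneg (by linarith) (Nat.cast_nonneg n)
  · exact h0

end TimeSharing

/-! ### Distortion of the time-shared reconstruction. -/

section Distortion

variable {ℰ 𝒜 ℬ 𝒴 𝒩 : Type*}
  [MeasurableSpace ℰ] [StandardBorelSpace ℰ] [Inhabited ℰ]
  [MeasurableSpace 𝒜] [StandardBorelSpace 𝒜] [Inhabited 𝒜]
  [MeasurableSpace ℬ]
  [MeasurableSpace 𝒴] [StandardBorelSpace 𝒴] [Inhabited 𝒴]
  [MeasurableSpace 𝒩] [StandardBorelSpace 𝒩] [Inhabited 𝒩] {k n M L : ℕ}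
  {f : (Fin n → Vec k) → Fin M} {φ : Vec k → Fin L} {g : Fin M × (Fin n → ℬ) → Fin n → Vec k}
  {dec : Fin L → Vec k} {yb : ℰ → ℬ}

/-- The reconstruction of a block. -/
def blockRecon (f : (Fin n → Vec k) → Fin M) (g : Fin M × (Fin n → ℬ) → Fin n → Vec k)
    (yb : ℰ → ℬ) (S : Fin n → Vec k × ℰ) : Fin n → Vec k :=
  g (f fun s => (S s).1, fun s => yb (S s).2)

/-- The reconstruction of the current letter, given the index, the time-sharing index and a block
of side information. -/
def estimator (g : Fin M × (Fin n → ℬ) → Fin n → Vec k) (dec : Fin L → Vec k) :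
    Fin M ⊕ Fin L → ShareIdx n → (Fin n → ℬ) → Vec k
  | .inl m, .inl t, v => g (m, v) t
  | .inr l, .inr _, _ => dec l
  | _, _, _ => 0

/-- The reconstruction of the current letter. -/
def shareRecon (f : (Fin n → Vec k) → Fin M) (g : Fin M × (Fin n → ℬ) → Fin n → Vec k)
    (φ : Vec k → Fin L) (dec : Fin L → Vec k) (yb : ℰ → ℬ)
    (ω : (Vec k × ℰ) × (ShareIdx n × (Fin n → Vec k × ℰ))) : Vec k :=
  ω.2.1.elim (fun t => blockRecon f g yb (Function.update ω.2.2 t ω.1) t)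
    (fun _ => dec (φ ω.1.1))

lemma measurable_estimator (hg : Measurable g) :
    Measurable fun z : (Fin M ⊕ Fin L) × ShareIdx n × (Fin n → ℬ) =>
      estimator g dec z.1 z.2.1 z.2.2 := by
  refine Measurable.of_discrete_index
    (g := fun (p : (Fin M ⊕ Fin L) × ShareIdx n) v => estimator g dec p.1 p.2 v)
    (T := fun z : (Fin M ⊕ Fin L) × ShareIdx n × (Fin n → ℬ) => (z.1, z.2.1)) (b := fun z => z.2.2)
    ?_ (by fun_prop) (by fun_prop)
  rintro ⟨m | l, t | t⟩
  · exact (measurable_pi_apply t).comp (hg.comp (by fun_prop))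
  all_goals exact measurable_const

lemma measurable_blockRecon (hf : Measurable f) (hg : Measurable g) (hyb : Measurable yb) :
    Measurable (blockRecon f g yb) :=
  hg.comp ((hf.comp (by fun_prop)).prodMk (by fun_prop))

lemma measurable_shareRecon (hf : Measurable f) (hg : Measurable g) (hφ : Measurable φ)
    (hyb : Measurable yb) : Measurable (shareRecon f g φ dec yb) := by
  refine Measurable.of_discrete_index
    (g := fun (t : ShareIdx n) (p : (Vec k × ℰ) × (Fin n → Vec k × ℰ)) =>
      t.elim (fun t => blockRecon f g yb (Function.update p.2 t p.1) t) (fun _ => dec (φ p.1.1)))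
    (T := fun ω : (Vec k × ℰ) × (ShareIdx n × (Fin n → Vec k × ℰ)) => ω.2.1)
    (b := fun ω => (ω.1, ω.2.2)) ?_ (by fun_prop) (by fun_prop)
  rintro (t | t)
  · exact (measurable_pi_apply t).comp
      ((measurable_blockRecon hf hg hyb).comp (measurable_update_prod t))
  · exact (measurable_of_countable dec).comp (hφ.comp (by fun_prop))

variable {Q : Measure (Vec k × ℰ)} [IsProbabilityMeasure Q]

/-- The expected distortion of the time-shared reconstruction. -/
lemma integral_shareRecon (hf : Measurable f) (hg : Measurable g) (hφ : Measurable φ)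
    (hyb : Measurable yb) (hn : 0 < n) {δ : ℝ} (h0 : 0 ≤ δ) (h1 : δ ≤ 1) {ρ : Vec k → ℝ}
    (hρ : Measurable ρ) (hρ0 : ∀ v, 0 ≤ ρ v)
    (hint : Integrable (fun S => ∑ t, ρ ((S t).1 - blockRecon f g yb S t))
      (Measure.pi fun _ : Fin n => Q))
    (hint' : Integrable (fun q => ρ (q.1 - dec (φ q.1))) Q) :
    Integrable (fun ω => ρ (ω.1.1 - shareRecon f g φ dec yb ω))
        (shareLaw Q (shareWeight n hn δ h0 h1).toMeasure) ∧
      ∫ ω, ρ (ω.1.1 - shareRecon f g φ dec yb ω)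
        ∂(shareLaw Q (shareWeight n hn δ h0 h1).toMeasure) =
      (1 - δ) / n * ∫ S, ∑ t, ρ ((S t).1 - blockRecon f g yb S t)
        ∂(Measure.pi fun _ : Fin n => Q) + δ * ∫ q, ρ (q.1 - dec (φ q.1)) ∂Q := by
  have hB := measurable_blockRecon hf hg hyb
  have hR := measurable_shareRecon (dec := dec) hf hg hφ hyb
  have hBt : ∀ t, Measurable fun S : Fin n → Vec k × ℰ => ρ ((S t).1 - blockRecon f g yb S t) :=
    fun t => hρ.comp (by fun_prop)
  have hintt : ∀ t, Integrable (fun S => ρ ((S t).1 - blockRecon f g yb S t))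
      (Measure.pi fun _ : Fin n => Q) := fun t =>
    hint.mono' (hBt t).aestronglyMeasurable (Filter.Eventually.of_forall fun S => by
      rw [Real.norm_of_nonneg (hρ0 _)]
      exact Finset.single_le_sum (f := fun t => ρ ((S t).1 - blockRecon f g yb S t))
        (fun i _ => hρ0 _) (Finset.mem_univ t))
  -- Substituting the letter leaves the block law unchanged, so the loss at index `t` is that of the
  -- code at its `t`-th letter.
  have hl : ∀ t : Fin n, Integrable (fun p : (Vec k × ℰ) × (Fin n → Vec k × ℰ) =>
      ρ (p.1.1 - shareRecon f g φ dec yb (p.1, .inl t, p.2)))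
      (Q.prod (Measure.pi fun _ : Fin n => Q)) ∧
      ∫ p, ρ (p.1.1 - shareRecon f g φ dec yb (p.1, .inl t, p.2))
        ∂(Q.prod (Measure.pi fun _ : Fin n => Q)) =
      ∫ S, ρ ((S t).1 - blockRecon f g yb S t) ∂(Measure.pi fun _ : Fin n => Q) := by
    intro t
    have hu := measurable_update_prod (α := Vec k × ℰ) t
    have e : (fun p : (Vec k × ℰ) × (Fin n → Vec k × ℰ) =>
        ρ (p.1.1 - shareRecon f g φ dec yb (p.1, .inl t, p.2))) = fun p =>
        (fun S : Fin n → Vec k × ℰ => ρ ((S t).1 - blockRecon f g yb S t))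
          (Function.update p.2 t p.1) := by
      funext p
      simp [shareRecon]
    have i1 := hintt t
    have i2 := integral_map (μ := Q.prod (Measure.pi fun _ : Fin n => Q)) hu.aemeasurable
      (f := fun S : Fin n → Vec k × ℰ => ρ ((S t).1 - blockRecon f g yb S t))
      (hBt t).aestronglyMeasurable
    rw [map_update_prod_pi] at i2
    rw [← map_update_prod_pi Q t, integrable_map_measure (hBt t).aestronglyMeasurable
      hu.aemeasurable] at i1
    rw [e]
    exact ⟨i1, i2.symm⟩
  have hr : Integrable (fun p : (Vec k × ℰ) × (Fin n → Vec k × ℰ) =>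
      ρ (p.1.1 - shareRecon f g φ dec yb (p.1, .inr (), p.2)))
      (Q.prod (Measure.pi fun _ : Fin n => Q)) ∧
      ∫ p, ρ (p.1.1 - shareRecon f g φ dec yb (p.1, .inr (), p.2))
        ∂(Q.prod (Measure.pi fun _ : Fin n => Q)) = ∫ q, ρ (q.1 - dec (φ q.1)) ∂Q := by
    refine ⟨hint'.comp_fst _, ?_⟩
    have := integral_fun_fst (μ := Q) (ν := Measure.pi fun _ : Fin n => Q)
      (fun q => ρ (q.1 - dec (φ q.1)))
    simpa [shareRecon] using this
  have key := integral_shareLaw (Q := Q) (w := (shareWeight n hn δ h0 h1).toMeasure)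
    (F := fun ω => ρ (ω.1.1 - shareRecon f g φ dec yb ω)) (hρ.comp (by fun_prop)) (by
      rintro (t | t)
      · exact (hl t).1
      · exact hr.1)
  refine ⟨key.1, ?_⟩
  rw [key.2, Fintype.sum_sum_type, integral_finsetSum _ fun t _ => hintt t, Finset.mul_sum]
  simp only [shareWeight_real, Sum.elim_inl, Sum.elim_inr, Finset.univ_unique, Finset.sum_singleton,
    (hl _).2]
  congr 2
  exact hr.2

end Distortion
end GaussSI
namespace GaussSI

lemma comap_eq_comap_of_comp {Ω α β : Type*} [MeasurableSpace α] [MeasurableSpace β]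
    {Z : Ω → α} {Z' : Ω → β} {h : β → α} {h' : α → β} (hh : Measurable h) (hh' : Measurable h')
    (e : ∀ ω, Z ω = h (Z' ω)) (e' : ∀ ω, Z' ω = h' (Z ω)) :
    MeasurableSpace.comap Z inferInstance = MeasurableSpace.comap Z' inferInstance := by
  have h1 : Z = h ∘ Z' := funext e
  have h2 : Z' = h' ∘ Z := funext e'
  refine le_antisymm ?_ ?_
  · rw [h1, ← MeasurableSpace.comap_comp]
    exact MeasurableSpace.comap_mono hh.comap_le
  · conv_lhs => rw [h2, ← MeasurableSpace.comap_comp]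
    exact MeasurableSpace.comap_mono hh'.comap_le

lemma condCov_eq_of_comp {Ω α β : Type*} [MeasurableSpace Ω] [MeasurableSpace α]
    [MeasurableSpace β] {k : ℕ} {ν : Measure Ω} {X : Ω → Vec k}
    {Z : Ω → α} {Z' : Ω → β} {h : β → α} {h' : α → β} (hh : Measurable h) (hh' : Measurable h')
    (e : ∀ ω, Z ω = h (Z' ω)) (e' : ∀ ω, Z' ω = h' (Z ω)) :
    condCov ν X Z = condCov ν X Z' :=
  condCov_congr fun i => by rw [comap_eq_comap_of_comp hh hh' e e']

/-! ### Conditional covariances given the auxiliary variables. -/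

section SharedCovariance

variable {ℰ 𝒜 ℬ 𝒴 𝒩 : Type*}
  [MeasurableSpace ℰ] [StandardBorelSpace ℰ] [Inhabited ℰ]
  [MeasurableSpace 𝒜] [StandardBorelSpace 𝒜] [Inhabited 𝒜]
  [MeasurableSpace ℬ]
  [MeasurableSpace 𝒴] [StandardBorelSpace 𝒴] [Inhabited 𝒴]
  [MeasurableSpace 𝒩] [StandardBorelSpace 𝒩] [Inhabited 𝒩] {k n M L : ℕ}
  {f : (Fin n → Vec k) → Fin M} {φ : Vec k → Fin L}
  {dec : Fin L → Vec k} {ya : ℰ → 𝒜} {yb : ℰ → ℬ} {y : ℰ → 𝒴} {o : ℰ → 𝒩}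

/-- A decoder sees the source only through the transmitted index, so it can be imitated by anyone
who knows the index, the position and its block of side information. When the quantizer is used, `v`
is irrelevant. -/
lemma shareRecon_eq_estimator {g : Fin M × (Fin n → ℬ) → Fin n → Vec k}
    (ω : (Vec k × ℰ) × (ShareIdx n × (Fin n → Vec k × ℰ))) {v : Fin n → ℬ}
    (hv : ∀ t, ω.2.1 = .inl t → ∀ s, v s = yb (Function.update ω.2.2 t ω.1 s).2) :
    shareRecon f g φ dec yb ω = estimator g dec (sharedCodeword f φ ω) ω.2.1 v := by
  obtain ⟨q, t | t, S⟩ := ω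
  · have : v = fun s => yb (Function.update S t q s).2 := funext (hv t rfl)
    subst this
    rfl
  · rfl

lemma measurable_ite_eq_inl {α : Type*} [MeasurableSpace α] {T : α → ShareIdx n}
    (hT : Measurable T) {a : α → ℬ} (ha : Measurable a) {b : α → Fin n → ℬ} (hb : Measurable b) :
    Measurable fun z s => if T z = .inl s then a z else b z s :=
  measurable_pi_lambda _ fun s => Measurable.ite (hT (measurableSet_singleton _)) ha
    ((measurable_pi_apply s).comp hb)

/-- The reconstruction from the weak auxiliary variables and the own side information. -/
def weakEstimator (g : Fin M × (Fin n → 𝒜) → Fin n → Vec k) (dec : Fin L → Vec k)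
    (z : 𝒜 × (Fin M ⊕ Fin L) × (ShareIdx n × ((Fin n → ℰ) × (Fin n → 𝒜)))) : Vec k :=
  estimator g dec z.2.1 z.2.2.1 fun s => if z.2.2.1 = .inl s then z.1 else z.2.2.2.2 s

/-- The reconstruction from all the auxiliary variables and all the side information. -/
def strongEstimator (g : Fin M × (Fin n → ℬ) → Fin n → Vec k) (dec : Fin L → Vec k)
    (yb : ℰ → ℬ) (r : 𝒴 × 𝒩 → ℰ)
    (z : (𝒴 × (Fin M ⊕ Fin L) × (ShareIdx n × ((Fin n → ℰ) × (Fin n → 𝒜))) ×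
      ((Fin n → Vec k) × (Fin n → ℰ))) × 𝒩) : Vec k :=
  estimator g dec z.1.2.1 z.1.2.2.1.1
    fun s => if z.1.2.2.1.1 = .inl s then yb (r (z.1.1, z.2)) else yb (z.1.2.2.2.2 s)

lemma measurable_weakEstimator {g : Fin M × (Fin n → 𝒜) → Fin n → Vec k} (hg : Measurable g) :
    Measurable (weakEstimator (ℰ := ℰ) g dec) := by
  have h1 : Measurable fun z : 𝒜 × (Fin M ⊕ Fin L) ×
      (ShareIdx n × ((Fin n → ℰ) × (Fin n → 𝒜))) =>
      fun s => if z.2.2.1 = .inl s then z.1 else z.2.2.2.2 s :=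
    measurable_ite_eq_inl (by fun_prop) (by fun_prop) (by fun_prop)
  exact (measurable_estimator hg).comp
    ((by fun_prop : Measurable fun z : 𝒜 × (Fin M ⊕ Fin L) ×
      (ShareIdx n × ((Fin n → ℰ) × (Fin n → 𝒜))) => z.2.1).prodMk
      ((by fun_prop : Measurable fun z : 𝒜 × (Fin M ⊕ Fin L) ×
      (ShareIdx n × ((Fin n → ℰ) × (Fin n → 𝒜))) => z.2.2.1).prodMk h1))

lemma measurable_strongEstimator {g : Fin M × (Fin n → ℬ) → Fin n → Vec k} (hg : Measurable g)
    (hyb : Measurable yb) {r : 𝒴 × 𝒩 → ℰ} (hr : Measurable r) :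
    Measurable (strongEstimator (𝒜 := 𝒜) g dec yb r) := by
  have h1 : Measurable fun z : (𝒴 × (Fin M ⊕ Fin L) ×
      (ShareIdx n × ((Fin n → ℰ) × (Fin n → 𝒜))) × ((Fin n → Vec k) × (Fin n → ℰ))) × 𝒩 =>
      fun s => if z.1.2.2.1.1 = .inl s then yb (r (z.1.1, z.2)) else yb (z.1.2.2.2.2 s) :=
    measurable_ite_eq_inl (b := fun z : (𝒴 × (Fin M ⊕ Fin L) ×
      (ShareIdx n × ((Fin n → ℰ) × (Fin n → 𝒜))) × ((Fin n → Vec k) × (Fin n → ℰ))) × 𝒩 =>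
      fun s => yb (z.1.2.2.2.2 s)) (by fun_prop) (by fun_prop) (by fun_prop)
  exact (measurable_estimator hg).comp
    ((by fun_prop : Measurable fun z : (𝒴 × (Fin M ⊕ Fin L) ×
      (ShareIdx n × ((Fin n → ℰ) × (Fin n → 𝒜))) × ((Fin n → Vec k) × (Fin n → ℰ))) × 𝒩 =>
      z.1.2.1).prodMk
      ((by fun_prop : Measurable fun z : (𝒴 × (Fin M ⊕ Fin L) ×
      (ShareIdx n × ((Fin n → ℰ) × (Fin n → 𝒜))) × ((Fin n → Vec k) × (Fin n → ℰ))) × 𝒩 =>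
      z.1.2.2.1.1).prodMk h1))

variable {Q : Measure (Vec k × ℰ)} [IsProbabilityMeasure Q]

/-- The weak mask together with the current `ya` contains the whole block of side information of
this decoder, so its reconstruction competes with the conditional mean. -/
lemma sum_mul_condCov_weak_le {g : Fin M × (Fin n → 𝒜) → Fin n → Vec k} (hf : Measurable f)
    (hg : Measurable g) (hφ : Measurable φ) (hya : Measurable ya) (hn : 0 < n) {δ : ℝ}
    (h0 : 0 ≤ δ) (h1 : δ ≤ 1) (hX : ∀ i, MemLp (fun q => q.1 i) 2 Q) {c : Fin k → Fin k → ℝ}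
    (hc : ∀ v : Vec k, 0 ≤ ∑ i, ∑ j, c i j * (v i * v j))
    (hint : Integrable (fun S => ∑ t, ∑ i, ∑ j, c i j * (((S t).1 - blockRecon f g ya S t) i *
      ((S t).1 - blockRecon f g ya S t) j)) (Measure.pi fun _ : Fin n => Q))
    (hint' : Integrable (fun q => ∑ i, ∑ j, c i j * ((q.1 - dec (φ q.1)) i *
      (q.1 - dec (φ q.1)) j)) Q) :
    ∑ i, ∑ j, c i j * condCov (shareLaw Q (shareWeight n hn δ h0 h1).toMeasure) (fun ω => ω.1.1)
      (fun ω => (ya ω.1.2, (sharedCodeword f φ ω, weakAux ya ω.2))) i j ≤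
      (1 - δ) / n * ∫ S, ∑ t, ∑ i, ∑ j, c i j * (((S t).1 - blockRecon f g ya S t) i *
        ((S t).1 - blockRecon f g ya S t) j) ∂(Measure.pi fun _ : Fin n => Q) +
      δ * ∫ q, ∑ i, ∑ j, c i j * ((q.1 - dec (φ q.1)) i * (q.1 - dec (φ q.1)) j) ∂Q := by
  obtain ⟨k1, k2⟩ := integral_shareRecon (dec := dec) hf hg hφ hya hn h0 h1
    (ρ := fun v => ∑ i, ∑ j, c i j * (v i * v j)) (by fun_prop) hc hint hint'
  have e : ∀ ω, shareRecon f g φ dec ya ω = weakEstimator g dec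
      (ya ω.1.2, (sharedCodeword f φ ω, weakAux ya ω.2)) := fun ω => by
    refine shareRecon_eq_estimator ω fun t ht s => ?_
    simp only [weakAux, ht, weakMask, Sum.inl.injEq]
    by_cases h : t = s
    · subst h; simp
    · simp [h, Function.update_of_ne (Ne.symm h), Ne.symm h]
  have hJ := measurable_sharedCodeword (ℰ := ℰ) hf hφ
  have hw := measurable_weakAux (𝒳 := Vec k) (n := n) hya
  simp only [e] at k1 k2
  refine (sum_mul_condCov_le (fun i => ?_) (by fun_prop)
    (measurable_weakEstimator hg) hc k1).trans k2.le
  exact (hX i).comp_measurePreserving measurePreserving_fst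

/-- This decoder's current side information `yb` need not be a function of `y`. The reconstruction
is compared with the conditional mean given also `o`, which by the Markov chain equals the one
without `o`. -/
lemma sum_mul_condCov_strong_le {g : Fin M × (Fin n → ℬ) → Fin n → Vec k} (hf : Measurable f)
    (hg : Measurable g) (hφ : Measurable φ) (hya : Measurable ya) (hyb : Measurable yb)
    (hy : Measurable y) (ho : Measurable o) {r : 𝒴 × 𝒩 → ℰ} (hr : Measurable r)
    (hro : ∀ e, r (y e, o e) = e)
    (h : CondIndepFun (MeasurableSpace.comap (fun q : Vec k × ℰ => y q.2) inferInstance)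
      (hy.comp measurable_snd).comap_le Prod.fst (fun q => o q.2) Q) (hn : 0 < n) {δ : ℝ}
    (h0 : 0 ≤ δ) (h1 : δ ≤ 1) (hX : ∀ i, MemLp (fun q => q.1 i) 2 Q) {c : Fin k → Fin k → ℝ}
    (hc : ∀ v : Vec k, 0 ≤ ∑ i, ∑ j, c i j * (v i * v j))
    (hint : Integrable (fun S => ∑ t, ∑ i, ∑ j, c i j * (((S t).1 - blockRecon f g yb S t) i *
      ((S t).1 - blockRecon f g yb S t) j)) (Measure.pi fun _ : Fin n => Q))
    (hint' : Integrable (fun q => ∑ i, ∑ j, c i j * ((q.1 - dec (φ q.1)) i *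
      (q.1 - dec (φ q.1)) j)) Q) [Nonempty (Fin M ⊕ Fin L)] :
    ∑ i, ∑ j, c i j * condCov (shareLaw Q (shareWeight n hn δ h0 h1).toMeasure) (fun ω => ω.1.1)
      (fun ω => (y ω.1.2, (sharedCodeword f φ ω, weakAux ya ω.2, strongAux ω.2))) i j ≤
      (1 - δ) / n * ∫ S, ∑ t, ∑ i, ∑ j, c i j * (((S t).1 - blockRecon f g yb S t) i *
        ((S t).1 - blockRecon f g yb S t) j) ∂(Measure.pi fun _ : Fin n => Q) +
      δ * ∫ q, ∑ i, ∑ j, c i j * ((q.1 - dec (φ q.1)) i * (q.1 - dec (φ q.1)) j) ∂Q := by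
  obtain ⟨k1, k2⟩ := integral_shareRecon (dec := dec) hf hg hφ hyb hn h0 h1
    (ρ := fun v => ∑ i, ∑ j, c i j * (v i * v j)) (by fun_prop) hc hint hint'
  have e : ∀ ω, shareRecon f g φ dec yb ω = strongEstimator g dec yb r
      ((y ω.1.2, (sharedCodeword f φ ω, weakAux ya ω.2, strongAux ω.2)), o ω.1.2) := fun ω => by
    refine shareRecon_eq_estimator ω fun t ht s => ?_
    simp only [weakAux, strongAux, ht, strongMask, Sum.inl.injEq, hro]
    by_cases h : t = s
    · subst h; simp
    · simp [h, Function.update_of_ne (Ne.symm h), Ne.symm h]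
  have hJ := measurable_sharedCodeword (ℰ := ℰ) hf hφ
  have hJ' := measurable_sharedCodewordOf (ℰ := ℰ) hf hφ
  have hw := measurable_weakAux (𝒳 := Vec k) (n := n) hya
  have hs := measurable_strongAux (𝒳 := Vec k) (ℰ := ℰ) (n := n)
  simp only [e] at k1 k2
  have hX' : ∀ i, MemLp (fun ω => ω.1.1 i) 2
      (shareLaw Q (shareWeight n hn δ h0 h1).toMeasure) := fun i =>
    (hX i).comp_measurePreserving measurePreserving_fst
  have hcov : condCov (shareLaw Q (shareWeight n hn δ h0 h1).toMeasure) (fun ω => ω.1.1)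
      (fun ω => (y ω.1.2, (sharedCodeword f φ ω, weakAux ya ω.2, strongAux ω.2))) =
      condCov (shareLaw Q (shareWeight n hn δ h0 h1).toMeasure) (fun ω => ω.1.1)
      (fun ω => ((y ω.1.2, (sharedCodeword f φ ω, weakAux ya ω.2, strongAux ω.2)), o ω.1.2)) := by
    refine condCov_congr fun i => ?_
    have cf := condIndepFun_shareLaw (w := (shareWeight n hn δ h0 h1).toMeasure) (A := Prod.fst)
      (N := fun q : Vec k × ℰ => o q.2) (C := fun q => y q.2) measurable_fst (by fun_prop)
      (by fun_prop) h (a := Prod.fst) measurable_fst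
      (g := fun a => (sharedCodewordOf f φ a, weakAux ya a.2, strongAux a.2)) (by fun_prop)
    simp only [← sharedCodeword_eq] at cf
    exact (condExp_comap_prodMk_of_condIndepFun (by fun_prop) (by fun_prop) (by fun_prop) cf
      (f := fun x => x i) (by fun_prop) ((hX' i).integrable (by norm_num))).symm
  rw [hcov]
  refine (sum_mul_condCov_le hX' (by fun_prop)
    (measurable_strongEstimator hg hyb hr) hc k1).trans k2.le

/-- The auxiliary variables of the time-sharing construction depend on the side information only
through the source. -/
lemma condIndepFun_shared_of_source (hf : Measurable f) (hφ : Measurable φ)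
    (hya : Measurable ya) {w : Measure (ShareIdx n)} [IsProbabilityMeasure w]
    [Nonempty (Fin M ⊕ Fin L)] :
    CondIndepFun (MeasurableSpace.comap (fun ω => ω.1.1) inferInstance)
      (measurable_fst.comp measurable_fst).comap_le
      (fun ω => (sharedCodeword f φ ω, weakAux ya ω.2, strongAux ω.2)) (fun ω => ω.1.2)
      (shareLaw Q w) := by
  have hJ' := measurable_sharedCodewordOf (ℰ := ℰ) hf hφ
  have hw := measurable_weakAux (𝒳 := Vec k) (n := n) hya
  have hs := measurable_strongAux (𝒳 := Vec k) (ℰ := ℰ) (n := n)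
  have := condIndepFun_prod (A := Prod.fst) (N := Prod.snd) (C := Prod.fst)
    measurable_fst measurable_snd measurable_fst
    (condIndepFun_self_left (μ := Q) measurable_snd measurable_fst)
    (w.prod (Measure.pi fun _ : Fin n => Q))
  have := this.comp (φ := fun a => (sharedCodewordOf f φ a, weakAux ya a.2, strongAux a.2))
    (by fun_prop) measurable_id
  simp only [Function.comp_def, ← sharedCodeword_eq] at this
  exact this

end SharedCovariance
end GaussSI
-- Encoding, quantization and the slack in the distortion constraint.
namespace GaussSI

/-- Any value in a standard Borel space can be encoded in a vector of size one. -/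
lemma exists_vec_encoding (α : Type*) [MeasurableSpace α] [StandardBorelSpace α] [Nonempty α] :
    ∃ (e : α → Vec 1) (d : Vec 1 → α), Measurable e ∧ Measurable d ∧ ∀ a, d (e a) = a := by
  obtain ⟨e, he⟩ := exists_measurableEmbedding_real α
  obtain ⟨d, hd, hde⟩ := he.exists_measurable_extend measurable_id fun _ => ‹Nonempty α›
  exact ⟨fun a _ => e a, fun v => d (v 0), measurable_pi_lambda _ fun _ => he.measurable,
    hd.comp (measurable_pi_apply 0), fun a => congr_fun hde a⟩

/-- A square integrable random vector has finite quantizers of arbitrarily small error. -/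
lemma exists_quantizer {Ω : Type*} [MeasurableSpace Ω] {μ : Measure Ω} [IsProbabilityMeasure μ]
    {k : ℕ} {X : Ω → Vec k} (hXm : Measurable X) (hX : ∀ i, MemLp (fun ω => X ω i) 2 μ) {s : ℝ}
    (hs : 0 < s) :
    ∃ (L : ℕ) (φ : Vec k → Fin L) (dec : Fin L → Vec k), Measurable φ ∧
      Integrable (fun ω => (X ω - dec (φ (X ω))) ⬝ᵥ (X ω - dec (φ (X ω)))) μ ∧
      ∫ ω, (X ω - dec (φ (X ω))) ⬝ᵥ (X ω - dec (φ (X ω))) ∂μ ≤ s := by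
  have hid : MemLp (id : Vec k → Vec k) 2 (μ.map X) :=
    (memLp_map_measure_iff aestronglyMeasurable_id hXm.aemeasurable).2 (memLp_pi_iff.2 hX)
  -- With the sup norm `v ⬝ᵥ v ≤ k * ‖v‖ ^ 2`, so an L² error of `ε` gives at most `k * ε ^ 2 ≤ s`;
  -- the `+ 1` covers `k = 0`.
  set ε : ℝ := Real.sqrt (s / (k + 1)) with hε
  have hk : (0 : ℝ) < k + 1 := by positivity
  have hεpos : 0 < ε := Real.sqrt_pos.2 (div_pos hs hk)
  obtain ⟨g, hg, hgm⟩ := hid.exists_simpleFunc_eLpNorm_sub_lt (by norm_num)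
    (ε := ENNReal.ofReal ε) (by simpa using hεpos)
  have hd : MemLp (id - ⇑g : Vec k → Vec k) 2 (μ.map X) := hid.sub hgm
  have hd' : MemLp (fun ω => X ω - g (X ω)) 2 μ :=
    (memLp_map_measure_iff hd.1 hXm.aemeasurable).1 hd
  have hn : eLpNorm (fun ω => X ω - g (X ω)) 2 μ < ENNReal.ofReal ε := by
    rw [eLpNorm_map_measure hd.1 hXm.aemeasurable] at hg
    exact hg
  have hsq : ∫ ω, ‖X ω - g (X ω)‖ ^ 2 ∂μ ≤ ε ^ 2 := by
    rw [hd'.eLpNorm_eq_integral_rpow_norm (by norm_num) (by norm_num),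
      ENNReal.ofReal_lt_ofReal_iff hεpos] at hn
    simp only [ENNReal.toReal_ofNat, Real.rpow_ofNat] at hn
    rw [← one_div, ← Real.sqrt_eq_rpow, Real.sqrt_lt' hεpos] at hn
    exact hn.le
  have hnorm : ∀ v : Vec k, v ⬝ᵥ v ≤ k * ‖v‖ ^ 2 := fun v => by
    calc v ⬝ᵥ v ≤ ∑ _i : Fin k, ‖v‖ ^ 2 := Finset.sum_le_sum fun i _ => by
          rw [← sq, ← sq_abs, ← Real.norm_eq_abs]
          exact pow_le_pow_left₀ (norm_nonneg _) (norm_le_pi_norm v i) 2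
      _ = _ := by simp
  have hmeas : Measurable fun ω => X ω - g (X ω) := hXm.sub (g.measurable.comp hXm)
  have hint : Integrable (fun ω => (k : ℝ) * ‖X ω - g (X ω)‖ ^ 2) μ :=
    (hd'.integrable_norm_pow (by norm_num)).const_mul _
  have hint' : Integrable (fun ω => (X ω - g (X ω)) ⬝ᵥ (X ω - g (X ω))) μ := by
    refine hint.mono' ?_ (Filter.Eventually.of_forall fun ω => ?_)
    · unfold dotProduct
      exact (Finset.measurable_sum _ fun i _ => ((measurable_pi_apply i).comp hmeas).mul
        ((measurable_pi_apply i).comp hmeas)).aestronglyMeasurable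
    · have h0 : 0 ≤ (X ω - g (X ω)) ⬝ᵥ (X ω - g (X ω)) :=
        Finset.sum_nonneg fun i _ => mul_self_nonneg _
      rw [Real.norm_of_nonneg h0]
      exact hnorm _
  -- The finitely many values of the approximating simple function are the codewords.
  set e := g.range.equivFin
  refine ⟨g.range.card, fun x => e ⟨g x, g.mem_range_self x⟩, fun l => (e.symm l : Vec k), ?_, ?_,
      ?_⟩
  · refine measurable_to_countable' fun l => ?_
    have : (fun x => e ⟨g x, g.mem_range_self x⟩) ⁻¹' {l} = g ⁻¹' {(e.symm l : Vec k)} := by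
      ext x
      simp only [Set.mem_preimage, Set.mem_singleton_iff]
      rw [← Equiv.eq_symm_apply, Subtype.ext_iff]
    rw [this]
    exact g.measurableSet_fiber _
  · simpa using hint'
  · simp only [Equiv.symm_apply_apply]
    calc ∫ ω, (X ω - g (X ω)) ⬝ᵥ (X ω - g (X ω)) ∂μ ≤ ∫ ω, (k : ℝ) * ‖X ω - g (X ω)‖ ^ 2 ∂μ :=
          integral_mono hint' hint fun ω => hnorm _
      _ ≤ k * ε ^ 2 := by
          rw [integral_const_mul]
          exact mul_le_mul_of_nonneg_left hsq (Nat.cast_nonneg k)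
      _ = k / (k + 1) * s := by
          rw [hε, Real.sq_sqrt (div_pos hs hk).le]
          ring
      _ ≤ 1 * s := mul_le_mul_of_nonneg_right ((div_le_one hk).2 (by linarith)) hs.le
      _ = s := one_mul s

variable {k k₀ n : ℕ}

/-- Since `v vᵀ ⪯ (v ⬝ᵥ v) I`, monotonicity bounds the loss by `v ⬝ᵥ v` times the form of `Γ 1`.
Ordinary square error thus controls every distortion. -/
lemma sum_quadCoeff_le {Γ : Mat k →ₗ[ℝ] Mat k₀} (hΓ : IsDistortionMap Γ) {K : ℝ}
    (hK : ∀ u : Vec k₀, u ⬝ᵥ (Γ 1).mulVec u ≤ K * (u ⬝ᵥ u)) (u : Vec k₀) (v : Vec k) :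
    ∑ i, ∑ j, quadCoeff Γ u i j * (v i * v j) ≤ K * (u ⬝ᵥ u) * (v ⬝ᵥ v) := by
  have hv : 0 ≤ v ⬝ᵥ v := Finset.sum_nonneg fun i _ => mul_self_nonneg _
  rw [← dotProduct_map_vecMulVec]
  refine (dotProduct_le_of_psdLE (hΓ.mono _ _ (posSemidef_vecMulVec_self v)
    (Matrix.PosSemidef.one.smul hv) (psdLE_vecMulVec_smul_one v)) u).trans ?_
  rw [map_smul, Matrix.smul_mulVec, dotProduct_smul, smul_eq_mul, mul_comm]
  exact mul_le_mul_of_nonneg_right (hK u) hv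

/-- The quadratic distortion of a quantizer. -/
lemma integral_quadCoeff_le {Ω : Type*} [MeasurableSpace Ω] {μ : Measure Ω}
    {Γ : Mat k →ₗ[ℝ] Mat k₀} (hΓ : IsDistortionMap Γ) {K s : ℝ} (hK0 : 0 ≤ K)
    (hK : ∀ u : Vec k₀, u ⬝ᵥ (Γ 1).mulVec u ≤ K * (u ⬝ᵥ u)) {e : Ω → Vec k} (he : Measurable e)
    (hint : Integrable (fun ω => e ω ⬝ᵥ e ω) μ) (hs : ∫ ω, e ω ⬝ᵥ e ω ∂μ ≤ s) (u : Vec k₀) :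
    Integrable (fun ω => ∑ i, ∑ j, quadCoeff Γ u i j * (e ω i * e ω j)) μ ∧
      ∫ ω, ∑ i, ∑ j, quadCoeff Γ u i j * (e ω i * e ω j) ∂μ ≤ K * s * (u ⬝ᵥ u) := by
  have hu : 0 ≤ u ⬝ᵥ u := Finset.sum_nonneg fun i _ => mul_self_nonneg _
  have h1 : Integrable (fun ω => K * (u ⬝ᵥ u) * (e ω ⬝ᵥ e ω)) μ := hint.const_mul _
  have h2 : Integrable (fun ω => ∑ i, ∑ j, quadCoeff Γ u i j * (e ω i * e ω j)) μ := by
    refine h1.mono' (Measurable.aestronglyMeasurable (by fun_prop))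
      (Filter.Eventually.of_forall fun ω => ?_)
    rw [Real.norm_of_nonneg (quadCoeff_nonneg hΓ u _)]
    exact sum_quadCoeff_le hΓ hK u _
  refine ⟨h2, (integral_mono h2 h1 fun ω => sum_quadCoeff_le hΓ hK u _).trans ?_⟩
  rw [integral_const_mul]
  nlinarith [mul_le_mul_of_nonneg_left hs (mul_nonneg hK0 hu)]

/-- Integrability of the scalar loss comes from that of the entries of the distortion matrix; no
square integrability of the reconstruction is available. -/
lemma integral_distortion_le {Ω : Type*} [MeasurableSpace Ω] {μ : Measure Ω}
    {Γ : Mat k →ₗ[ℝ] Mat k₀} {D : Mat k₀} {X Xhat : Ω → Fin n → Vec k} (hn : 0 < n)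
    (h : MeetsDistortion μ Γ D X Xhat) (u : Vec k₀) :
    Integrable (fun ω => ∑ t, ∑ i, ∑ j, quadCoeff Γ u i j *
      ((X ω t - Xhat ω t) i * (X ω t - Xhat ω t) j)) μ ∧
    (n : ℝ)⁻¹ * ∫ ω, ∑ t, ∑ i, ∑ j, quadCoeff Γ u i j *
      ((X ω t - Xhat ω t) i * (X ω t - Xhat ω t) j) ∂μ ≤ u ⬝ᵥ D.mulVec u := by
  obtain ⟨h1, h2⟩ := h
  have hn' : (n : ℝ) ≠ 0 := Nat.cast_ne_zero.2 hn.ne'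
  set d : Ω → Mat k₀ := fun ω =>
    (n : ℝ)⁻¹ • ∑ t, Γ (Matrix.vecMulVec (X ω t - Xhat ω t) (X ω t - Xhat ω t)) with hd
  have e : ∀ ω, ∑ t, ∑ i, ∑ j, quadCoeff Γ u i j *
      ((X ω t - Xhat ω t) i * (X ω t - Xhat ω t) j) =
      n * ∑ i, ∑ j, u i * (d ω i j * u j) := fun ω => by
    have h3 : ∑ i, ∑ j, u i * (d ω i j * u j) = u ⬝ᵥ (d ω).mulVec u := by
      simp only [dotProduct, Matrix.mulVec, Finset.mul_sum]
    rw [h3, hd]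
    simp only [Matrix.smul_mulVec, dotProduct_smul, smul_eq_mul, Matrix.sum_mulVec, dotProduct_sum,
      dotProduct_map_vecMulVec]
    rw [mul_inv_cancel_left₀ hn']
  have hij : ∀ i j, Integrable (fun ω => u i * (d ω i j * u j)) μ := fun i j =>
    ((h1 i j).mul_const _).const_mul _
  simp only [e]
  refine ⟨(integrable_finsetSum _ fun i _ => integrable_finsetSum _ fun j _ => hij i j).const_mul _,
    ?_⟩
  rw [integral_const_mul, inv_mul_cancel_left₀ hn',
    integral_finsetSum _ fun i _ => integrable_finsetSum _ fun j _ => hij i j]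
  refine le_trans (le_of_eq ?_) (dotProduct_le_of_psdLE h2 u)
  simp only [dotProduct, Matrix.mulVec, Finset.mul_sum]
  refine Finset.sum_congr rfl fun i _ => ?_
  rw [integral_finsetSum _ fun j _ => hij i j]
  refine Finset.sum_congr rfl fun j _ => ?_
  rw [integral_const_mul, integral_mul_const]
  rfl

/-- If the quadratic forms of the distortion of `K` are bounded by those of a time-shared scheme,
then `K` meets the distortion constraint. -/
lemma psdLE_map_of_forall_le {Ω : Type*} [MeasurableSpace Ω] {μ : Measure Ω}
    {Γ : Mat k →ₗ[ℝ] Mat k₀} (hΓ : IsDistortionMap Γ) {D : Mat k₀} (hD : D.PosDef)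
    {X Xhat : Ω → Fin n → Vec k} (hn : 0 < n) {δ ε l : ℝ} (h0 : 0 ≤ δ) (h1 : δ ≤ 1)
    (hε0 : 0 ≤ ε) (hε : ε ≤ δ * (l / 2)) (hl : ∀ u : Vec k₀, l * (u ⬝ᵥ u) ≤ u ⬝ᵥ D.mulVec u)
    (h : MeetsDistortion μ Γ (D + ε • (1 : Mat k₀)) X Xhat) {C : Mat k} (hC : C.PosSemidef)
    (hle : ∀ u : Vec k₀, Integrable (fun ω => ∑ t, ∑ i, ∑ j, quadCoeff Γ u i j *
      ((X ω t - Xhat ω t) i * (X ω t - Xhat ω t) j)) μ →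
      ∑ i, ∑ j, quadCoeff Γ u i j * C i j ≤ (1 - δ) / n * ∫ ω, ∑ t, ∑ i, ∑ j,
        quadCoeff Γ u i j * ((X ω t - Xhat ω t) i * (X ω t - Xhat ω t) j) ∂μ +
        δ * (l / 2 * (u ⬝ᵥ u))) :
    PsdLE (Γ C) D := by
  rw [psdLE_iff_dotProduct (hΓ.posSemidef C hC).1 hD.1]
  intro u
  obtain ⟨k1, k2⟩ := integral_distortion_le hn h u
  rw [dotProduct_map_mulVec]
  have hu : 0 ≤ u ⬝ᵥ u := Finset.sum_nonneg fun i _ => mul_self_nonneg _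
  have k3 := hle u k1
  rw [Matrix.add_mulVec, dotProduct_add, Matrix.smul_mulVec, Matrix.one_mulVec, dotProduct_smul,
    smul_eq_mul] at k2
  rw [div_eq_mul_inv, mul_assoc] at k3
  -- In units of `u ⬝ᵥ u`: (1 - δ)(D + ε) + δ l/2 ≤ (1 - δ) D + δ l/2 + δ l/2 ≤ D, by ε ≤ δ l/2 and
  -- l ≤ D.
  have k4 := mul_le_mul_of_nonneg_left k2 (sub_nonneg.2 h1)
  have k5 : (1 - δ) * (ε * (u ⬝ᵥ u)) ≤ δ * (l / 2) * (u ⬝ᵥ u) :=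
    calc (1 - δ) * (ε * (u ⬝ᵥ u)) ≤ 1 * (ε * (u ⬝ᵥ u)) :=
          mul_le_mul_of_nonneg_right (by linarith) (mul_nonneg hε0 hu)
      _ = ε * (u ⬝ᵥ u) := one_mul _
      _ ≤ _ := mul_le_mul_of_nonneg_right hε hu
  have k6 := mul_le_mul_of_nonneg_left (hl u) h0
  nlinarith [k3, k4, k5, k6]

end GaussSI
namespace GaussSI

/-! ### From codes to auxiliary laws. -/

section Existence

variable {ℰ 𝒜 ℬ 𝒴 𝒩 : Type*}
  [MeasurableSpace ℰ] [StandardBorelSpace ℰ] [Inhabited ℰ]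
  [MeasurableSpace 𝒜] [StandardBorelSpace 𝒜] [Inhabited 𝒜]
  [MeasurableSpace ℬ]
  [MeasurableSpace 𝒴] [StandardBorelSpace 𝒴] [Inhabited 𝒴]
  [MeasurableSpace 𝒩] [StandardBorelSpace 𝒩] [Inhabited 𝒩] {k k₀ : ℕ}
  {ya : ℰ → 𝒜} {yb : ℰ → ℬ} {y : ℰ → 𝒴} {o : ℰ → 𝒩}
  {Q : Measure (Vec k × ℰ)} [IsProbabilityMeasure Q]

lemma sum_shareWeight_mul_indexGap_le {n M L : ℕ} {f : (Fin n → Vec k) → Fin M}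
    {φ : Vec k → Fin L} [Nonempty (Fin M ⊕ Fin L)] (hf : Measurable f) (hφ : Measurable φ)
    (hya : Measurable ya) (hy : Measurable y) (hn : 0 < n) {δ : ℝ} (h0 : 0 ≤ δ) (h1 : δ ≤ 1) :
    ∑ t, (shareWeight n hn δ h0 h1).toMeasure.real {t} * indexGap Q f φ ya y t ≤
      (1 - δ) / n * Real.log M + δ * Real.log L := by
  rw [Fintype.sum_sum_type]
  simp only [shareWeight_real, Sum.elim_inl, Sum.elim_inr, Finset.univ_unique, Finset.sum_singleton,
    ← Finset.mul_sum]
  refine add_le_add (mul_le_mul_of_nonneg_left (sum_indexGap_inl_le hf hφ hya hy)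
    (div_nonneg (by linarith) (Nat.cast_nonneg n)))
    (mul_le_mul_of_nonneg_left (indexGap_inr_le hφ hf hya hy) h0)

/-- Codes of rate close to `R` yield auxiliary variables meeting the constraints of the lower
bound with informations of total at most `R + η`. -/
theorem exists_auxiliary_law (hya : Measurable ya) (hyb : Measurable yb) (hy : Measurable y)
    (ho : Measurable o) {r : 𝒴 × 𝒩 → ℰ} (hr : Measurable r) (hro : ∀ e, r (y e, o e) = e)
    (hCI : CondIndepFun (MeasurableSpace.comap (fun q : Vec k × ℰ => y q.2) inferInstance)
      (hy.comp measurable_snd).comap_le Prod.fst (fun q => o q.2) Q)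
    (hX : ∀ i, MemLp (fun q => q.1 i) 2 Q) {Γa Γb : Mat k →ₗ[ℝ] Mat k₀}
    (hΓa : IsDistortionMap Γa) (hΓb : IsDistortionMap Γb) {Da Db : Mat k₀} (hDa : Da.PosDef)
    (hDb : Db.PosDef) {R : ℝ}
    (hcode : ∀ ε : ℝ, 0 < ε → ∃ (n M : ℕ) (f : (Fin n → Vec k) → Fin M)
      (ga : Fin M × (Fin n → 𝒜) → (Fin n → Vec k)) (gb : Fin M × (Fin n → ℬ) → (Fin n → Vec k)),
      0 < n ∧ Measurable f ∧ Measurable ga ∧ Measurable gb ∧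
      MeetsDistortion (Measure.pi fun _ : Fin n => Q) Γa (Da + ε • (1 : Mat k₀))
        (fun S t => (S t).1) (blockRecon f ga ya) ∧
      MeetsDistortion (Measure.pi fun _ : Fin n => Q) Γb (Db + ε • (1 : Mat k₀))
        (fun S t => (S t).1) (blockRecon f gb yb) ∧
      (n : ℝ)⁻¹ * Real.log M ≤ R + ε) {η : ℝ} (hη : 0 < η) :
    ∃ μ : ProbabilityMeasure ((Vec k × ℰ) × (Vec 1 × Vec 1)),
      (μ : Measure ((Vec k × ℰ) × (Vec 1 × Vec 1))).map Prod.fst = Q ∧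
      CondIndepFun (MeasurableSpace.comap (fun ω : (Vec k × ℰ) × (Vec 1 × Vec 1) => ω.1.1)
        inferInstance) (measurable_fst.comp measurable_fst).comap_le Prod.snd (fun ω => ω.1.2)
        (μ : Measure ((Vec k × ℰ) × (Vec 1 × Vec 1))) ∧
      PsdLE (Γa (condCov (μ : Measure ((Vec k × ℰ) × (Vec 1 × Vec 1))) (fun ω => ω.1.1)
        (fun ω => (ω.2.1, ya ω.1.2)))) Da ∧
      PsdLE (Γb (condCov (μ : Measure ((Vec k × ℰ) × (Vec 1 × Vec 1))) (fun ω => ω.1.1)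
        (fun ω => (ω.2, y ω.1.2)))) Db ∧
      condMutualInfo (μ : Measure ((Vec k × ℰ) × (Vec 1 × Vec 1))) (fun ω => ω.1.1)
          (fun ω => ω.2.1) (fun ω => ya ω.1.2) +
        condMutualInfo (μ : Measure ((Vec k × ℰ) × (Vec 1 × Vec 1))) (fun ω => ω.1.1)
          (fun ω => ω.2.2) (fun ω => (ω.2.1, y ω.1.2)) ≤ ENNReal.ofReal (R + η) := by
  obtain ⟨la, hla, hla'⟩ := exists_le_dotProduct_mulVec hDa
  obtain ⟨lb, hlb, hlb'⟩ := exists_le_dotProduct_mulVec hDb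
  obtain ⟨Ka, hKa, hKa'⟩ := exists_dotProduct_mulVec_le (Γa 1)
  obtain ⟨Kb, hKb, hKb'⟩ := exists_dotProduct_mulVec_le (Γb 1)
  set l := min la lb
  have hl : 0 < l := lt_min hla hlb
  have hu : ∀ u : Vec k₀, 0 ≤ u ⬝ᵥ u := fun u => Finset.sum_nonneg fun i _ => mul_self_nonneg _
  have hla'' : ∀ u : Vec k₀, l * (u ⬝ᵥ u) ≤ u ⬝ᵥ Da.mulVec u := fun u =>
    (mul_le_mul_of_nonneg_right (min_le_left _ _) (hu u)).trans (hla' u)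
  have hlb'' : ∀ u : Vec k₀, l * (u ⬝ᵥ u) ≤ u ⬝ᵥ Db.mulVec u := fun u =>
    (mul_le_mul_of_nonneg_right (min_le_right _ _) (hu u)).trans (hlb' u)
  -- Square error `s` makes the quantizer's distortion at most `l / 2` for both maps at once; the `+
  -- 1` keeps the denominator positive.
  set s := l / (2 * (Ka + Kb + 1)) with hs
  have hspos : 0 < s := div_pos hl (by positivity)
  have hsK : (Ka + Kb + 1) * s = l / 2 := by
    rw [hs]
    field_simp
  obtain ⟨L, φ, dec, hφ, hqi, hqs⟩ := exists_quantizer (X := Prod.fst) measurable_fst hX hspos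
  have hem : Measurable fun q : Vec k × ℰ => q.1 - dec (φ q.1) :=
    measurable_fst.sub ((measurable_of_countable dec).comp (hφ.comp measurable_fst))
  have hquant : ∀ (Γ : Mat k →ₗ[ℝ] Mat k₀) (K : ℝ), IsDistortionMap Γ → 0 ≤ K →
      K ≤ Ka + Kb + 1 → (∀ u : Vec k₀, u ⬝ᵥ (Γ 1).mulVec u ≤ K * (u ⬝ᵥ u)) → ∀ u : Vec k₀,
      Integrable (fun q => ∑ i, ∑ j, quadCoeff Γ u i j * ((q.1 - dec (φ q.1)) i *
        (q.1 - dec (φ q.1)) j)) Q ∧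
      ∫ q, ∑ i, ∑ j, quadCoeff Γ u i j * ((q.1 - dec (φ q.1)) i * (q.1 - dec (φ q.1)) j) ∂Q ≤
        l / 2 * (u ⬝ᵥ u) := by
    intro Γ K hΓ hK0 hK1 hK u
    obtain ⟨k1, k2⟩ := integral_quadCoeff_le hΓ hK0 hK hem hqi hqs u
    refine ⟨k1, k2.trans (mul_le_mul_of_nonneg_right ?_ (hu u))⟩
    rw [← hsK]
    exact mul_le_mul_of_nonneg_right hK1 hspos.le
  have hlogL : 0 ≤ Real.log L := Real.log_natCast_nonneg L
  -- The quantizer, and hence `L`, is fixed before `δ`, `δ` before `ε`, and `ε` before the code. The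
  -- rate excess `η` is split evenly between `δ * Real.log L` and `ε`.
  set δ := min 1 (η / (2 * (Real.log L + 1))) with hδ
  have hδ0 : 0 < δ := lt_min one_pos (div_pos hη (by positivity))
  have hδ1 : δ ≤ 1 := min_le_left _ _
  have hδL : δ * Real.log L ≤ η / 2 := by
    calc δ * Real.log L ≤ δ * (Real.log L + 1) := mul_le_mul_of_nonneg_left (by linarith) hδ0.le
      _ ≤ η / (2 * (Real.log L + 1)) * (Real.log L + 1) :=
        mul_le_mul_of_nonneg_right (min_le_right _ _) (by linarith)
      _ = η / 2 := by field_simp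
  set ε := min (η / 2) (δ * (l / 2)) with hε
  have hε0 : 0 < ε := lt_min (by linarith) (by positivity)
  obtain ⟨n, M, f, ga, gb, hn, hf, hga, hgb, hma, hmb, hrate⟩ := hcode ε hε0
  have : Nonempty (Fin M ⊕ Fin L) := ⟨.inl (f default)⟩
  set w := (shareWeight n hn δ hδ0.le hδ1).toMeasure with hw_def
  set ν := shareLaw Q w with hν
  have hJ := measurable_sharedCodeword (ℰ := ℰ) hf hφ
  have hw := measurable_weakAux (𝒳 := Vec k) (n := n) hya
  have hst := measurable_strongAux (𝒳 := Vec k) (ℰ := ℰ) (n := n)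
  have hX' : ∀ i, MemLp (fun ω => ω.1.1 i) 2 ν := fun i =>
    (hX i).comp_measurePreserving measurePreserving_fst
  have dista : PsdLE (Γa (condCov ν (fun ω => ω.1.1)
      (fun ω => (ya ω.1.2, (sharedCodeword f φ ω, weakAux ya ω.2))))) Da := by
    refine psdLE_map_of_forall_le hΓa hDa hn hδ0.le hδ1 hε0.le (min_le_right _ _) hla'' hma
      (condCov_posSemidef hX' _) fun u hu1 => ?_
    obtain ⟨q1, q2⟩ := hquant Γa Ka hΓa hKa (by linarith) hKa' u
    refine (sum_mul_condCov_weak_le hf hga hφ hya hn hδ0.le hδ1 hX (quadCoeff_nonneg hΓa u) hu1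
      q1).trans ?_
    exact add_le_add_right (mul_le_mul_of_nonneg_left q2 hδ0.le) _
  have distb : PsdLE (Γb (condCov ν (fun ω => ω.1.1)
      (fun ω => (y ω.1.2, (sharedCodeword f φ ω, weakAux ya ω.2, strongAux ω.2))))) Db := by
    refine psdLE_map_of_forall_le hΓb hDb hn hδ0.le hδ1 hε0.le (min_le_right _ _) hlb'' hmb
      (condCov_posSemidef hX' _) fun u hu1 => ?_
    obtain ⟨q1, q2⟩ := hquant Γb Kb hΓb hKb (by linarith) hKb' u
    refine (sum_mul_condCov_strong_le hf hgb hφ hya hyb hy ho hr hro hCI hn hδ0.le hδ1 hX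
      (quadCoeff_nonneg hΓb u) hu1 q1).trans ?_
    exact add_le_add_right (mul_le_mul_of_nonneg_left q2 hδ0.le) _
  -- Encodings with measurable left inverses generate the same σ-algebras, so the covariances are
  -- unchanged and the informations do not increase.
  obtain ⟨eW, dW, heW, hdW, hdeW⟩ := exists_vec_encoding
    ((Fin M ⊕ Fin L) × (ShareIdx n × ((Fin n → ℰ) × (Fin n → 𝒜))))
  obtain ⟨eV, dV, heV, hdV, hdeV⟩ := exists_vec_encoding ((Fin n → Vec k) × (Fin n → ℰ))
  set F : (Vec k × ℰ) × (ShareIdx n × (Fin n → Vec k × ℰ)) → (Vec k × ℰ) × (Vec 1 × Vec 1) :=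
    fun ω => (ω.1, (eW (sharedCodeword f φ ω, weakAux ya ω.2), eV (strongAux ω.2))) with hF_def
  have hF : Measurable F := by fun_prop
  have hXi : ∀ i, Integrable (fun ω => (F ω).1.1 i) ν := fun i =>
    (hX' i).integrable (by norm_num)
  refine ⟨⟨ν.map F, Measure.isProbabilityMeasure_map hF.aemeasurable⟩, ?_, ?_, ?_, ?_, ?_⟩
  · rw [ProbabilityMeasure.coe_mk, Measure.map_map measurable_fst hF]
    exact (measurePreserving_fst (μ := Q)
      (ν := w.prod (Measure.pi fun _ : Fin n => Q))).map_eq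
  · refine condIndepFun_map ν hF measurable_snd (by fun_prop) (by fun_prop) ?_
    exact (condIndepFun_shared_of_source (Q := Q) (w := w) hf hφ hya).comp
      (φ := fun z => (eW (z.1, z.2.1), eV z.2.2)) (by fun_prop) measurable_id
  · rw [ProbabilityMeasure.coe_mk, condCov_map hF (by fun_prop) (by fun_prop) hXi]
    rwa [condCov_eq_of_comp (Z' := fun ω => (ya ω.1.2, (sharedCodeword f φ ω, weakAux ya ω.2)))
      (h := fun z => (eW z.2, z.1)) (h' := fun z => (z.2, dW z.1)) (by fun_prop) (by fun_prop)
      (fun ω => rfl) (fun ω => by simp [hF_def, hdeW])]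
  · rw [ProbabilityMeasure.coe_mk, condCov_map hF (by fun_prop) (by fun_prop) hXi]
    rwa [condCov_eq_of_comp
      (Z' := fun ω => (y ω.1.2, (sharedCodeword f φ ω, weakAux ya ω.2, strongAux ω.2)))
      (h := fun z => ((eW (z.2.1, z.2.2.1), eV z.2.2.2), z.1))
      (h' := fun z => (z.2, (dW z.1.1).1, (dW z.1.1).2, dV z.1.2)) (by fun_prop) (by fun_prop)
      (fun ω => rfl) (fun ω => by simp [hF_def, hdeW, hdeV])]
  · have i1 := condMutualInfo_map_le (ν := ν) hF (A := fun ω => ω.1.1) (B := fun ω => ω.2.1)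
      (C := fun ω => ya ω.1.2) (A₀ := fun ω => ω.1.1)
      (B₀ := fun ω => (sharedCodeword f φ ω, weakAux ya ω.2)) (C₀ := fun ω => ya ω.1.2) (eB := eW)
      (eC := id) (dC := id) (by fun_prop) (by fun_prop) (by fun_prop) (by fun_prop) (by fun_prop)
      heW measurable_id measurable_id (fun _ => rfl) (fun _ => rfl) (fun _ => rfl) (fun _ => rfl)
    have i2 := condMutualInfo_map_le (ν := ν) hF (A := fun ω => ω.1.1) (B := fun ω => ω.2.2)
      (C := fun ω => (ω.2.1, y ω.1.2)) (A₀ := fun ω => ω.1.1) (B₀ := fun ω => strongAux ω.2)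
      (C₀ := fun ω => (sharedCodeword f φ ω, (y ω.1.2, weakAux ya ω.2))) (eB := eV)
      (eC := fun z => (eW (z.1, z.2.2), z.2.1)) (dC := fun z => ((dW z.1).1, (z.2, (dW z.1).2)))
      (by fun_prop) (by fun_prop) (by fun_prop) (by fun_prop) (by fun_prop)
      heV (by fun_prop) (by fun_prop) (fun _ => by simp [hdeW]) (fun _ => rfl) (fun _ => rfl)
      (fun _ => rfl)
    refine (add_le_add i1 i2).trans ((condMutualInfo_shareLaw_le hf hφ hya hy ho hr hro hCI).trans
      (ENNReal.ofReal_le_ofReal ?_))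
    refine (sum_shareWeight_mul_indexGap_le hf hφ hya hy hn hδ0.le hδ1).trans ?_
    have hlogM : 0 ≤ (n : ℝ)⁻¹ * Real.log M :=
      mul_nonneg (by positivity) (Real.log_natCast_nonneg M)
    have hε2 : ε ≤ η / 2 := min_le_left _ _
    have : (1 - δ) / n * Real.log M ≤ (n : ℝ)⁻¹ * Real.log M := by
      rw [div_eq_mul_inv, mul_assoc]
      nlinarith
    linarith

end Existence
end GaussSI
-- Transfer to the spaces of the statement.
namespace GaussSI

/-- Expected distortion depends only on the law, so a code for the original source remains one when
an extra component `Y` is carried along. -/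
lemma MeetsDistortion.of_map {Ω Ω' : Type*} [MeasurableSpace Ω] [MeasurableSpace Ω'] {k k₀ n : ℕ}
    {ν : Measure Ω'} {G : Ω' → Ω} (hG : Measurable G) {Γ : Mat k →ₗ[ℝ] Mat k₀} {D : Mat k₀}
    {X Xhat : Ω → Fin n → Vec k} (h : MeetsDistortion (ν.map G) Γ D X Xhat) :
    MeetsDistortion ν Γ D (fun ω => X (G ω)) (fun ω => Xhat (G ω)) := by
  obtain ⟨h1, h2⟩ := h
  refine ⟨fun i j =>
    (integrable_map_measure (h1 i j).aestronglyMeasurable hG.aemeasurable).1 (h1 i j), ?_⟩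
  simp only [fun i j => integral_map hG.aemeasurable (h1 i j).aestronglyMeasurable] at h2
  exact h2

section

variable {k k₁ k₂ m a b c : ℕ}

namespace AuxSpace

lemma measurable_X : Measurable (X : AuxSpace k k₁ k₂ m a b c → Vec k) :=
  measurable_fst.fst

lemma measurable_Y₁ : Measurable (Y₁ : AuxSpace k k₁ k₂ m a b c → Vec k₁) :=
  measurable_fst.snd.fst

lemma measurable_Y₂ : Measurable (Y₂ : AuxSpace k k₁ k₂ m a b c → Vec k₂) :=
  measurable_fst.snd.snd.fst

lemma measurable_Y : Measurable (Y : AuxSpace k k₁ k₂ m a b c → Vec m) :=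
  measurable_fst.snd.snd.snd

lemma measurable_W : Measurable (W : AuxSpace k k₁ k₂ m a b c → Vec a) :=
  measurable_snd.fst

lemma measurable_U : Measurable (U : AuxSpace k k₁ k₂ m a b c → Vec b) :=
  measurable_snd.snd.fst

lemma measurable_V : Measurable (V : AuxSpace k k₁ k₂ m a b c → Vec c) :=
  measurable_snd.snd.snd

end AuxSpace

/-- Auxiliary vectors `(W, V)`, completed by an empty `U`. -/
def joinV (ω : (Vec k × (Vec k₁ × Vec k₂ × Vec m)) × (Vec 1 × Vec 1)) :
    AuxSpace k k₁ k₂ m 1 0 1 :=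
  (ω.1, (ω.2.1, 0, ω.2.2))

/-- Auxiliary vectors `(W, U)`, completed by an empty `V`. -/
def joinU (ω : (Vec k × (Vec k₁ × Vec k₂ × Vec m)) × (Vec 1 × Vec 1)) :
    AuxSpace k k₁ k₂ m 1 1 0 :=
  (ω.1, (ω.2.1, ω.2.2, 0))

lemma measurable_joinV : Measurable (joinV (k := k) (k₁ := k₁) (k₂ := k₂) (m := m)) := by
  unfold joinV
  fun_prop

lemma measurable_joinU : Measurable (joinU (k := k) (k₁ := k₁) (k₂ := k₂) (m := m)) := by
  unfold joinU
  fun_prop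

end

/-! ### The two halves of the enhancement bound. -/

section Enhancement

variable {k k₁ k₂ k₀ m : ℕ} {P : Measure (Vec k × Vec k₁ × Vec k₂)}
  {Q : ProbabilityMeasure (EnhSpace k k₁ k₂ m)} {Γ₁ Γ₂ : Mat k →ₗ[ℝ] Mat k₀} {D₁ D₂ : Mat k₀}
  {R : ℝ}

/-- Gaussian laws have finite second moments, as required by the quantizer and by the optimality of
the conditional mean. -/
lemma IsGaussianEnhancement.memLp_two (hQ : IsGaussianEnhancement P Q) (i : Fin k) :
    MemLp (fun q : EnhSpace k k₁ k₂ m => q.1 i) 2 (Q : Measure (EnhSpace k k₁ k₂ m)) := by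
  have := hQ.gaussian.1
  have h : MemLp id 2 (Q : Measure (EnhSpace k k₁ k₂ m)) := IsGaussian.memLp_two_id
  exact memLp_pi_iff.1 h.fst i

/-- A code for `(X, Y₁, Y₂)` is a code for `(X, Y₁, Y₂, Y)`. -/
lemma IsGaussianEnhancement.exists_code (hQ : IsGaussianEnhancement P Q)
    (hR : IsAchievable P Γ₁ Γ₂ D₁ D₂ R) {ε : ℝ} (hε : 0 < ε) :
    ∃ (n M : ℕ) (f : (Fin n → Vec k) → Fin M)
      (g₁ : Fin M × (Fin n → Vec k₁) → (Fin n → Vec k))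
      (g₂ : Fin M × (Fin n → Vec k₂) → (Fin n → Vec k)),
      0 < n ∧ Measurable f ∧ Measurable g₁ ∧ Measurable g₂ ∧
      MeetsDistortion (Measure.pi fun _ : Fin n => (Q : Measure (EnhSpace k k₁ k₂ m))) Γ₁
        (D₁ + ε • (1 : Mat k₀)) (fun S t => (S t).1) (blockRecon f g₁ fun e => e.1) ∧
      MeetsDistortion (Measure.pi fun _ : Fin n => (Q : Measure (EnhSpace k k₁ k₂ m))) Γ₂
        (D₂ + ε • (1 : Mat k₀)) (fun S t => (S t).1) (blockRecon f g₂ fun e => e.2.1) ∧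
      (n : ℝ)⁻¹ * Real.log M ≤ R + ε := by
  obtain ⟨n, M, f, g₁, g₂, hc, hr⟩ := hR ε hε
  have hm : Measurable fun q : EnhSpace k k₁ k₂ m => (q.1, q.2.1, q.2.2.1) := by fun_prop
  have hpi : (Measure.pi fun _ : Fin n => P) =
      (Measure.pi fun _ : Fin n => (Q : Measure (EnhSpace k k₁ k₂ m))).map
        (fun S t => ((S t).1, (S t).2.1, (S t).2.2.1)) := by
    have h := Measure.pi_map_pi (μ := fun _ : Fin n => (Q : Measure (EnhSpace k k₁ k₂ m)))
      (f := fun _ q => (q.1, q.2.1, q.2.2.1)) (fun _ => hm.aemeasurable)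
    rw [h, hQ.marginal]
  have hG : Measurable fun (S : Fin n → EnhSpace k k₁ k₂ m) t =>
      ((S t).1, (S t).2.1, (S t).2.2.1) := by fun_prop
  have h1 := hc.distortion₁
  have h2 := hc.distortion₂
  rw [hpi] at h1 h2
  exact ⟨n, M, f, g₁, g₂, hc.blockLength_pos, hc.measurable_f, hc.measurable_g₁, hc.measurable_g₂,
    h1.of_map hG, h2.of_map hG, hr⟩

lemma IsAchievable.nonneg (hR : IsAchievable P Γ₁ Γ₂ D₁ D₂ R) : 0 ≤ R := by
  refine le_of_forall_pos_le_add fun ε hε => ?_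
  obtain ⟨n, M, f, g₁, g₂, -, hr⟩ := hR ε hε
  exact (mul_nonneg (by positivity) (Real.log_natCast_nonneg M)).trans hr

lemma isAuxLaw_map_joinV {μ : ProbabilityMeasure ((Vec k × (Vec k₁ × Vec k₂ × Vec m)) × (Vec 1 ×
    Vec 1))}
    (h1 : (μ : Measure ((Vec k × (Vec k₁ × Vec k₂ × Vec m)) × (Vec 1 × Vec 1))).map Prod.fst =
      (Q : Measure (EnhSpace k k₁ k₂ m)))
    (h2 : CondIndepFun (MeasurableSpace.comap (fun ω => ω.1.1) inferInstance)
      (measurable_fst.comp measurable_fst).comap_le Prod.snd (fun ω => ω.1.2)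
      (μ : Measure ((Vec k × (Vec k₁ × Vec k₂ × Vec m)) × (Vec 1 × Vec 1)))) :
    IsAuxLaw Q (μ.map (f := joinV) measurable_joinV.aemeasurable) where
  marginal := by
    rw [ProbabilityMeasure.toMeasure_map, Measure.map_map measurable_fst measurable_joinV]
    exact h1
  markov := by
    refine ⟨AuxSpace.measurable_X, ?_⟩
    refine condIndepFun_map (μ : Measure ((Vec k × (Vec k₁ × Vec k₂ × Vec m)) × (Vec 1 × Vec 1)))
        measurable_joinV
      (AuxSpace.measurable_W.prodMk (AuxSpace.measurable_U.prodMk AuxSpace.measurable_V))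
      (AuxSpace.measurable_Y.prodMk (AuxSpace.measurable_Y₁.prodMk AuxSpace.measurable_Y₂))
      AuxSpace.measurable_X ?_
    exact h2.comp (φ := fun z => (z.1, (0 : Vec 0), z.2)) (ψ := fun e => (e.2.2, e.1, e.2.1))
      (by fun_prop) (by fun_prop)

lemma condCov_map_joinV_weak {μ : ProbabilityMeasure ((Vec k × (Vec k₁ × Vec k₂ × Vec m)) × (Vec 1
    × Vec 1))}
    (hX : ∀ i, Integrable (fun ω => ω.1.1 i) (μ : Measure ((Vec k × (Vec k₁ × Vec k₂ × Vec m)) ×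
        (Vec 1 × Vec 1)))) :
    condCov ((μ : Measure ((Vec k × (Vec k₁ × Vec k₂ × Vec m)) × (Vec 1 × Vec 1))).map joinV)
        AuxSpace.X
      (fun ω => (AuxSpace.W ω, AuxSpace.U ω, AuxSpace.Y₁ ω)) =
      condCov (μ : Measure ((Vec k × (Vec k₁ × Vec k₂ × Vec m)) × (Vec 1 × Vec 1))) (fun ω =>
          ω.1.1) (fun ω => (ω.2.1, ω.1.2.1)) := by
  rw [condCov_map measurable_joinV (AuxSpace.measurable_W.prodMk
    (AuxSpace.measurable_U.prodMk AuxSpace.measurable_Y₁)) AuxSpace.measurable_X hX]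
  exact condCov_eq_of_comp (h := fun z => (z.1, (0 : Vec 0), z.2)) (h' := fun z => (z.1, z.2.2))
    (by fun_prop) (by fun_prop) (fun _ => rfl) (fun _ => rfl)

lemma condCov_map_joinV_strong {μ : ProbabilityMeasure ((Vec k × (Vec k₁ × Vec k₂ × Vec m)) × (Vec
    1 × Vec 1))}
    (hX : ∀ i, Integrable (fun ω => ω.1.1 i) (μ : Measure ((Vec k × (Vec k₁ × Vec k₂ × Vec m)) ×
        (Vec 1 × Vec 1)))) :
    condCov ((μ : Measure ((Vec k × (Vec k₁ × Vec k₂ × Vec m)) × (Vec 1 × Vec 1))).map joinV)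
        AuxSpace.X
      (fun ω => (AuxSpace.W ω, AuxSpace.U ω, AuxSpace.V ω, AuxSpace.Y ω)) =
      condCov (μ : Measure ((Vec k × (Vec k₁ × Vec k₂ × Vec m)) × (Vec 1 × Vec 1))) (fun ω =>
          ω.1.1) (fun ω => (ω.2, ω.1.2.2.2)) := by
  rw [condCov_map measurable_joinV (AuxSpace.measurable_W.prodMk (AuxSpace.measurable_U.prodMk
    (AuxSpace.measurable_V.prodMk AuxSpace.measurable_Y))) AuxSpace.measurable_X hX]
  exact condCov_eq_of_comp (h := fun z => (z.1.1, (0 : Vec 0), z.1.2, z.2))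
    (h' := fun z => ((z.1, z.2.2.1), z.2.2.2)) (by fun_prop) (by fun_prop)
    (fun _ => rfl) (fun _ => rfl)

lemma Rlo1_map_joinV_le (μ : ProbabilityMeasure ((Vec k × (Vec k₁ × Vec k₂ × Vec m)) × (Vec 1 × Vec
    1))) :
    Rlo1 (μ.map (f := joinV) measurable_joinV.aemeasurable) ≤
      condMutualInfo (μ : Measure ((Vec k × (Vec k₁ × Vec k₂ × Vec m)) × (Vec 1 × Vec 1))) (fun ω
          => ω.1.1) (fun ω => ω.2.1) (fun ω => ω.1.2.1) +
      condMutualInfo (μ : Measure ((Vec k × (Vec k₁ × Vec k₂ × Vec m)) × (Vec 1 × Vec 1))) (fun ω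
          => ω.1.1) (fun ω => ω.2.2) (fun ω => (ω.2.1, ω.1.2.2.2)) := by
  refine add_le_add ?_ ?_
  · exact condMutualInfo_map_le measurable_joinV AuxSpace.measurable_X
      (AuxSpace.measurable_W.prodMk AuxSpace.measurable_U) AuxSpace.measurable_Y₁
      (B₀ := fun ω => ω.2.1) (C₀ := fun ω => ω.1.2.1) (eB := fun z => (z, (0 : Vec 0))) (eC := id)
      (dC := id) (by fun_prop) (by fun_prop) (by fun_prop) measurable_id measurable_id
      (fun _ => rfl) (fun _ => rfl) (fun _ => rfl) (fun _ => rfl)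
  · exact condMutualInfo_map_le measurable_joinV AuxSpace.measurable_X AuxSpace.measurable_V
      (AuxSpace.measurable_W.prodMk (AuxSpace.measurable_U.prodMk AuxSpace.measurable_Y))
      (B₀ := fun ω => ω.2.2) (C₀ := fun ω => (ω.2.1, ω.1.2.2.2)) (eB := id)
      (eC := fun z => (z.1, (0 : Vec 0), z.2)) (dC := fun z => (z.1, z.2.2))
      (by fun_prop) (by fun_prop) measurable_id (by fun_prop) (by fun_prop) (fun _ => rfl)
      (fun _ => rfl) (fun _ => rfl) (fun _ => rfl)

lemma exists_mem_Cl1 (hΓ₁ : IsDistortionMap Γ₁) (hΓ₂ : IsDistortionMap Γ₂) (hD₁ : D₁.PosDef)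
    (hD₂ : D₂.PosDef) (hR : IsAchievable P Γ₁ Γ₂ D₁ D₂ R) (hQ : IsGaussianEnhancement P Q) {η : ℝ}
    (hη : 0 < η) : ∃ μ ∈ Cl1 Γ₁ Γ₂ D₁ D₂ Q 1 0 1, Rlo1 μ ≤ ENNReal.ofReal (R + η) := by
  obtain ⟨_, hCI⟩ := hQ.markov
  -- The full side information is `(Y₁, Y₂, Y)`, split into `Y` and its complement `o = (Y₁, Y₂)`;
  -- `r` reassembles the two. Decoder 1 plays the weak role.
  have key := exists_auxiliary_law (ℰ := Vec k₁ × Vec k₂ × Vec m)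
    (Q := (Q : Measure (EnhSpace k k₁ k₂ m)))
    (ya := fun e => e.1) (yb := fun e => e.2.1) (y := fun e => e.2.2)
    (o := fun e => (e.1, e.2.1)) (r := fun z => (z.2.1, z.2.2, z.1)) (by fun_prop) (by fun_prop)
    (by fun_prop) (by fun_prop) (by fun_prop) (fun _ => rfl) hCI hQ.memLp_two hΓ₁ hΓ₂ hD₁ hD₂
    (fun ε hε => hQ.exists_code hR hε) hη
  obtain ⟨μ, h1, h2, h3, h4, h5⟩ := key
  have hX : ∀ i, Integrable (fun ω => ω.1.1 i) (μ : Measure ((Vec k × (Vec k₁ × Vec k₂ × Vec m)) ×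
      (Vec 1 × Vec 1))) :=
    fun i => by
    have := (hQ.memLp_two i).integrable (by norm_num)
    rw [← h1] at this
    exact this.comp_measurable measurable_fst
  rw [← condCov_map_joinV_weak hX] at h3
  rw [← condCov_map_joinV_strong hX] at h4
  exact ⟨μ.map measurable_joinV.aemeasurable, ⟨isAuxLaw_map_joinV h1 h2, h3, h4⟩,
    (Rlo1_map_joinV_le μ).trans h5⟩

lemma isAuxLaw_map_joinU {μ : ProbabilityMeasure ((Vec k × (Vec k₁ × Vec k₂ × Vec m)) × (Vec 1 ×
    Vec 1))}
    (h1 : (μ : Measure ((Vec k × (Vec k₁ × Vec k₂ × Vec m)) × (Vec 1 × Vec 1))).map Prod.fst =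
      (Q : Measure (EnhSpace k k₁ k₂ m)))
    (h2 : CondIndepFun (MeasurableSpace.comap (fun ω => ω.1.1) inferInstance)
      (measurable_fst.comp measurable_fst).comap_le Prod.snd (fun ω => ω.1.2)
      (μ : Measure ((Vec k × (Vec k₁ × Vec k₂ × Vec m)) × (Vec 1 × Vec 1)))) :
    IsAuxLaw Q (μ.map (f := joinU) measurable_joinU.aemeasurable) where
  marginal := by
    rw [ProbabilityMeasure.toMeasure_map, Measure.map_map measurable_fst measurable_joinU]
    exact h1
  markov := by
    refine ⟨AuxSpace.measurable_X, ?_⟩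
    refine condIndepFun_map (μ : Measure ((Vec k × (Vec k₁ × Vec k₂ × Vec m)) × (Vec 1 × Vec 1)))
        measurable_joinU
      (AuxSpace.measurable_W.prodMk (AuxSpace.measurable_U.prodMk AuxSpace.measurable_V))
      (AuxSpace.measurable_Y.prodMk (AuxSpace.measurable_Y₁.prodMk AuxSpace.measurable_Y₂))
      AuxSpace.measurable_X ?_
    exact h2.comp (φ := fun z => (z.1, z.2, (0 : Vec 0))) (ψ := fun e => (e.2.2, e.1, e.2.1))
      (by fun_prop) (by fun_prop)

lemma condCov_map_joinU_weak {μ : ProbabilityMeasure ((Vec k × (Vec k₁ × Vec k₂ × Vec m)) × (Vec 1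
    × Vec 1))}
    (hX : ∀ i, Integrable (fun ω => ω.1.1 i) (μ : Measure ((Vec k × (Vec k₁ × Vec k₂ × Vec m)) ×
        (Vec 1 × Vec 1)))) :
    condCov ((μ : Measure ((Vec k × (Vec k₁ × Vec k₂ × Vec m)) × (Vec 1 × Vec 1))).map joinU)
        AuxSpace.X
      (fun ω => (AuxSpace.W ω, AuxSpace.V ω, AuxSpace.Y₂ ω)) =
      condCov (μ : Measure ((Vec k × (Vec k₁ × Vec k₂ × Vec m)) × (Vec 1 × Vec 1))) (fun ω =>
          ω.1.1) (fun ω => (ω.2.1, ω.1.2.2.1)) := by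
  rw [condCov_map measurable_joinU (AuxSpace.measurable_W.prodMk
    (AuxSpace.measurable_V.prodMk AuxSpace.measurable_Y₂)) AuxSpace.measurable_X hX]
  exact condCov_eq_of_comp (h := fun z => (z.1, (0 : Vec 0), z.2)) (h' := fun z => (z.1, z.2.2))
    (by fun_prop) (by fun_prop) (fun _ => rfl) (fun _ => rfl)

lemma condCov_map_joinU_strong {μ : ProbabilityMeasure ((Vec k × (Vec k₁ × Vec k₂ × Vec m)) × (Vec
    1 × Vec 1))}
    (hX : ∀ i, Integrable (fun ω => ω.1.1 i) (μ : Measure ((Vec k × (Vec k₁ × Vec k₂ × Vec m)) ×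
        (Vec 1 × Vec 1)))) :
    condCov ((μ : Measure ((Vec k × (Vec k₁ × Vec k₂ × Vec m)) × (Vec 1 × Vec 1))).map joinU)
        AuxSpace.X
      (fun ω => (AuxSpace.W ω, AuxSpace.U ω, AuxSpace.V ω, AuxSpace.Y ω)) =
      condCov (μ : Measure ((Vec k × (Vec k₁ × Vec k₂ × Vec m)) × (Vec 1 × Vec 1))) (fun ω =>
          ω.1.1) (fun ω => (ω.2, ω.1.2.2.2)) := by
  rw [condCov_map measurable_joinU (AuxSpace.measurable_W.prodMk (AuxSpace.measurable_U.prodMk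
    (AuxSpace.measurable_V.prodMk AuxSpace.measurable_Y))) AuxSpace.measurable_X hX]
  exact condCov_eq_of_comp (h := fun z => (z.1.1, z.1.2, (0 : Vec 0), z.2))
    (h' := fun z => ((z.1, z.2.1), z.2.2.2)) (by fun_prop) (by fun_prop)
    (fun _ => rfl) (fun _ => rfl)

lemma Rlo2_map_joinU_le (μ : ProbabilityMeasure ((Vec k × (Vec k₁ × Vec k₂ × Vec m)) × (Vec 1 × Vec
    1))) :
    Rlo2 (μ.map (f := joinU) measurable_joinU.aemeasurable) ≤
      condMutualInfo (μ : Measure ((Vec k × (Vec k₁ × Vec k₂ × Vec m)) × (Vec 1 × Vec 1))) (fun ω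
          => ω.1.1) (fun ω => ω.2.1) (fun ω => ω.1.2.2.1) +
      condMutualInfo (μ : Measure ((Vec k × (Vec k₁ × Vec k₂ × Vec m)) × (Vec 1 × Vec 1))) (fun ω
          => ω.1.1) (fun ω => ω.2.2) (fun ω => (ω.2.1, ω.1.2.2.2)) := by
  refine add_le_add ?_ ?_
  · exact condMutualInfo_map_le measurable_joinU AuxSpace.measurable_X
      (AuxSpace.measurable_W.prodMk AuxSpace.measurable_V) AuxSpace.measurable_Y₂
      (B₀ := fun ω => ω.2.1) (C₀ := fun ω => ω.1.2.2.1) (eB := fun z => (z, (0 : Vec 0))) (eC := id)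
      (dC := id) (by fun_prop) (by fun_prop) (by fun_prop) measurable_id measurable_id
      (fun _ => rfl) (fun _ => rfl) (fun _ => rfl) (fun _ => rfl)
  · exact condMutualInfo_map_le measurable_joinU AuxSpace.measurable_X AuxSpace.measurable_U
      (AuxSpace.measurable_W.prodMk (AuxSpace.measurable_V.prodMk AuxSpace.measurable_Y))
      (B₀ := fun ω => ω.2.2) (C₀ := fun ω => (ω.2.1, ω.1.2.2.2)) (eB := id)
      (eC := fun z => (z.1, (0 : Vec 0), z.2)) (dC := fun z => (z.1, z.2.2))
      (by fun_prop) (by fun_prop) measurable_id (by fun_prop) (by fun_prop) (fun _ => rfl)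
      (fun _ => rfl) (fun _ => rfl) (fun _ => rfl)

lemma exists_mem_Cl2 (hΓ₁ : IsDistortionMap Γ₁) (hΓ₂ : IsDistortionMap Γ₂) (hD₁ : D₁.PosDef)
    (hD₂ : D₂.PosDef) (hR : IsAchievable P Γ₁ Γ₂ D₁ D₂ R) (hQ : IsGaussianEnhancement P Q) {η : ℝ}
    (hη : 0 < η) : ∃ μ ∈ Cl2 Γ₁ Γ₂ D₁ D₂ Q 1 1 0, Rlo2 μ ≤ ENNReal.ofReal (R + η) := by
  obtain ⟨_, hCI⟩ := hQ.markov
  -- Decoder 2 now plays the weak role, so the decoders, distortion maps and bounds are exchanged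
  -- and `U` takes the place of `V`.
  have key := exists_auxiliary_law (ℰ := Vec k₁ × Vec k₂ × Vec m)
    (Q := (Q : Measure (EnhSpace k k₁ k₂ m)))
    (ya := fun e => e.2.1) (yb := fun e => e.1) (y := fun e => e.2.2)
    (o := fun e => (e.1, e.2.1)) (r := fun z => (z.2.1, z.2.2, z.1)) (by fun_prop) (by fun_prop)
    (by fun_prop) (by fun_prop) (by fun_prop) (fun _ => rfl) hCI hQ.memLp_two hΓ₂ hΓ₁ hD₂ hD₁
    (fun ε hε => by
      obtain ⟨n, M, f, g₁, g₂, hn, hf, hg₁, hg₂, hm₁, hm₂, hr⟩ := hQ.exists_code hR hε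
      exact ⟨n, M, f, g₂, g₁, hn, hf, hg₂, hg₁, hm₂, hm₁, hr⟩) hη
  obtain ⟨μ, h1, h2, h3, h4, h5⟩ := key
  have hX : ∀ i, Integrable (fun ω => ω.1.1 i) (μ : Measure ((Vec k × (Vec k₁ × Vec k₂ × Vec m)) ×
      (Vec 1 × Vec 1))) :=
    fun i => by
    have := (hQ.memLp_two i).integrable (by norm_num)
    rw [← h1] at this
    exact this.comp_measurable measurable_fst
  rw [← condCov_map_joinU_weak hX] at h3
  rw [← condCov_map_joinU_strong hX] at h4
  exact ⟨μ.map measurable_joinU.aemeasurable, ⟨isAuxLaw_map_joinU h1 h2, h4, h3⟩,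
    (Rlo2_map_joinU_le μ).trans h5⟩

/-- The enhancement bound is a lower bound for the achievable rates. -/
lemma enhancementBound_le_of_isAchievable (hΓ₁ : IsDistortionMap Γ₁) (hΓ₂ : IsDistortionMap Γ₂)
    (hD₁ : D₁.PosDef) (hD₂ : D₂.PosDef) (hR : IsAchievable P Γ₁ Γ₂ D₁ D₂ R) :
    enhancementBound P Γ₁ Γ₂ D₁ D₂ ≤ ENNReal.ofReal R := by
  have hR0 := hR.nonneg
  refine max_le (iSup_le fun m => iSup_le fun Q => iSup_le fun hQ => ?_)
    (iSup_le fun m => iSup_le fun Q => iSup_le fun hQ => ?_) <;>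
  refine ENNReal.le_of_forall_pos_le_add fun η hη _ => ?_
  · obtain ⟨μ, hμ, hle⟩ := exists_mem_Cl1 hΓ₁ hΓ₂ hD₁ hD₂ hR hQ (η := η) (by exact_mod_cast hη)
    rw [ENNReal.ofReal_add hR0 η.coe_nonneg, ENNReal.ofReal_coe_nnreal] at hle
    exact (iInf_le_of_le (1 : ℕ) <| iInf_le_of_le (0 : ℕ) <| iInf_le_of_le (1 : ℕ) <|
      iInf₂_le_of_le μ hμ hle)
  · obtain ⟨μ, hμ, hle⟩ := exists_mem_Cl2 hΓ₁ hΓ₂ hD₁ hD₂ hR hQ (η := η) (by exact_mod_cast hη)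
    rw [ENNReal.ofReal_add hR0 η.coe_nonneg, ENNReal.ofReal_coe_nnreal] at hle
    exact (iInf_le_of_le (1 : ℕ) <| iInf_le_of_le (1 : ℕ) <| iInf_le_of_le (0 : ℕ) <|
      iInf₂_le_of_le μ hμ hle)

end Enhancement
end GaussSI
theorem mainTheorem7 {k k₁ k₂ k₀ : ℕ}
    (P : Measure (GaussSI.Vec k × GaussSI.Vec k₁ × GaussSI.Vec k₂))
    (hP : GaussSI.IsCenteredGaussian P)
    (hK₁ : IsUnit (GaussSI.condCov P (fun p => p.1) (fun p => p.2.1)))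
    (hK₂ : IsUnit (GaussSI.condCov P (fun p => p.1) (fun p => p.2.2)))
    (Γ₁ Γ₂ : GaussSI.Mat k →ₗ[ℝ] GaussSI.Mat k₀)
    (hΓ₁ : GaussSI.IsDistortionMap Γ₁) (hΓ₂ : GaussSI.IsDistortionMap Γ₂)
    (D₁ D₂ : GaussSI.Mat k₀) (hD₁ : D₁.PosDef) (hD₂ : D₂.PosDef) :
    ((GaussSI.enhancementBound P Γ₁ Γ₂ D₁ D₂ : ENNReal) : EReal) ≤
      GaussSI.rateDistortion P Γ₁ Γ₂ D₁ D₂ := by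
  refine le_sInf ?_
  rintro _ ⟨R, hR, rfl⟩
  have h := GaussSI.enhancementBound_le_of_isAchievable hΓ₁ hΓ₂ hD₁ hD₂ hR
  -- Achievable rates are nonnegative, so truncation by `ENNReal.ofReal` loses nothing.
  rw [← EReal.coe_ennreal_le_coe_ennreal_iff, EReal.coe_ennreal_ofReal, max_eq_left hR.nonneg] at h
  exact h
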